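/- There is an absolute constant $C>0$ such that the following holds for all integers $M\ge 1$ and $0\le n\le M$ and all real $\rho>0$, $r>0$ and $0<s_{\min}\le s_{\max}$. Let $M$ devices move on a sphere of radius $\rho$ (area $4\pi\rho^2$) by the random waypoint model without pauses: the initial position of each device is uniform on the sphere; a device repeatedly picks a target uniformly on the sphere and a speed uniformly in $[s_{\min},s_{\max}]$, and travels at this speed along the shorter great-circle arc to the target. Independently, a set of $n$ caching devices is chosen uniformly among all $n$-element sets of devices. All these choices are independent. Two devices are in contact when their distance along the sphere is at most $r$. Put $$s=\frac{2(s_{\max}+s_{\min})}{\pi},\qquad \lambda=(M-1)\frac{2rs}{4\pi\rho^2},\qquad \mu=\frac{2s}{\pi r},\qquad q_j=\frac{\left(\frac{\lambda}{\mu}\cdot\frac nM\right)^j}{j!}\,e^{-\frac{\lambda}{\mu}\cdot\frac nM}\quad(j\ge 0),$$ and $\delta=C\left(\frac{r}{2\rho}\right)^2+\frac{s_{\max}-s_{\min}}{s_{\max}+s_{\min}}$. Then for every device $i$: 1. (The number of caching devices in range is approximately Poisson with mean $\frac{\lambda}{\mu}\cdot\frac nM$.) For every time $t\ge 0$ and every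 $j\ge 0$, if $N_i(t)$ denotes the number of caching devices other than $i$ that are in contact with $i$ at time $t$, then $\left|\Pr(N_i(t)=j)-q_j\right|\le C\left(\frac{r}{2\rho}\right)^2$. 2. ($\lambda$ is approximately the aggregate arrival rate.) For all $0\le a<b$, the expected number of contacts of $i$ with other devices that begin during $(a,b]$, divided by $b-a$, is finite and differs from $\lambda$ by at most $\delta\lambda$. 3. ($\mu$ is approximately the departure rate.) For all $0\le a<b$, the expected number of contacts of $i$ with other devices that end during $(a,b]$ and the expected total time, summed over the other devices, spent in contact with $i$ during $(a,b]$ are finite; and if $M\ge2$, the latter is positive and the quotient of the former by the latter differs from $\mu$ by at most $\delta\mu$. -/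

import Mathlib

open MeasureTheory Set

namespace RandomWaypoint

/-- Euclidean three-space. -/
abbrev Space : Type := EuclideanSpace ℝ (Fin 3)

/-- The unit sphere. The point `ρ • u` of the sphere of radius `ρ` about the origin is represented
by the unit vector `u`. -/
abbrev UnitSphere : Type := Metric.sphere (0 : Space) 1

/-- The uniform distribution (normalized surface measure) on the sphere. -/
noncomputable def uniformSphere : Measure UnitSphere :=
  ((volume : Measure Space).toSphere univ)⁻¹ • (volume : Measure Space).toSphere

instance : IsProbabilityMeasure uniformSphere := by
  refine ⟨?_⟩
  rw [uniformSphere, Measure.smul_apply, smul_eq_mul]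
  refine ENNReal.inv_mul_cancel ?_ (measure_ne_top _ _)
  exact (Measure.measure_univ_ne_zero).2 (Measure.toSphere_ne_zero _)

/-- The uniform distribution on `[smin, smax]` (a point mass if `smin = smax`), as the law of
`smin + (smax - smin) * U` with `U` uniform on `[0, 1]`. -/
noncomputable def uniformSpeed (smin smax : ℝ) : Measure ℝ :=
  Measure.map (fun u : ℝ => smin + (smax - smin) * u) (volume.restrict (Icc (0 : ℝ) 1))

instance (smin smax : ℝ) : IsProbabilityMeasure (uniformSpeed smin smax) := by
  have : IsProbabilityMeasure (volume.restrict (Icc (0 : ℝ) 1)) := ⟨by simp⟩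
  exact Measure.isProbabilityMeasure_map (by fun_prop)

/-- Distance, measured along the sphere of radius `ρ`, of the points `ρ • u` and `ρ • v`. -/
noncomputable def geoDist (ρ : ℝ) (u v : Space) : ℝ :=
  ρ * InnerProductGeometry.angle u v

/-- The unit vector reached from the unit vector `u` by travelling the angle `φ` along the great
circle through `u` and `v`, in the direction of the shorter arc from `u` to `v`. -/
noncomputable def greatCircle (u v : Space) (φ : ℝ) : Space :=
  Real.cos φ • u +
    Real.sin φ • (‖v - inner ℝ u v • u‖⁻¹ • (v - inner ℝ u v • u))

/-- The random choices of one device: `(d l).1` is its `l`-th waypoint (`(d 0).1` is its initial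
position, the later ones are its successive targets), and `(d l).2` is its speed on leg `l`, which
leads from waypoint `l` to waypoint `l + 1`. -/
abbrev Itinerary : Type := ℕ → UnitSphere × ℝ

/-- The duration of leg `l`. -/
noncomputable def legTime (ρ : ℝ) (d : Itinerary) (l : ℕ) : ℝ :=
  geoDist ρ (d l).1 (d (l + 1)).1 / (d l).2

/-- The time at which waypoint `l` is reached; there are no pauses. -/
noncomputable def waypointTime (ρ : ℝ) (d : Itinerary) (l : ℕ) : ℝ :=
  ∑ i ∈ Finset.range l, legTime ρ d i

/-- The leg on which the device is at time `t`. -/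
noncomputable def currentLeg (ρ : ℝ) (d : Itinerary) (t : ℝ) : ℕ :=
  sSup {l : ℕ | waypointTime ρ d l ≤ t}

/-- The position at time `t`, as a unit vector. -/
noncomputable def position (ρ : ℝ) (d : Itinerary) (t : ℝ) : Space :=
  greatCircle (d (currentLeg ρ d t)).1 (d (currentLeg ρ d t + 1)).1
    ((d (currentLeg ρ d t)).2 * (t - waypointTime ρ d (currentLeg ρ d t)) / ρ)

/-- An outcome of the model with `M` devices: the waypoints and speeds of all devices, and the set
of the devices that cache a packet of the file. -/
abbrev Outcome (M : ℕ) : Type := (Fin M × ℕ → UnitSphere × ℝ) × Finset (Fin M)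

/-- The law of the model: all waypoints (initial positions and targets) are uniform on the sphere,
all speeds are uniform on `[smin, smax]`, the set of caching devices is a uniformly chosen set of
`n` of the `M` devices, and all of these are independent. -/
noncomputable def law (M n : ℕ) (smin smax : ℝ) : Measure (Outcome M) :=
  (Measure.infinitePi fun _ : Fin M × ℕ => uniformSphere.prod (uniformSpeed smin smax)).prod
    (ProbabilityTheory.uniformOn {S : Finset (Fin M) | S.card = n})

/-- Devices `i` and `k` are at time `t` within the communication range `r` of each other. -/
def InRange {M : ℕ} (ρ r : ℝ) (ω : Outcome M) (i k : Fin M) (t : ℝ) : Prop :=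
  geoDist ρ (position ρ (fun l => ω.1 (i, l)) t) (position ρ (fun l => ω.1 (k, l)) t) ≤ r

/-- The devices, other than `i`, within range of device `i` at time `t`. -/
def neighbours {M : ℕ} (ρ r : ℝ) (ω : Outcome M) (i : Fin M) (t : ℝ) : Set (Fin M) :=
  {k | k ≠ i ∧ InRange ρ r ω i k t}

/-- The number of devices, other than `i`, within range of device `i` at time `t`. -/
noncomputable def deviceCount {M : ℕ} (ρ r : ℝ) (ω : Outcome M) (i : Fin M) (t : ℝ) : ℕ :=
  (neighbours ρ r ω i t).ncard

/-- The number of caching devices, other than `i`, within range of device `i` at time `t`. -/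
noncomputable def cachingCount {M : ℕ} (ρ r : ℝ) (ω : Outcome M) (i : Fin M) (t : ℝ) : ℕ :=
  (neighbours ρ r ω i t ∩ ω.2).ncard

/-- At time `t` a contact of the devices `i` and `k` begins. -/
def ContactBegins {M : ℕ} (ρ r : ℝ) (ω : Outcome M) (i k : Fin M) (t : ℝ) : Prop :=
  InRange ρ r ω i k t ∧ ∀ᶠ u in nhdsWithin t (Iio t), ¬ InRange ρ r ω i k u

/-- At time `t` a contact of the devices `i` and `k` ends. -/
def ContactEnds {M : ℕ} (ρ r : ℝ) (ω : Outcome M) (i k : Fin M) (t : ℝ) : Prop :=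
  InRange ρ r ω i k t ∧ ∀ᶠ u in nhdsWithin t (Ioi t), ¬ InRange ρ r ω i k u

open Classical in
/-- The number of arrivals of devices to within range of device `i` during `(a, b]`. -/
noncomputable def arrivals {M : ℕ} (ρ r : ℝ) (ω : Outcome M) (i : Fin M) (a b : ℝ) : ENNReal :=
  ∑ k ∈ Finset.univ.erase i, (({t ∈ Ioc a b | ContactBegins ρ r ω i k t}.encard : ℕ∞) : ENNReal)

open Classical in
/-- The number of departures of devices from the range of device `i` during `(a, b]`. -/
noncomputable def departures {M : ℕ} (ρ r : ℝ) (ω : Outcome M) (i : Fin M) (a b : ℝ) : ENNReal :=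
  ∑ k ∈ Finset.univ.erase i, (({t ∈ Ioc a b | ContactEnds ρ r ω i k t}.encard : ℕ∞) : ENNReal)

/-- The total time, summed over the devices other than `i`, that is spent within range of device
`i` during `(a, b]`. -/
noncomputable def contactTime {M : ℕ} (ρ r : ℝ) (ω : Outcome M) (i : Fin M) (a b : ℝ) : ENNReal :=
  ∫⁻ t in Ioc a b, (deviceCount ρ r ω i t : ENNReal)

/-- The approximate average relative speed `s` of two devices. -/
noncomputable def relSpeed (smin smax : ℝ) : ℝ := 2 * (smax + smin) / Real.pi

/-- The aggregate arrival rate `λ`. -/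
noncomputable def arrivalRate (M : ℕ) (ρ r smin smax : ℝ) : ℝ :=
  ((M : ℝ) - 1) * (2 * r * relSpeed smin smax / (4 * Real.pi * ρ ^ 2))

/-- The departure rate `μ`. -/
noncomputable def departureRate (r smin smax : ℝ) : ℝ :=
  2 * relSpeed smin smax / (Real.pi * r)

/-- The Poisson probability `q j` with mean `(λ / μ) * (n / M)`. -/
noncomputable def q (M n : ℕ) (ρ r smin smax : ℝ) (j : ℕ) : ℝ :=
  (arrivalRate M ρ r smin smax / departureRate r smin smax * ((n : ℝ) / M)) ^ j / (j.factorial : ℝ) *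
    Real.exp (-(arrivalRate M ρ r smin smax / departureRate r smin smax * ((n : ℝ) / M)))

end RandomWaypoint

/-!
All three parts rest on the invariance of the law of the waypoints under independent rotations of
the sphere: an expectation may first be averaged over a Haar-random rotation `R` of the itinerary of
one device (`lintegral_turn`). Given everything else, the pair (position, heading) of that device is
then a uniformly random frame, at every time. By Archimedes' theorem the height `⟪p, R q⟫` of one
position over the other is uniform on `[-1, 1]` (`map_inner_haar`), and the two tangential
components that make up its derivative point in independent uniform directions
(`lintegral_haar_frame`). Devices are in contact when the height is at least `cos (r / ρ)`.

*Rates.* Beginnings of contacts are crossings of the level `c = cos (r / ρ)` by the height from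
below; ends are the same after time reversal (`encard_contactEnds_eq`). The interval `(a, b]` is cut
into short pieces. On a piece where no device changes its leg, the height is linear up to a second
order error, and the frame computation gives the probability of a crossing; the pieces with a change
of leg contribute nothing in the limit, since the number of changes of leg is finite
(`tendsto_sum_legChange`). This is Rice's formula, with the angular speeds known only to lie in
`[smin / ρ, smax / ρ]`: as the mean rate of approach is monotone in the speeds (`meanApproach_mono`),
evaluating it at equal speeds (`meanApproach_self`) bounds the expected number of crossings between
its values for `smin` and `smax` (`exists_majorant_entries`, `le_lintegral_encard_entries`). The
expected contact time is a cap area (`lintegral_contactTime`). What remains of the statements on `λ`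
and `μ` is that `sin α` is close to `α`, and `x cot x` to `1`.

*Poisson approximation.* Independent rotations of the other devices show that the number of caching
devices in range is binomial, given the set of caching devices, with success probability
`p = sin² (r / (2 ρ))` when `r ≤ π ρ` (`integral_pow_cachingCount`). An error of order `p` that does
not grow with the number `m` of trials comes from Fourier inversion: at `e ^ (i θ)` the binomial and
Poisson characteristic functions both decay like `exp (- m p (1 - cos θ) / 2)`, which absorbs the
factor `m` in the difference of the two (`norm_pow_sub_cexp_le`). Replacing the mean `m p` by the
mean in the statement is treated the same way.
-/

open scoped Pointwise

namespace RandomWaypoint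

/-! ### Random rotations of the sphere -/

/-- The orthogonal group of three-space, realised as the unitary operators; reflections are
included. -/
abbrev Rot : Type := unitary (Space →L[ℝ] Space)

instance : ContinuousStar (Space →L[ℝ] Space) :=
  ⟨(ContinuousLinearMap.adjoint (𝕜 := ℝ) (E := Space) (F := Space)).continuous⟩

instance : IsTopologicalGroup Rot where
  continuous_inv := by
    refine Continuous.subtype_mk (f := fun R : Rot => star (R : Space →L[ℝ] Space)) ?_ _
    exact continuous_star.comp continuous_subtype_val

namespace Rot

theorem inner_map_map (R : Rot) (x y : Space) : inner ℝ (R.1 x) (R.1 y) = inner ℝ x y :=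
  (Unitary.linearIsometryEquiv R).inner_map_map x y

theorem norm_map (R : Rot) (x : Space) : ‖R.1 x‖ = ‖x‖ :=
  (Unitary.linearIsometryEquiv R).norm_map x

theorem angle_map_map (R : Rot) (x y : Space) :
    InnerProductGeometry.angle (R.1 x) (R.1 y) = InnerProductGeometry.angle x y := by
  simp only [InnerProductGeometry.angle, inner_map_map, norm_map]

theorem inner_map_inv_right (R : Rot) (x y : Space) :
    inner ℝ x (R.1 y) = inner ℝ ((R⁻¹ : Rot).1 x) y := by
  rw [← inner_map_map R⁻¹ x (R.1 y)]
  congr 1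
  change ((R⁻¹ * R : Rot).1) y = y
  simp

theorem mul_apply (R S : Rot) (x : Space) : (R * S).1 x = R.1 (S.1 x) := rfl

theorem isCompact_carrier : IsCompact (unitary (Space →L[ℝ] Space) : Set (Space →L[ℝ] Space)) := by
  refine Metric.isCompact_of_isClosed_isBounded ?_ ?_
  · have : (unitary (Space →L[ℝ] Space) : Set (Space →L[ℝ] Space)) =
        {T | star T * T = 1} ∩ {T | T * star T = 1} := by
      ext T; simp [Unitary.mem_iff]
    rw [this]
    exact (isClosed_eq (by fun_prop) continuous_const).inter
      (isClosed_eq (by fun_prop) continuous_const)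
  · rw [isBounded_iff_forall_norm_le]
    refine ⟨1, fun T hT => ?_⟩
    refine ContinuousLinearMap.opNorm_le_bound _ zero_le_one fun x => ?_
    rw [one_mul]
    exact (norm_map ⟨T, hT⟩ x).le

instance : CompactSpace Rot := isCompact_iff_compactSpace.1 isCompact_carrier

/-- The normalised Haar measure on the orthogonal group. -/
noncomputable def haar : Measure Rot := Measure.haarMeasure ⊤

instance : haar.IsHaarMeasure := by unfold haar; infer_instance

instance : IsProbabilityMeasure haar :=
  ⟨by simpa [haar] using (Measure.haarMeasure_self (K₀ := (⊤ : TopologicalSpace.PositiveCompacts Rot)))⟩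

instance : haar.IsMulRightInvariant where
  map_mul_right_eq_self g := by
    have : IsProbabilityMeasure (haar.map (· * g)) :=
      Measure.isProbabilityMeasure_map (by fun_prop)
    have : (haar.map (· * g)).IsHaarMeasure := by
      have := isMulLeftInvariant_map_mul_right (μ := haar) g
      exact Measure.isHaarMeasure_of_isCompact_nonempty_interior _ univ isCompact_univ (by simp) (by simp) (by simp)
    exact Measure.isHaarMeasure_eq_of_isProbabilityMeasure _ _

theorem continuous_apply : Continuous fun q : Rot × Space => q.1.1 q.2 := by fun_prop

@[fun_prop]
theorem measurable_apply {α : Type*} [MeasurableSpace α] {f : α → Rot} {g : α → Space}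
    (hf : Measurable f) (hg : Measurable g) : Measurable fun a => (f a).1 (g a) :=
  continuous_apply.measurable.comp (hf.prodMk hg)

/-- The action of the orthogonal group on the unit sphere. -/
def onSphere (R : Rot) (u : UnitSphere) : UnitSphere :=
  ⟨R.1 u.1, by have := u.2; simp only [mem_sphere_zero_iff_norm] at this ⊢; rw [norm_map, this]⟩

theorem measurable_onSphere {α : Type*} [MeasurableSpace α] {f : α → Rot} {g : α → UnitSphere}
    (hf : Measurable f) (hg : Measurable g) : Measurable fun a => onSphere (f a) (g a) :=
  (measurable_apply hf (measurable_subtype_coe.comp hg)).subtype_mk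

theorem exists_map_basis (b b' : OrthonormalBasis (Fin 3) ℝ Space) :
    ∃ R : Rot, ∀ i, R.1 (b i) = b' i :=
  ⟨Unitary.linearIsometryEquiv.symm (b.equiv b' (Equiv.refl _)), fun i => by simp⟩

theorem exists_basis {p p₁ : Space} (hp : ‖p‖ = 1) (hp₁ : ‖p₁‖ = 1) (h : inner ℝ p p₁ = 0) :
    ∃ b : OrthonormalBasis (Fin 3) ℝ Space, b 0 = p ∧ b 1 = p₁ := by
  obtain ⟨b, hb⟩ := Orthonormal.exists_orthonormalBasis_extension_of_card_eq (𝕜 := ℝ) (E := Space)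
    (ι := Fin 3) (by simp) (v := ![p, p₁, 0]) (s := {0, 1}) (by
      have h' : inner ℝ p₁ p = 0 := by rw [real_inner_comm]; exact h
      constructor
      · rintro ⟨i, hi⟩
        rcases hi with rfl | rfl <;> simp [hp, hp₁]
      · rintro ⟨i, hi⟩ ⟨j, hj⟩ hij
        rcases hi with rfl | rfl <;> rcases hj with rfl | rfl <;> simp_all)
  exact ⟨b, by simpa using hb 0 (by simp), by simpa using hb 1 (by simp)⟩

theorem exists_basis_one {p : Space} (hp : ‖p‖ = 1) :
    ∃ b : OrthonormalBasis (Fin 3) ℝ Space, b 0 = p := by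
  obtain ⟨b, hb⟩ := Orthonormal.exists_orthonormalBasis_extension_of_card_eq (𝕜 := ℝ) (E := Space)
    (ι := Fin 3) (by simp) (v := ![p, 0, 0]) (s := {0}) (by
      constructor
      · rintro ⟨i, hi⟩
        rcases hi with rfl; simp [hp]
      · rintro ⟨i, hi⟩ ⟨j, hj⟩ hij
        rcases hi with rfl; rcases hj with rfl; simp_all)
  exact ⟨b, by simpa using hb 0 (by simp)⟩

theorem exists_map_eq {p q : Space} (hp : ‖p‖ = 1) (hq : ‖q‖ = 1) : ∃ R : Rot, R.1 p = q := by
  obtain ⟨b, rfl⟩ := exists_basis_one hp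
  obtain ⟨b', rfl⟩ := exists_basis_one hq
  obtain ⟨R, hR⟩ := exists_map_basis b b'
  exact ⟨R, hR 0⟩

theorem image_onSphere (R : Rot) (s : Set UnitSphere) :
    (Subtype.val '' (onSphere R ⁻¹' s) : Set Space) =
      (Unitary.linearIsometryEquiv R) ⁻¹' (Subtype.val '' s) := by
  ext x
  constructor
  · rintro ⟨u, hu, rfl⟩
    exact ⟨onSphere R u, hu, rfl⟩
  · rintro ⟨v, hv, hx⟩
    have hx' : R.1 x = v.1 := hx.symm
    have : ‖x‖ = 1 := by
      rw [← norm_map R x, hx']; exact mem_sphere_zero_iff_norm.1 v.2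
    exact ⟨⟨x, mem_sphere_zero_iff_norm.2 this⟩, by
      change onSphere R ⟨x, _⟩ ∈ s
      convert hv using 1
      exact Subtype.ext hx', rfl⟩

theorem measurePreserving_onSphere (R : Rot) :
    MeasurePreserving (onSphere R) uniformSphere uniformSphere := by
  have hm : Measurable (onSphere R) := measurable_onSphere measurable_const measurable_id
  refine ⟨hm, ?_⟩
  unfold uniformSphere
  rw [Measure.map_smul]
  congr 1
  ext s hs
  rw [Measure.map_apply hm hs, Measure.toSphere_apply' _ hs, Measure.toSphere_apply' _ (hm hs),
    image_onSphere]
  congr 1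
  rw [← (Unitary.linearIsometryEquiv R).measurePreserving.measure_preimage_emb
    (Unitary.linearIsometryEquiv R).toHomeomorph.measurableEmbedding
    (Ioo (0 : ℝ) 1 • (Subtype.val '' s))]
  congr 1
  ext x
  simp only [mem_smul, mem_preimage]
  constructor
  · rintro ⟨a, ha, y, hy, rfl⟩
    exact ⟨a, ha, _, hy, by simp⟩
  · rintro ⟨a, ha, y, hy, hxy⟩
    refine ⟨a, ha, (Unitary.linearIsometryEquiv R).symm y, by simpa using hy, ?_⟩
    apply (Unitary.linearIsometryEquiv R).injective
    rw [map_smul, LinearIsometryEquiv.apply_symm_apply, hxy]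

/-- The orbit map of the orthogonal group sends Haar measure to the uniform law on the sphere. -/
theorem map_haar_onSphere (q : UnitSphere) : haar.map (fun R => onSphere R q) = uniformSphere := by
  have hm : ∀ q, Measurable fun R => onSphere R q := fun q =>
    measurable_onSphere measurable_id measurable_const
  have hconst : ∀ q q' : UnitSphere, haar.map (fun R => onSphere R q) =
      haar.map (fun R => onSphere R q') := by
    intro q q'
    obtain ⟨S, hS⟩ := exists_map_eq (mem_sphere_zero_iff_norm.1 q.2) (mem_sphere_zero_iff_norm.1 q'.2)
    have h1 : (fun R => onSphere R q') = (fun R => onSphere R q) ∘ (· * S) := by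
      funext R
      apply Subtype.ext
      simp [onSphere, ← hS]
    rw [h1, ← Measure.map_map (hm q) (by fun_prop), map_mul_right_eq_self]
  ext s hs
  have h2 : ∫⁻ q', (haar.map (fun R => onSphere R q')) s ∂uniformSphere =
      haar.map (fun R => onSphere R q) s := by
    simp_rw [fun q' => hconst q' q]
    simp
  rw [← h2]
  have hm2 : Measurable fun x : UnitSphere × Rot => onSphere x.2 x.1 :=
    measurable_onSphere measurable_snd measurable_fst
  have h3 : ∀ q', (haar.map (fun R => onSphere R q')) s =
      ∫⁻ R, s.indicator 1 (onSphere R q') ∂haar := by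
    intro q'
    rw [← lintegral_map (f := s.indicator 1) (measurable_one.indicator hs) (hm q'),
      lintegral_indicator_one hs]
  simp_rw [h3]
  rw [lintegral_lintegral_swap]
  · have h4 : ∀ R, ∫⁻ q', s.indicator 1 (onSphere R q') ∂uniformSphere = uniformSphere s := by
      intro R
      rw [(measurePreserving_onSphere R).lintegral_comp (measurable_one.indicator hs),
        lintegral_indicator_one hs]
    simp_rw [h4]
    simp
  · exact ((measurable_one.indicator hs).comp hm2).aemeasurable

end Rot

/-! ### Archimedes' hat-box theorem -/

theorem smul_cap_eq (e : Space) (c : ℝ) :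
    (Ioo (0 : ℝ) 1 • (Subtype.val '' {u : UnitSphere | c ≤ inner ℝ e u.1}) : Set Space) =
      {x | 0 < ‖x‖ ∧ ‖x‖ < 1 ∧ c * ‖x‖ ≤ inner ℝ e x} := by
  ext x
  simp only [mem_smul, mem_ofPred_eq]
  constructor
  · rintro ⟨a, ha, _, ⟨u, hu, rfl⟩, rfl⟩
    have h1 : ‖(u : Space)‖ = 1 := mem_sphere_zero_iff_norm.1 u.2
    simp only [mem_ofPred_eq] at hu
    rw [norm_smul, h1, mul_one, Real.norm_of_nonneg ha.1.le, real_inner_smul_right]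
    refine ⟨ha.1, ha.2, ?_⟩
    nlinarith [ha.1]
  · rintro ⟨h0, h1, h2⟩
    refine ⟨‖x‖, ⟨h0, h1⟩, ‖x‖⁻¹ • x, ⟨⟨‖x‖⁻¹ • x, ?_⟩, ?_, rfl⟩, ?_⟩
    · simp [norm_smul, h0.ne']
    · simp only [mem_ofPred_eq, real_inner_smul_right]
      rw [inv_mul_eq_div, le_div_iff₀ h0]; exact h2
    · rw [smul_smul, mul_inv_cancel₀ h0.ne', one_smul]

/-- Coordinates `(z, y)` of three-space along and across an axis `e`. -/
theorem exists_axis_coordinates : ∃ (e : Space) (T : ℝ × EuclideanSpace ℝ (Fin 2) → Space),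
    ‖e‖ = 1 ∧ MeasurePreserving T ∧ (∀ z y, ‖T (z, y)‖ ^ 2 = z ^ 2 + ‖y‖ ^ 2) ∧
      ∀ z y, inner ℝ e (T (z, y)) = z := by
  let V := WithLp 2 (ℝ × EuclideanSpace ℝ (Fin 2))
  have hdim : Module.finrank ℝ V = Module.finrank ℝ Space := by
    have : Module.finrank ℝ V = Module.finrank ℝ (ℝ × EuclideanSpace ℝ (Fin 2)) :=
      (WithLp.linearEquiv 2 ℝ _).finrank_eq
    rw [this]; simp
  let L : V ≃ₗᵢ[ℝ] Space := (stdOrthonormalBasis ℝ V).equiv (stdOrthonormalBasis ℝ Space)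
    (finCongr hdim)
  refine ⟨L (WithLp.toLp 2 (1, 0)), fun q => L (WithLp.toLp 2 q), ?_, ?_, ?_, ?_⟩
  · rw [L.norm_map, ← sq_eq_sq₀ (norm_nonneg _) zero_le_one, WithLp.prod_norm_sq_eq_of_L2]
    simp
  · exact L.measurePreserving.comp (WithLp.volume_preserving_toLp _ _)
  · intro z y
    rw [L.norm_map, WithLp.prod_norm_sq_eq_of_L2]
    simp
  · intro z y
    rw [L.inner_map_map, WithLp.prod_inner_apply]
    simp

/-- The volume of the solid cone over a spherical cap, by slicing orthogonally to the axis: discs of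
radius `z * k` below height `c`, where `k` is the slope of the cone, and slices of the ball above. -/
theorem volume_cone {e : Space} {T : ℝ × EuclideanSpace ℝ (Fin 2) → Space}
    (hT : MeasurePreserving T) (hn : ∀ z y, ‖T (z, y)‖ ^ 2 = z ^ 2 + ‖y‖ ^ 2)
    (hi : ∀ z y, inner ℝ e (T (z, y)) = z) {c : ℝ} (hc : 0 < c) (hc1 : c < 1) :
    volume {x : Space | 0 < ‖x‖ ∧ ‖x‖ < 1 ∧ c * ‖x‖ ≤ inner ℝ e x} =
      ENNReal.ofReal (2 * Real.pi / 3 * (1 - c)) := by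
  have hmeas : MeasurableSet {x : Space | 0 < ‖x‖ ∧ ‖x‖ < 1 ∧ c * ‖x‖ ≤ inner ℝ e x} := by
    refine (measurableSet_lt measurable_const measurable_norm).inter
      ((measurableSet_lt measurable_norm measurable_const).inter
        (measurableSet_le (f := fun x : Space => c * ‖x‖) (g := fun x : Space => inner ℝ e x)
          (by fun_prop) (by fun_prop)))
  rw [← hT.measure_preimage hmeas.nullMeasurableSet, Measure.volume_eq_prod,
    Measure.prod_apply (hT.measurable hmeas)]
  set k : ℝ := √(1 - c ^ 2) / c with hk
  have hk0 : 0 ≤ k := by positivity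
  have hc2 : 0 < 1 - c ^ 2 := by nlinarith
  have hk2 : c ^ 2 * k ^ 2 = 1 - c ^ 2 := by
    rw [hk, div_pow, Real.sq_sqrt hc2.le]; field_simp
  have key : ∀ z y, (0 < ‖T (z, y)‖ ∧ ‖T (z, y)‖ < 1 ∧ c * ‖T (z, y)‖ ≤ inner ℝ e (T (z, y))) ↔
      0 < z ∧ z ^ 2 + ‖y‖ ^ 2 < 1 ∧ ‖y‖ ^ 2 ≤ z ^ 2 * k ^ 2 := by
    intro z y
    rw [hi]
    have h := hn z y
    set N := ‖T (z, y)‖ with hN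
    have hN0 : 0 ≤ N := norm_nonneg _
    constructor
    · rintro ⟨h0, h1, h2⟩
      have hz : 0 < z := lt_of_lt_of_le (by positivity) h2
      refine ⟨hz, by nlinarith, ?_⟩
      have h3 : (c * N) ^ 2 ≤ z ^ 2 := by gcongr
      rw [mul_pow, h] at h3
      have h4 : c ^ 2 * ‖y‖ ^ 2 ≤ c ^ 2 * (z ^ 2 * k ^ 2) := by
        nlinarith
      exact le_of_mul_le_mul_left h4 (by positivity)
    · rintro ⟨hz, h1, h2⟩
      refine ⟨?_, ?_, ?_⟩
      · by_contra h0
        have : N = 0 := le_antisymm (not_lt.1 h0) hN0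
        nlinarith [sq_nonneg ‖y‖, this]
      · nlinarith
      · refine le_of_sq_le_sq ?_ hz.le
        rw [mul_pow, h]
        have := mul_le_mul_of_nonneg_left h2 (sq_nonneg c)
        nlinarith
  have slice : ∀ z : ℝ, volume (Prod.mk z ⁻¹' (T ⁻¹' {x : Space | 0 < ‖x‖ ∧ ‖x‖ < 1 ∧
      c * ‖x‖ ≤ inner ℝ e x})) =
      (Ioo 0 c).indicator (fun z => ENNReal.ofReal (Real.pi * k ^ 2 * z ^ 2)) z +
      (Ico c 1).indicator (fun z => ENNReal.ofReal (Real.pi * (1 - z ^ 2))) z := by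
    intro z
    have hset : (Prod.mk z ⁻¹' (T ⁻¹' {x : Space | 0 < ‖x‖ ∧ ‖x‖ < 1 ∧ c * ‖x‖ ≤ inner ℝ e x})) =
        {y | 0 < z ∧ z ^ 2 + ‖y‖ ^ 2 < 1 ∧ ‖y‖ ^ 2 ≤ z ^ 2 * k ^ 2} := by
      ext y
      exact key z y
    rw [hset]
    by_cases hz0 : 0 < z
    swap
    · have : {y : EuclideanSpace ℝ (Fin 2) | 0 < z ∧ z ^ 2 + ‖y‖ ^ 2 < 1 ∧ ‖y‖ ^ 2 ≤ z ^ 2 * k ^ 2}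
          = ∅ := by ext y; simp [hz0]
      rw [this, indicator_of_notMem (by simp [hz0]), indicator_of_notMem]
      · simp
      · intro h; exact hz0 (hc.trans_le h.1)
    by_cases hzc : z < c
    · have : {y : EuclideanSpace ℝ (Fin 2) | 0 < z ∧ z ^ 2 + ‖y‖ ^ 2 < 1 ∧ ‖y‖ ^ 2 ≤ z ^ 2 * k ^ 2}
          = Metric.closedBall 0 (z * k) := by
        ext y
        simp only [mem_ofPred_eq, mem_closedBall_zero_iff, hz0, true_and]
        rw [← mul_pow, sq_le_sq₀ (norm_nonneg _) (by positivity)]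
        refine ⟨fun h => h.2, fun h => ⟨?_, h⟩⟩
        have : ‖y‖ ^ 2 ≤ (z * k) ^ 2 := by gcongr
        have h5 : z ^ 2 < c ^ 2 := by gcongr
        have h6 : z ^ 2 * (1 + k ^ 2) < c ^ 2 * (1 + k ^ 2) := by gcongr
        nlinarith
      rw [this, indicator_of_mem (by exact ⟨hz0, hzc⟩), indicator_of_notMem (by simp [hzc]), add_zero,
        EuclideanSpace.volume_closedBall_fin_two, ← ENNReal.ofReal_pow (by positivity),
        ← ENNReal.ofReal_mul (by positivity)]
      congr 1; ring
    · rw [indicator_of_notMem (by simp [hzc]), zero_add]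
      push Not at hzc
      by_cases hz1 : z < 1
      · have : {y : EuclideanSpace ℝ (Fin 2) | 0 < z ∧ z ^ 2 + ‖y‖ ^ 2 < 1 ∧
            ‖y‖ ^ 2 ≤ z ^ 2 * k ^ 2} = Metric.ball 0 √(1 - z ^ 2) := by
          ext y
          simp only [mem_ofPred_eq, mem_ball_zero_iff, hz0, true_and]
          rw [Real.lt_sqrt (norm_nonneg _)]
          refine ⟨fun h => by linarith [h.1], fun h => ⟨by linarith, ?_⟩⟩
          have h5 : c ^ 2 ≤ z ^ 2 := by gcongr
          have h6 : c ^ 2 * (1 + k ^ 2) ≤ z ^ 2 * (1 + k ^ 2) := by gcongr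
          nlinarith
        rw [this, indicator_of_mem (by exact ⟨hzc, hz1⟩), EuclideanSpace.volume_ball_fin_two,
          ← ENNReal.ofReal_pow (by positivity), ← ENNReal.ofReal_mul (by positivity),
          Real.sq_sqrt (by nlinarith)]
        congr 1; ring
      · have : {y : EuclideanSpace ℝ (Fin 2) | 0 < z ∧ z ^ 2 + ‖y‖ ^ 2 < 1 ∧
            ‖y‖ ^ 2 ≤ z ^ 2 * k ^ 2} = ∅ := by
          ext y
          simp only [mem_ofPred_eq, mem_empty_iff_false, iff_false, not_and]
          intro _ h
          push Not at hz1
          nlinarith [sq_nonneg ‖y‖]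
        rw [this, indicator_of_notMem (by simp [hz1])]
        simp
  simp_rw [slice]
  rw [lintegral_add_left (by
      refine Measurable.indicator ?_ measurableSet_Ioo
      fun_prop), lintegral_indicator measurableSet_Ioo, lintegral_indicator measurableSet_Ico,
    Measure.restrict_congr_set Ioo_ae_eq_Ioc, Measure.restrict_congr_set Ico_ae_eq_Ioc,
    ← ofReal_integral_eq_lintegral_ofReal, ← ofReal_integral_eq_lintegral_ofReal,
    ← ENNReal.ofReal_add, ← intervalIntegral.integral_of_le hc.le,
    ← intervalIntegral.integral_of_le hc1.le]
  · congr 1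
    rw [intervalIntegral.integral_const_mul, intervalIntegral.integral_const_mul,
      intervalIntegral.integral_sub (by simp) (by simp), integral_pow, integral_pow]
    simp only [intervalIntegral.integral_const, smul_eq_mul]
    norm_num
    linear_combination (Real.pi * c / 3) * hk2
  · exact setIntegral_nonneg measurableSet_Ioc fun z _ => by positivity
  · exact setIntegral_nonneg measurableSet_Ioc fun z hz => by
      have : z ^ 2 ≤ 1 := by nlinarith [hz.1, hz.2]
      exact mul_nonneg Real.pi_pos.le (by linarith)
  · exact (Continuous.integrableOn_Icc (by fun_prop)).mono_set Ioc_subset_Icc_self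
  · filter_upwards [ae_restrict_mem measurableSet_Ioc] with z hz
    have : z ^ 2 ≤ 1 := by nlinarith [hz.1, hz.2]
    exact mul_nonneg Real.pi_pos.le (by linarith)
  · exact (Continuous.integrableOn_Icc (by fun_prop)).mono_set Ioc_subset_Icc_self
  · exact Filter.Eventually.of_forall fun z => by positivity

theorem measurableSet_cap (p : Space) (c : ℝ) :
    MeasurableSet {u : UnitSphere | c ≤ inner ℝ p u.1} :=
  measurableSet_le measurable_const (by fun_prop)

/-- The law of the height of a uniform point over an axis does not depend on the axis. -/
theorem uniformSphere_axis {p p' : Space} (hp : ‖p‖ = 1) (hp' : ‖p'‖ = 1) {s : Set ℝ}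
    (hs : MeasurableSet s) : uniformSphere {u : UnitSphere | inner ℝ p u.1 ∈ s} =
      uniformSphere {u : UnitSphere | inner ℝ p' u.1 ∈ s} := by
  obtain ⟨R, rfl⟩ := Rot.exists_map_eq hp hp'
  have hm : MeasurableSet {u : UnitSphere | inner ℝ (R.1 p) u.1 ∈ s} :=
    (show Measurable fun u : UnitSphere => inner ℝ (R.1 p) u.1 by fun_prop) hs
  rw [← (Rot.measurePreserving_onSphere R).measure_preimage hm.nullMeasurableSet]
  congr 1
  ext u
  simp [Rot.onSphere, Rot.inner_map_map]

theorem uniformSphere_cap_of_pos {p : Space} (hp : ‖p‖ = 1) {c : ℝ} (hc : 0 < c) (hc1 : c < 1) :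
    uniformSphere {u : UnitSphere | c ≤ inner ℝ p u.1} = ENNReal.ofReal ((1 - c) / 2) := by
  obtain ⟨e, T, he, hT, hn, hi⟩ := exists_axis_coordinates
  have := uniformSphere_axis hp he (s := Ici c) measurableSet_Ici
  simp only [mem_Ici] at this
  rw [this, uniformSphere, Measure.smul_apply, smul_eq_mul, Measure.toSphere_apply_univ,
    Measure.toSphere_apply' _ (measurableSet_cap e c), smul_cap_eq, volume_cone hT hn hi hc hc1,
    EuclideanSpace.volume_ball_fin_three]
  have h3 : ((Module.finrank ℝ Space : ℕ) : ENNReal) = ENNReal.ofReal 3 := by simp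
  rw [h3, ENNReal.ofReal_one, one_pow, one_mul, ← ENNReal.ofReal_mul (by norm_num),
    ← ENNReal.ofReal_mul (by norm_num), ← ENNReal.ofReal_inv_of_pos (by positivity),
    ← ENNReal.ofReal_mul (by positivity)]
  congr 1
  have := Real.pi_pos
  field_simp
  ring

/-- The uniform distribution on `[-1, 1]`. -/
noncomputable def uniformHeight : Measure ℝ :=
  ENNReal.ofReal (1 / 2) • volume.restrict (Icc (-1) 1)

theorem uniformHeight_Ici (c : ℝ) :
    uniformHeight (Ici c) = ENNReal.ofReal ((1 - max c (-1)) / 2) := by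
  rw [uniformHeight, Measure.smul_apply, Measure.restrict_apply measurableSet_Ici, smul_eq_mul]
  have : Ici c ∩ Icc (-1) 1 = Icc (max c (-1)) 1 := by
    ext z; simp only [mem_inter_iff, mem_Ici, mem_Icc, max_le_iff]; tauto
  rw [this, Real.volume_Icc, ← ENNReal.ofReal_mul (by norm_num)]
  congr 1; ring

instance : IsProbabilityMeasure uniformHeight := by
  refine ⟨?_⟩
  rw [uniformHeight, Measure.smul_apply, Measure.restrict_apply_univ, Real.volume_Icc, smul_eq_mul,
    ← ENNReal.ofReal_mul (by norm_num)]
  norm_num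

theorem inner_mem_Icc {p q : Space} (hp : ‖p‖ = 1) (hq : ‖q‖ = 1) :
    inner ℝ p q ∈ Icc (-1 : ℝ) 1 := by
  have := abs_le.1 (abs_real_inner_le_norm p q)
  simpa [hp, hq] using this

/-- Archimedes' hat-box theorem: the height of a uniform point of the sphere is uniform. -/
theorem map_inner_uniformSphere {p : Space} (hp : ‖p‖ = 1) :
    uniformSphere.map (fun u : UnitSphere => inner ℝ p u.1) = uniformHeight := by
  have hm : Measurable fun u : UnitSphere => inner ℝ p u.1 := by fun_prop
  set κ := uniformSphere.map (fun u : UnitSphere => inner ℝ p u.1) with hκ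
  have : IsProbabilityMeasure κ := Measure.isProbabilityMeasure_map hm.aemeasurable
  have hneg : κ.map (fun z => -z) = κ := by
    rw [hκ, Measure.map_map measurable_neg hm]
    ext s hs
    rw [Measure.map_apply (measurable_neg.comp hm) hs, Measure.map_apply hm hs]
    have := uniformSphere_axis (p := -p) (p' := p) (by simpa using hp) hp hs
    simp only [inner_neg_left] at this
    exact this
  have hnegU : uniformHeight.map (fun z => -z) = uniformHeight := by
    unfold uniformHeight
    rw [Measure.map_smul]
    congr 1
    have := ((Measure.measurePreserving_neg (volume : Measure ℝ)).restrict_preimage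
      (measurableSet_Icc (a := (-1 : ℝ)) (b := 1))).map_eq
    have h2 : Neg.neg ⁻¹' Icc (-1 : ℝ) 1 = Icc (-1) 1 := by
      ext z
      simp only [mem_preimage, mem_Icc]
      constructor <;> rintro ⟨h, h'⟩ <;> constructor <;> linarith
    rw [h2] at this
    exact this
  -- positive thresholds are the cone computation; the others follow by symmetry
  have hpos : ∀ c, 0 < c → κ (Ici c) = uniformHeight (Ici c) := by
    intro c hc
    rw [uniformHeight_Ici, max_eq_left (by linarith)]
    rcases lt_or_ge c 1 with h1 | h1
    · rw [hκ, Measure.map_apply hm measurableSet_Ici]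
      exact uniformSphere_cap_of_pos hp hc h1
    · rw [ENNReal.ofReal_of_nonpos (by linarith)]
      refine le_antisymm (ENNReal.le_of_forall_pos_le_add fun ε hε _ => ?_) bot_le
      have hε' : (0 : ℝ) < min (ε : ℝ) 1 := lt_min (by exact_mod_cast hε) one_pos
      have hε1 : min (ε : ℝ) 1 ≤ 1 := min_le_right _ _
      calc κ (Ici c) ≤ κ (Ici (1 - min (ε : ℝ) 1 / 2)) := by
            refine measure_mono (Ici_subset_Ici.2 (by linarith))
        _ = ENNReal.ofReal ((1 - (1 - min (ε : ℝ) 1 / 2)) / 2) := by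
            rw [hκ, Measure.map_apply hm measurableSet_Ici]
            exact uniformSphere_cap_of_pos hp (by linarith) (by linarith)
        _ ≤ ENNReal.ofReal ε := by
            refine ENNReal.ofReal_le_ofReal ?_
            have := min_le_left (ε : ℝ) 1
            linarith
        _ = 0 + ε := by simp
  have hIoi : ∀ t, 0 ≤ t → κ (Ioi t) = uniformHeight (Ioi t) := by
    intro t ht
    have hu : Ioi t = ⋃ n : ℕ, Ici (t + 1 / ((n : ℝ) + 1)) := by
      ext z
      simp only [mem_Ioi, mem_iUnion, mem_Ici]
      constructor
      · intro h
        obtain ⟨n, hn⟩ := exists_nat_one_div_lt (sub_pos.2 h)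
        exact ⟨n, by linarith⟩
      · rintro ⟨n, hn⟩
        have : 0 < 1 / ((n : ℝ) + 1) := by positivity
        linarith
    have hmono : Monotone fun n : ℕ => Ici (t + 1 / ((n : ℝ) + 1)) := by
      intro m n hmn
      refine Ici_subset_Ici.2 ?_
      gcongr
    rw [hu, hmono.measure_iUnion, hmono.measure_iUnion]
    congr 1
    funext n
    exact hpos _ (by positivity)
  refine Measure.ext_of_Ici _ _ fun c => ?_
  rcases lt_or_ge 0 c with hc | hc
  · exact hpos c hc
  · have h1 : ∀ (m : Measure ℝ) [IsProbabilityMeasure m], m.map (fun z => -z) = m →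
        m (Ici c) = 1 - m (Ioi (-c)) := by
      intro m _ hmm
      rw [← compl_Iio, prob_compl_eq_one_sub measurableSet_Iio]
      congr 1
      conv_lhs => rw [← hmm]
      rw [Measure.map_apply measurable_neg measurableSet_Iio]
      congr 1
      ext z
      simp only [mem_preimage, mem_Iio, mem_Ioi]
      constructor <;> intro h <;> linarith
    rw [h1 κ hneg, h1 _ hnegU, hIoi _ (by linarith)]

/-! ### Random frames -/

theorem map_inner_haar {p q : Space} (hp : ‖p‖ = 1) (hq : ‖q‖ = 1) :
    Rot.haar.map (fun R => inner ℝ p (R.1 q)) = uniformHeight := by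
  have hm : Measurable fun R => Rot.onSphere R ⟨q, mem_sphere_zero_iff_norm.2 hq⟩ :=
    Rot.measurable_onSphere measurable_id measurable_const
  rw [← map_inner_uniformSphere hp,
    ← Rot.map_haar_onSphere ⟨q, mem_sphere_zero_iff_norm.2 hq⟩, Measure.map_map (by fun_prop) hm]
  rfl

/-- The uniform distribution on `(0, 2π]`. -/
noncomputable def uniformAngle : Measure ℝ :=
  ENNReal.ofReal (1 / (2 * Real.pi)) • volume.restrict (Ioc 0 (2 * Real.pi))

instance : IsProbabilityMeasure uniformAngle := by
  refine ⟨?_⟩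
  have := Real.pi_pos
  rw [uniformAngle, Measure.smul_apply, Measure.restrict_apply_univ, Real.volume_Ioc, smul_eq_mul,
    ← ENNReal.ofReal_mul (by positivity)]
  rw [sub_zero, one_div, inv_mul_cancel₀ (by positivity), ENNReal.ofReal_one]

theorem lintegral_uniformAngle_add {f : ℝ → ENNReal} (hf : Function.Periodic f (2 * Real.pi))
    (s : ℝ) : ∫⁻ θ, f (θ + s) ∂uniformAngle = ∫⁻ θ, f θ ∂uniformAngle := by
  unfold uniformAngle
  rw [lintegral_smul_measure, lintegral_smul_measure]
  congr 1
  have h1 : ∫⁻ θ in Ioc 0 (2 * Real.pi), f (θ + s) = ∫⁻ θ in Ioc s (s + 2 * Real.pi), f θ := by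
    have h := (measurePreserving_add_right (volume : Measure ℝ) s).setLIntegral_comp_preimage_emb
      (measurableEmbedding_addRight s) f (Ioc s (s + 2 * Real.pi))
    rw [← h]
    congr 2
    ext x
    simp only [mem_Ioc, mem_preimage]
    constructor <;> rintro ⟨h, h'⟩ <;> constructor <;> linarith
  rw [h1]
  have h2 := IsAddFundamentalDomain.setLIntegral_eq
    (isAddFundamentalDomain_Ioc Real.two_pi_pos s volume)
    (isAddFundamentalDomain_Ioc Real.two_pi_pos 0 volume) f ?_
  · simpa using h2
  · rintro ⟨g, hg⟩ x
    obtain ⟨n, rfl⟩ := AddSubgroup.mem_zmultiples_iff.1 hg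
    change f (n • (2 * Real.pi) + x) = f x
    rw [add_comm]
    exact hf.zsmul n x

/-- A linear function of a uniform direction depends in law on the norm of its coefficients only. -/
theorem lintegral_uniformAngle_linear (G : ℝ → ENNReal) (a b : ℝ) :
    ∫⁻ θ, G (Real.cos θ * a + Real.sin θ * b) ∂uniformAngle =
      ∫⁻ θ, G (√(a ^ 2 + b ^ 2) * Real.cos θ) ∂uniformAngle := by
  set w : ℂ := ⟨a, -b⟩ with hw
  have hn : ‖w‖ = √(a ^ 2 + b ^ 2) := by
    rw [Complex.norm_def, Complex.normSq_mk]; congr 1; ring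
  have ha : a = ‖w‖ * Real.cos w.arg := (Complex.norm_mul_cos_arg w).symm
  have hb : b = -(‖w‖ * Real.sin w.arg) := by rw [Complex.norm_mul_sin_arg w]; simp [hw]
  rw [← lintegral_uniformAngle_add (f := fun θ => G (√(a ^ 2 + b ^ 2) * Real.cos θ)) (s := w.arg)]
  · refine lintegral_congr fun θ => ?_
    congr 1
    rw [← hn, Real.cos_add]
    conv_lhs => rw [ha, hb]
    ring
  · intro θ
    simp only [Real.cos_add_two_pi]

/-- For a Haar-random rotation `R` and two orthonormal pairs `p, p₁` and `q, q₁`, the height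
`⟪p, R q⟫` is uniform on `[-1, 1]`, and given the height the tangential components of `R q` along
`p₁` and of `p` along `R q₁` point in independent uniform directions. -/
theorem lintegral_haar_frame {p p₁ q q₁ : Space} (hp : ‖p‖ = 1) (hp₁ : ‖p₁‖ = 1)
    (hpp : inner ℝ p p₁ = 0) (hq : ‖q‖ = 1) (hq₁ : ‖q₁‖ = 1) (hqq : inner ℝ q q₁ = 0)
    {F : ℝ × ℝ × ℝ → ENNReal} (hF : Measurable F) :
    ∫⁻ R, F (inner ℝ p (R.1 q), inner ℝ p₁ (R.1 q), inner ℝ p (R.1 q₁)) ∂(Rot.haar) =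
      ∫⁻ θ, ∫⁻ η, ∫⁻ z, F (z, √(1 - z ^ 2) * Real.cos θ, √(1 - z ^ 2) * Real.cos η)
        ∂uniformHeight ∂uniformAngle ∂uniformAngle := by
  obtain ⟨b, hb0, hb1⟩ := Rot.exists_basis hp hp₁ hpp
  obtain ⟨d, hd0, hd1⟩ := Rot.exists_basis hq hq₁ hqq
  have turn : ∀ (b : OrthonormalBasis (Fin 3) ℝ Space) (θ : ℝ), ∃ A : Rot, A.1 (b 0) = b 0 ∧
      A.1 (b 1) = Real.cos θ • b 1 + Real.sin θ • b 2 := by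
    intro b θ
    have hb : ∀ i j, inner ℝ (b i) (b j) = if i = j then (1 : ℝ) else 0 :=
      fun i j => orthonormal_iff_ite.1 b.orthonormal i j
    have hn : ‖Real.cos θ • b 1 + Real.sin θ • b 2‖ = 1 := by
      rw [← sq_eq_sq₀ (norm_nonneg _) zero_le_one, ← real_inner_self_eq_norm_sq]
      simp only [inner_add_left, inner_add_right, real_inner_smul_left, real_inner_smul_right, hb]
      simp
      nlinarith [Real.sin_sq_add_cos_sq θ]
    have ho : inner ℝ (b 0) (Real.cos θ • b 1 + Real.sin θ • b 2) = 0 := by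
      simp only [inner_add_right, real_inner_smul_right, hb]
      simp
    obtain ⟨b', h0, h1⟩ := Rot.exists_basis (b.norm_eq_one 0) hn ho
    obtain ⟨A, hA⟩ := Rot.exists_map_basis b b'
    exact ⟨A, by rw [hA, h0], by rw [hA, h1]⟩
  have hinv : ∀ θ η : ℝ,
      ∫⁻ R, F (inner ℝ p (R.1 q), inner ℝ p₁ (R.1 q), inner ℝ p (R.1 q₁)) ∂(Rot.haar) =
      ∫⁻ R, F (inner ℝ p (R.1 q),
        Real.cos θ * inner ℝ p₁ (R.1 q) + Real.sin θ * inner ℝ (b 2) (R.1 q),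
        Real.cos η * inner ℝ p (R.1 q₁) + Real.sin η * inner ℝ p (R.1 (d 2))) ∂(Rot.haar) := by
    intro θ η
    obtain ⟨A, hA0, hA1⟩ := turn b θ
    obtain ⟨B, hB0, hB1⟩ := turn d η
    rw [hb0] at hA0
    rw [hb0, hb1] at *
    rw [hd0, hd1] at *
    rw [← lintegral_mul_left_eq_self _ A⁻¹, ← lintegral_mul_right_eq_self _ B]
    refine lintegral_congr fun R => ?_
    have h1 : ∀ x y : Space, inner ℝ x ((A⁻¹ * (R * B)).1 y) = inner ℝ (A.1 x) (R.1 (B.1 y)) := by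
      intro x y
      rw [Rot.mul_apply, Rot.inner_map_inv_right, inv_inv]; rfl
    rw [h1, h1, h1, hA0, hA1, hB0, hB1]
    simp only [map_add, map_smul, inner_add_left, inner_add_right, real_inner_smul_left,
      real_inner_smul_right]
  have hm : ∀ x y : Space, Measurable fun R : Rot => inner ℝ x (R.1 y) := fun x y => by
    fun_prop
  have hconst : ∫⁻ R, F (inner ℝ p (R.1 q), inner ℝ p₁ (R.1 q), inner ℝ p (R.1 q₁)) ∂(Rot.haar) =
      ∫⁻ θ, ∫⁻ η, ∫⁻ R, F (inner ℝ p (R.1 q),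
        Real.cos θ * inner ℝ p₁ (R.1 q) + Real.sin θ * inner ℝ (b 2) (R.1 q),
        Real.cos η * inner ℝ p (R.1 q₁) + Real.sin η * inner ℝ p (R.1 (d 2))) ∂(Rot.haar)
          ∂uniformAngle ∂uniformAngle := by
    simp_rw [← hinv]
    simp
  have hsq : ∀ (b : OrthonormalBasis (Fin 3) ℝ Space) (x : Space), ‖x‖ = 1 →
      inner ℝ (b 1) x ^ 2 + inner ℝ (b 2) x ^ 2 = 1 - inner ℝ (b 0) x ^ 2 := by
    intro b x hx
    have := b.sum_sq_norm_inner_right x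
    rw [Fin.sum_univ_three, hx] at this
    simp only [Real.norm_eq_abs, sq_abs] at this
    linarith
  rw [hconst]
  -- bring the rotation outside, where both angles can be shifted to phase zero
  have hswap : ∀ Φ : ℝ → ℝ → Rot → ENNReal, Measurable (fun x : ℝ × ℝ × Rot => Φ x.1 x.2.1 x.2.2) →
      ∫⁻ θ, ∫⁻ η, ∫⁻ R, Φ θ η R ∂(Rot.haar) ∂uniformAngle ∂uniformAngle =
        ∫⁻ R, ∫⁻ θ, ∫⁻ η, Φ θ η R ∂uniformAngle ∂uniformAngle ∂(Rot.haar) := by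
    intro Φ hΦ
    have h1 : ∀ θ, ∫⁻ η, ∫⁻ R, Φ θ η R ∂(Rot.haar) ∂uniformAngle =
        ∫⁻ R, ∫⁻ η, Φ θ η R ∂uniformAngle ∂(Rot.haar) := fun θ =>
      lintegral_lintegral_swap (hΦ.comp (measurable_const.prodMk measurable_id)).aemeasurable
    simp_rw [h1]
    refine lintegral_lintegral_swap (Measurable.aemeasurable ?_)
    have : Measurable fun x : (ℝ × Rot) × ℝ => Φ x.1.1 x.2 x.1.2 :=
      hΦ.comp (measurable_fst.fst.prodMk (measurable_snd.prodMk measurable_fst.snd))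
    exact this.lintegral_prod_right'
  rw [hswap]
  swap
  · refine hF.comp (Measurable.prodMk ((hm _ _).comp measurable_snd.snd) (Measurable.prodMk ?_ ?_))
    · exact ((Real.measurable_cos.comp measurable_fst).mul ((hm _ _).comp measurable_snd.snd)).add
        ((Real.measurable_sin.comp measurable_fst).mul ((hm _ _).comp measurable_snd.snd))
    · exact ((Real.measurable_cos.comp measurable_snd.fst).mul
        ((hm _ _).comp measurable_snd.snd)).add
        ((Real.measurable_sin.comp measurable_snd.fst).mul ((hm _ _).comp measurable_snd.snd))
  have hinner : ∀ R : Rot, ∫⁻ θ, ∫⁻ η, F (inner ℝ p (R.1 q),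
        Real.cos θ * inner ℝ p₁ (R.1 q) + Real.sin θ * inner ℝ (b 2) (R.1 q),
        Real.cos η * inner ℝ p (R.1 q₁) + Real.sin η * inner ℝ p (R.1 (d 2))) ∂uniformAngle
          ∂uniformAngle =
      ∫⁻ θ, ∫⁻ η, F (inner ℝ p (R.1 q), √(1 - inner ℝ p (R.1 q) ^ 2) * Real.cos θ,
        √(1 - inner ℝ p (R.1 q) ^ 2) * Real.cos η) ∂uniformAngle ∂uniformAngle := by
    intro R
    have e1 : ∀ v, ∫⁻ η, F (inner ℝ p (R.1 q), v,
        Real.cos η * inner ℝ p (R.1 q₁) + Real.sin η * inner ℝ p (R.1 (d 2))) ∂uniformAngle =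
        ∫⁻ η, F (inner ℝ p (R.1 q), v, √(1 - inner ℝ p (R.1 q) ^ 2) * Real.cos η)
          ∂uniformAngle := by
      intro v
      rw [lintegral_uniformAngle_linear (fun w => F (inner ℝ p (R.1 q), v, w))]
      have := hsq d ((R⁻¹ : Rot).1 p) (by rw [Rot.norm_map, hp])
      simp only [real_inner_comm ((R⁻¹ : Rot).1 p), ← Rot.inner_map_inv_right] at this
      rw [hd0, hd1] at this
      rw [this]
    simp_rw [e1]
    rw [lintegral_uniformAngle_linear (fun w => ∫⁻ η, F (inner ℝ p (R.1 q), w,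
      √(1 - inner ℝ p (R.1 q) ^ 2) * Real.cos η) ∂uniformAngle)]
    have := hsq b (R.1 q) (by rw [Rot.norm_map, hq])
    rw [hb0, hb1] at this
    rw [this]
  simp_rw [hinner]
  rw [← hswap]
  swap
  · have hz : Measurable fun x : ℝ × ℝ × Rot => inner ℝ p (x.2.2.1 q) :=
      (hm _ _).comp measurable_snd.snd
    refine hF.comp (Measurable.prodMk hz (Measurable.prodMk ?_ ?_))
    · exact ((measurable_const.sub (hz.pow_const 2)).sqrt).mul
        (Real.measurable_cos.comp measurable_fst)
    · exact ((measurable_const.sub (hz.pow_const 2)).sqrt).mul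
        (Real.measurable_cos.comp measurable_snd.fst)
  refine lintegral_congr fun θ => lintegral_congr fun η => ?_
  rw [← map_inner_haar hp hq, lintegral_map _ (hm _ _)]
  refine hF.comp (Measurable.prodMk measurable_id (Measurable.prodMk ?_ ?_)) <;> fun_prop

/-! ### The mean rate of approach -/

/-- The mean of the positive part of `v * cos θ + w * cos η` for independent uniform directions
`θ` and `η`: the rate at which the distance of two points with speeds `v` and `w` and random
headings decreases. The positive part is taken by `ENNReal.ofReal`. -/
noncomputable def meanApproach (v w : ℝ) : ENNReal :=
  ∫⁻ θ, ∫⁻ η, ENNReal.ofReal (v * Real.cos θ + w * Real.cos η) ∂uniformAngle ∂uniformAngle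

theorem lintegral_uniformAngle_of_nonneg {f : ℝ → ℝ} (hf : Continuous f)
    (h0 : ∀ θ ∈ Ioc 0 (2 * Real.pi), 0 ≤ f θ) :
    ∫⁻ θ, ENNReal.ofReal (f θ) ∂uniformAngle =
      ENNReal.ofReal (1 / (2 * Real.pi) * ∫ θ in 0..(2 * Real.pi), f θ) := by
  have := Real.pi_pos
  rw [uniformAngle, lintegral_smul_measure, ← ofReal_integral_eq_lintegral_ofReal,
    ← intervalIntegral.integral_of_le (by positivity), smul_eq_mul,
    ← ENNReal.ofReal_mul (by positivity)]
  · exact (hf.integrableOn_Icc).mono_set Ioc_subset_Icc_self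
  · filter_upwards [ae_restrict_mem measurableSet_Ioc] with θ hθ using h0 θ hθ

theorem lintegral_abs_cos :
    ∫⁻ θ, ENNReal.ofReal |Real.cos θ| ∂uniformAngle = ENNReal.ofReal (2 / Real.pi) := by
  have hpi := Real.pi_pos
  rw [← lintegral_uniformAngle_add (f := fun θ => ENNReal.ofReal |Real.cos θ|)
    (fun θ => by simp only [Real.cos_add_two_pi]) (-(Real.pi / 2))]
  simp only [← sub_eq_add_neg, Real.cos_sub_pi_div_two]
  rw [lintegral_uniformAngle_of_nonneg (by fun_prop) (fun _ _ => abs_nonneg _)]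
  congr 1
  have hint : ∀ a b : ℝ, IntervalIntegrable (fun θ => |Real.sin θ|) volume a b :=
    fun a b => (by fun_prop : Continuous fun θ => |Real.sin θ|).intervalIntegrable a b
  rw [← intervalIntegral.integral_add_adjacent_intervals (hint 0 Real.pi) (hint _ _)]
  have h1 : ∫ θ in 0..Real.pi, |Real.sin θ| = ∫ θ in 0..Real.pi, Real.sin θ := by
    refine intervalIntegral.integral_congr fun θ hθ => ?_
    rw [uIcc_of_le hpi.le] at hθ
    exact abs_of_nonneg (Real.sin_nonneg_of_mem_Icc hθ)
  have h2 : ∫ θ in Real.pi..(2 * Real.pi), |Real.sin θ| =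
      ∫ θ in Real.pi..(2 * Real.pi), -Real.sin θ := by
    refine intervalIntegral.integral_congr fun θ hθ => ?_
    rw [uIcc_of_le (by linarith)] at hθ
    refine abs_of_nonpos ?_
    have := Real.sin_nonneg_of_nonneg_of_le_pi (x := θ - Real.pi) (by linarith [hθ.1])
      (by linarith [hθ.2])
    rw [Real.sin_sub_pi] at this
    linarith
  rw [h1, h2]
  simp only [integral_sin, intervalIntegral.integral_neg, Real.cos_two_pi, Real.cos_pi,
    Real.cos_zero]
  field_simp
  norm_num

theorem lintegral_abs_cos_half :
    ∫⁻ θ, ENNReal.ofReal |Real.cos (θ / 2)| ∂uniformAngle = ENNReal.ofReal (2 / Real.pi) := by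
  have hpi := Real.pi_pos
  rw [← lintegral_uniformAngle_add (f := fun θ => ENNReal.ofReal |Real.cos (θ / 2)|)
    (fun θ => by
      have : (θ + 2 * Real.pi) / 2 = θ / 2 + Real.pi := by ring
      simp only [this, Real.cos_add_pi, abs_neg]) (-Real.pi)]
  have h : ∀ θ, (θ + -Real.pi) / 2 = θ / 2 - Real.pi / 2 := fun θ => by ring
  simp only [h, Real.cos_sub_pi_div_two]
  rw [lintegral_uniformAngle_of_nonneg (by fun_prop) (fun _ _ => abs_nonneg _)]
  congr 1
  have h1 : ∫ θ in 0..(2 * Real.pi), |Real.sin (θ / 2)| =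
      ∫ θ in 0..(2 * Real.pi), Real.sin (θ / 2) := by
    refine intervalIntegral.integral_congr fun θ hθ => ?_
    rw [uIcc_of_le (by linarith)] at hθ
    exact abs_of_nonneg (Real.sin_nonneg_of_nonneg_of_le_pi (by linarith [hθ.1])
      (by linarith [hθ.2]))
  rw [h1, intervalIntegral.integral_comp_div (fun x => Real.sin x) two_ne_zero, integral_sin]
  have : 2 * Real.pi / 2 = Real.pi := by ring
  rw [this]
  simp only [zero_div, Real.cos_zero, Real.cos_pi, smul_eq_mul]
  field_simp
  norm_num

theorem lintegral_uniformAngle_cos_neg (f : ℝ → ENNReal) :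
    ∫⁻ θ, f (-Real.cos θ) ∂uniformAngle = ∫⁻ θ, f (Real.cos θ) ∂uniformAngle := by
  rw [← lintegral_uniformAngle_add (f := fun θ => f (Real.cos θ))
    (fun θ => by simp only [Real.cos_add_two_pi]) Real.pi]
  simp only [Real.cos_add_pi]

theorem measurable_ofReal_linear_cos (v w : ℝ) :
    Measurable fun x : ℝ × ℝ => ENNReal.ofReal (v * Real.cos x.1 + w * Real.cos x.2) :=
  (by fun_prop : Continuous fun x : ℝ × ℝ =>
    v * Real.cos x.1 + w * Real.cos x.2).measurable.ennreal_ofReal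

theorem lintegral_lintegral_add {f g : ℝ → ℝ → ENNReal} (hf : Measurable fun x : ℝ × ℝ => f x.1 x.2) :
    ∫⁻ θ, ∫⁻ η, (f θ η + g θ η) ∂uniformAngle ∂uniformAngle =
    ∫⁻ θ, ∫⁻ η, f θ η ∂uniformAngle ∂uniformAngle +
      ∫⁻ θ, ∫⁻ η, g θ η ∂uniformAngle ∂uniformAngle := by
  rw [← lintegral_add_left hf.lintegral_prod_right']
  refine lintegral_congr fun θ => ?_
  rw [lintegral_add_left]
  exact hf.comp (measurable_const.prodMk measurable_id)

theorem two_mul_max_abs (x y : ℝ) :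
    ENNReal.ofReal (x + y) + ENNReal.ofReal (x + -y) +
      (ENNReal.ofReal (-x + y) + ENNReal.ofReal (-x + -y)) =
        ENNReal.ofReal (2 * max |x| |y|) := by
  simp only [ENNReal.ofReal]
  norm_cast
  apply NNReal.coe_injective
  simp only [NNReal.coe_add, Real.coe_toNNReal']
  rcases le_total |x| |y| with h | h
  · have h0 : 0 ≤ 2 * |y| := by positivity
    rw [max_eq_right h, max_eq_left h0]
    rcases abs_cases x with ⟨hx, hx'⟩ | ⟨hx, hx'⟩ <;> rcases abs_cases y with ⟨hy, hy'⟩ | ⟨hy, hy'⟩ <;>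
    rw [hx, hy] at h <;> rw [hy] <;>
    rcases max_cases (x + y) 0 with ⟨e1, e1'⟩ | ⟨e1, e1'⟩ <;>
    rcases max_cases (x + -y) 0 with ⟨e2, e2'⟩ | ⟨e2, e2'⟩ <;>
    rcases max_cases (-x + y) 0 with ⟨e3, e3'⟩ | ⟨e3, e3'⟩ <;>
    rcases max_cases (-x + -y) 0 with ⟨e4, e4'⟩ | ⟨e4, e4'⟩ <;>
    rw [e1, e2, e3, e4] <;> linarith
  · have h0 : 0 ≤ 2 * |x| := by positivity
    rw [max_eq_left h, max_eq_left h0]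
    rcases abs_cases x with ⟨hx, hx'⟩ | ⟨hx, hx'⟩ <;> rcases abs_cases y with ⟨hy, hy'⟩ | ⟨hy, hy'⟩ <;>
    rw [hx, hy] at h <;> rw [hx] <;>
    rcases max_cases (x + y) 0 with ⟨e1, e1'⟩ | ⟨e1, e1'⟩ <;>
    rcases max_cases (x + -y) 0 with ⟨e2, e2'⟩ | ⟨e2, e2'⟩ <;>
    rcases max_cases (-x + y) 0 with ⟨e3, e3'⟩ | ⟨e3, e3'⟩ <;>
    rcases max_cases (-x + -y) 0 with ⟨e4, e4'⟩ | ⟨e4, e4'⟩ <;>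
    rw [e1, e2, e3, e4] <;> linarith

/-- Averaging over the four sign changes of the two cosines replaces the positive part of their
linear combination by a maximum of absolute values, which is monotone in the speeds. -/
theorem four_mul_meanApproach (v w : ℝ) :
    4 * meanApproach v w =
      ∫⁻ θ, ∫⁻ η, ENNReal.ofReal (2 * max |v * Real.cos θ| |w * Real.cos η|)
        ∂uniformAngle ∂uniformAngle := by
  have e1 : meanApproach v (-w) = meanApproach v w := by
    refine lintegral_congr fun θ => ?_
    rw [← lintegral_uniformAngle_cos_neg (fun c => ENNReal.ofReal (v * Real.cos θ + w * c))]
    simp only [mul_neg, neg_mul]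
  have e2 : ∀ w, meanApproach (-v) w = meanApproach v w := by
    intro w
    unfold meanApproach
    rw [← lintegral_uniformAngle_cos_neg
      (fun c => ∫⁻ η, ENNReal.ofReal (v * c + w * Real.cos η) ∂uniformAngle)]
    simp only [mul_neg, neg_mul]
  have h4 : 4 * meanApproach v w = (meanApproach v w + meanApproach v (-w)) +
      (meanApproach (-v) w + meanApproach (-v) (-w)) := by
    rw [e2, e2, e1]; ring
  rw [h4]
  unfold meanApproach
  have hm := measurable_ofReal_linear_cos
  rw [← lintegral_lintegral_add (hm v w), ← lintegral_lintegral_add (hm (-v) w),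
    ← lintegral_lintegral_add ((hm v w).add (hm v (-w)))]
  refine lintegral_congr fun θ => lintegral_congr fun η => ?_
  rw [← two_mul_max_abs]
  simp only [neg_mul]

theorem meanApproach_mono {v w v' w' : ℝ} (hv : 0 ≤ v) (hw : 0 ≤ w) (hv' : v ≤ v')
    (hw' : w ≤ w') : meanApproach v w ≤ meanApproach v' w' := by
  have h : 4 * meanApproach v w ≤ 4 * meanApproach v' w' := by
    rw [four_mul_meanApproach, four_mul_meanApproach]
    refine lintegral_mono fun θ => lintegral_mono fun η => ENNReal.ofReal_le_ofReal ?_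
    simp only [abs_mul]
    gcongr
  exact (ENNReal.mul_le_mul_iff_right (by norm_num) (by norm_num)).1 h

/-- For equal speeds the integral factorizes, by the formula for a sum of two cosines. -/
theorem meanApproach_self {v : ℝ} (hv : 0 ≤ v) :
    meanApproach v v = ENNReal.ofReal (4 / Real.pi ^ 2 * v) := by
  have hpi := Real.pi_pos
  have h2 : 2 * meanApproach v v = ∫⁻ θ, ∫⁻ η, ENNReal.ofReal (v * |Real.cos θ + Real.cos η|)
      ∂uniformAngle ∂uniformAngle := by
    have hneg : meanApproach v v = ∫⁻ θ, ∫⁻ η, ENNReal.ofReal (-(v * Real.cos θ + v * Real.cos η))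
        ∂uniformAngle ∂uniformAngle := by
      unfold meanApproach
      rw [← lintegral_uniformAngle_cos_neg
        (fun c => ∫⁻ η, ENNReal.ofReal (v * c + v * Real.cos η) ∂uniformAngle)]
      refine lintegral_congr fun θ => ?_
      rw [← lintegral_uniformAngle_cos_neg
        (fun c => ENNReal.ofReal (v * -Real.cos θ + v * c))]
      refine lintegral_congr fun η => ?_
      congr 1; ring
    rw [two_mul]
    nth_rw 2 [hneg]
    unfold meanApproach
    rw [← lintegral_lintegral_add (measurable_ofReal_linear_cos v v)]
    refine lintegral_congr fun θ => lintegral_congr fun η => ?_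
    rw [← mul_add, ← abs_of_nonneg hv, ← abs_mul, abs_of_nonneg hv]
    rcases le_total 0 (v * (Real.cos θ + Real.cos η)) with h | h
    · rw [abs_of_nonneg h, ENNReal.ofReal_of_nonpos (neg_nonpos.2 h), add_zero]
    · rw [abs_of_nonpos h, ENNReal.ofReal_of_nonpos h, zero_add]
  have h3 : ∫⁻ θ, ∫⁻ η, ENNReal.ofReal (v * |Real.cos θ + Real.cos η|)
      ∂uniformAngle ∂uniformAngle = ENNReal.ofReal (8 / Real.pi ^ 2 * v) := by
    have hs : Measurable fun x : ℝ × ℝ => ENNReal.ofReal (v * |Real.cos (x.1 + x.2) + Real.cos x.2|) :=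
      (by fun_prop : Continuous fun x : ℝ × ℝ => v * |Real.cos (x.1 + x.2) + Real.cos x.2|).measurable.ennreal_ofReal
    calc ∫⁻ θ, ∫⁻ η, ENNReal.ofReal (v * |Real.cos θ + Real.cos η|) ∂uniformAngle ∂uniformAngle
        = ∫⁻ η, ∫⁻ θ, ENNReal.ofReal (v * |Real.cos θ + Real.cos η|) ∂uniformAngle ∂uniformAngle :=
          lintegral_lintegral_swap (by fun_prop : Continuous fun x : ℝ × ℝ =>
            v * |Real.cos x.1 + Real.cos x.2|).measurable.ennreal_ofReal.aemeasurable
      _ = ∫⁻ η, ∫⁻ θ, ENNReal.ofReal (v * |Real.cos (θ + η) + Real.cos η|)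
            ∂uniformAngle ∂uniformAngle := by
          refine lintegral_congr fun η => ?_
          exact (lintegral_uniformAngle_add
            (f := fun θ => ENNReal.ofReal (v * |Real.cos θ + Real.cos η|))
            (fun θ => by simp only [Real.cos_add_two_pi]) η).symm
      _ = ∫⁻ θ, ∫⁻ η, ENNReal.ofReal (v * |Real.cos (θ + η) + Real.cos η|)
            ∂uniformAngle ∂uniformAngle :=
          (lintegral_lintegral_swap hs.aemeasurable).symm
      _ = ∫⁻ θ, ∫⁻ η, ENNReal.ofReal (2 * v * |Real.cos (θ / 2)|) * ENNReal.ofReal |Real.cos η|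
            ∂uniformAngle ∂uniformAngle := by
          refine lintegral_congr fun θ => ?_
          rw [← lintegral_uniformAngle_add
            (f := fun η => ENNReal.ofReal (v * |Real.cos (θ + η) + Real.cos η|))
            (fun η => by simp only [Real.cos_add_two_pi, ← add_assoc]) (-(θ / 2))]
          refine lintegral_congr fun η => ?_
          rw [← ENNReal.ofReal_mul (by positivity), Real.cos_add_cos]
          congr 1
          have e1 : (θ + (η + -(θ / 2)) + (η + -(θ / 2))) / 2 = η := by ring
          have e2 : (θ + (η + -(θ / 2)) - (η + -(θ / 2))) / 2 = θ / 2 := by ring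
          rw [e1, e2, abs_mul, abs_mul, abs_two]
          ring
      _ = ENNReal.ofReal (8 / Real.pi ^ 2 * v) := by
          simp_rw [lintegral_const_mul' _ _ ENNReal.ofReal_ne_top, lintegral_abs_cos]
          rw [lintegral_mul_const' _ _ ENNReal.ofReal_ne_top]
          simp_rw [ENNReal.ofReal_mul (mul_nonneg zero_le_two hv)]
          rw [lintegral_const_mul' _ _ ENNReal.ofReal_ne_top, lintegral_abs_cos_half,
            ← ENNReal.ofReal_mul (by positivity), ← ENNReal.ofReal_mul (by positivity)]
          congr 1
          field_simp
          ring
  have h5 : 2 * meanApproach v v = 2 * ENNReal.ofReal (4 / Real.pi ^ 2 * v) := by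
    rw [h2, h3, ← ENNReal.ofReal_ofNat, ← ENNReal.ofReal_mul (by norm_num)]
    congr 1; ring
  exact (ENNReal.mul_right_inj (by norm_num) (by norm_num)).1 h5

/-! ### Crossing a level within a short time -/

theorem uniformHeight_Ico_le (a b : ℝ) : uniformHeight (Ico a b) ≤ ENNReal.ofReal ((b - a) / 2) := by
  rw [uniformHeight, Measure.smul_apply, smul_eq_mul]
  calc ENNReal.ofReal (1 / 2) * (volume.restrict (Icc (-1) 1)) (Ico a b)
      ≤ ENNReal.ofReal (1 / 2) * volume (Ico a b) := by
        gcongr; exact Measure.restrict_le_self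
    _ = ENNReal.ofReal ((b - a) / 2) := by
        rw [Real.volume_Ico, ← ENNReal.ofReal_mul (by norm_num)]
        congr 1; ring

theorem uniformHeight_Ico {a b : ℝ} (ha : -1 ≤ a) (hb : b ≤ 1) :
    uniformHeight (Ico a b) = ENNReal.ofReal ((b - a) / 2) := by
  rw [uniformHeight, Measure.smul_apply, smul_eq_mul, Measure.restrict_apply measurableSet_Ico,
    inter_eq_left.2 (Ico_subset_Icc_self.trans (Icc_subset_Icc ha hb)), Real.volume_Ico,
    ← ENNReal.ofReal_mul (by norm_num)]
  congr 1; ring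

theorem ae_uniformHeight : ∀ᵐ z ∂uniformHeight, z ∈ Icc (-1 : ℝ) 1 :=
  Measure.ae_smul_measure (ae_restrict_mem measurableSet_Icc) _

theorem indicator_one_le {α β : Type*} {s : Set α} {t : Set β} {x : α} {y : β}
    (h : x ∈ s → y ∈ t) : s.indicator (1 : α → ENNReal) x ≤ t.indicator 1 y := by
  by_cases hx : x ∈ s
  · simp [hx, h hx]
  · simp [hx]

theorem lintegral_haar_Ico_le {p q : Space} (hp : ‖p‖ = 1) (hq : ‖q‖ = 1) (a b : ℝ) :
    ∫⁻ R, (Ico a b).indicator 1 (inner ℝ p (R.1 q)) ∂(Rot.haar) ≤ ENNReal.ofReal ((b - a) / 2) := by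
  have := lintegral_map (μ := Rot.haar) (f := (Ico a b).indicator 1)
    (g := fun R => inner ℝ p (R.1 q)) (measurable_one.indicator measurableSet_Ico) (by fun_prop)
  rw [← this, map_inner_haar hp hq, lintegral_indicator_one measurableSet_Ico]
  exact uniformHeight_Ico_le a b

/-- The `(z, x, y)` for which a function starting at `z` with slope `v * x + w * y`, known up to an
error `k`, may reach the level `c` from below within time `h`. -/
def upcrossUpper (c h k v w : ℝ) : Set (ℝ × ℝ × ℝ) :=
  {s | s.1 < c ∧ c ≤ s.1 + h * max (v * s.2.1 + w * s.2.2) 0 + k}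

/-- The `(z, x, y)` for which a function starting at `z` with slope `v * x + w * y`, known up to an
error `k`, is below the level `c` and certain to be above it after time `h`. -/
def upcrossLower (c h k v w : ℝ) : Set (ℝ × ℝ × ℝ) :=
  {s | s.1 < c ∧ c ≤ s.1 + h * (v * s.2.1 + w * s.2.2) - k}

theorem measurableSet_upcrossUpper (c h k v w : ℝ) : MeasurableSet (upcrossUpper c h k v w) :=
  (measurableSet_lt measurable_fst measurable_const).inter
    (measurableSet_le measurable_const
      (g := fun s : ℝ × ℝ × ℝ => s.1 + h * max (v * s.2.1 + w * s.2.2) 0 + k) (by fun_prop))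

theorem measurableSet_upcrossLower (c h k v w : ℝ) : MeasurableSet (upcrossLower c h k v w) :=
  (measurableSet_lt measurable_fst measurable_const).inter
    (measurableSet_le measurable_const
      (g := fun s : ℝ × ℝ × ℝ => s.1 + h * (v * s.2.1 + w * s.2.2) - k) (by fun_prop))

theorem abs_linear_cos_le {v w L : ℝ} (hv : 0 ≤ v) (hw : 0 ≤ w) (hvL : v ≤ L) (hwL : w ≤ L)
    (θ η : ℝ) : |v * Real.cos θ + w * Real.cos η| ≤ 2 * L := by
  refine (abs_add_le _ _).trans ?_
  rw [abs_mul, abs_mul, abs_of_nonneg hv, abs_of_nonneg hw]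
  nlinarith [Real.abs_cos_le_one θ, Real.abs_cos_le_one η, abs_nonneg (Real.cos θ),
    abs_nonneg (Real.cos η)]

theorem sqrt_one_sub_sq_le {c z δ : ℝ} (hc : c ∈ Icc (-1 : ℝ) 1) (hz : z ∈ Icc (-1 : ℝ) 1)
    (h : |c - z| ≤ δ) : √(1 - z ^ 2) ≤ √(1 - c ^ 2) + √(2 * δ) := by
  have hδ : 0 ≤ δ := (abs_nonneg _).trans h
  rw [Real.sqrt_le_left (by positivity), add_sq, Real.sq_sqrt (by nlinarith [hc.1, hc.2]),
    Real.sq_sqrt (by positivity)]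
  have h1 : c ^ 2 - z ^ 2 ≤ 2 * δ := by
    calc c ^ 2 - z ^ 2 = (c - z) * (c + z) := by ring
      _ ≤ |c - z| * |c + z| := by rw [← abs_mul]; exact le_abs_self _
      _ ≤ δ * 2 := by
        gcongr
        rw [abs_le]; constructor <;> linarith [hc.1, hc.2, hz.1, hz.2]
      _ = 2 * δ := mul_comm _ _
  have : 0 ≤ 2 * √(1 - c ^ 2) * √(2 * δ) := by positivity
  linarith

section
variable {p p₁ q q₁ : Space} {c h k v w L : ℝ}

/-- For a random frame, the probability that the level may be reached. Given the directions, the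
height has to lie in an interval below `c` whose length is the increment over the time `h`; the
factor `√(1 - z ^ 2)` in the slope is compared with its value at `z = c`. -/
theorem lintegral_haar_upcrossUpper_le (hp : ‖p‖ = 1) (hp₁ : ‖p₁‖ = 1)
    (hpp : inner ℝ p p₁ = 0) (hq : ‖q‖ = 1) (hq₁ : ‖q₁‖ = 1) (hqq : inner ℝ q q₁ = 0)
    (hc : c ∈ Icc (-1 : ℝ) 1) (hh : 0 ≤ h) (hk : 0 ≤ k) (hv : 0 ≤ v) (hw : 0 ≤ w) (hvL : v ≤ L)
    (hwL : w ≤ L) :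
    ∫⁻ R, (upcrossUpper c h k v w).indicator 1
      (inner ℝ p (R.1 q), inner ℝ p₁ (R.1 q), inner ℝ p (R.1 q₁)) ∂(Rot.haar) ≤
      ENNReal.ofReal (h * (√(1 - c ^ 2) + √(2 * (2 * L * h + k))) / 2) * meanApproach v w +
        ENNReal.ofReal (k / 2) := by
  set S := √(1 - c ^ 2) + √(2 * (2 * L * h + k)) with hS
  have hS0 : 0 ≤ S := by positivity
  have hL : 0 ≤ L := hv.trans hvL
  have hmE := measurableSet_upcrossUpper c h k v w
  rw [lintegral_haar_frame hp hp₁ hpp hq hq₁ hqq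
    (F := (upcrossUpper c h k v w).indicator 1) (measurable_one.indicator hmE)]
  have hbound : ∀ θ η, ∫⁻ z, (upcrossUpper c h k v w).indicator 1
      (z, √(1 - z ^ 2) * Real.cos θ, √(1 - z ^ 2) * Real.cos η) ∂uniformHeight ≤
      ENNReal.ofReal (h * S / 2) * ENNReal.ofReal (v * Real.cos θ + w * Real.cos η) +
        ENNReal.ofReal (k / 2) := by
    intro θ η
    set ξ := v * Real.cos θ + w * Real.cos η with hξ
    have hξL := abs_linear_cos_le hv hw hvL hwL θ η
    rw [← hξ] at hξL
    calc ∫⁻ z, (upcrossUpper c h k v w).indicator 1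
          (z, √(1 - z ^ 2) * Real.cos θ, √(1 - z ^ 2) * Real.cos η) ∂uniformHeight
        ≤ ∫⁻ z, (Ico (c - (h * S * max ξ 0 + k)) c).indicator 1 z ∂uniformHeight := by
          refine lintegral_mono_ae ?_
          filter_upwards [ae_uniformHeight] with z hz
          refine indicator_one_le fun hE => ?_
          obtain ⟨h1, h2⟩ := hE
          have hr0 : 0 ≤ √(1 - z ^ 2) := Real.sqrt_nonneg _
          have hr1 : √(1 - z ^ 2) ≤ 1 := Real.sqrt_le_one.2 (by nlinarith)
          have hm : max (v * (√(1 - z ^ 2) * Real.cos θ) + w * (√(1 - z ^ 2) * Real.cos η)) 0 =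
              √(1 - z ^ 2) * max ξ 0 := by
            rw [mul_max_of_nonneg _ _ hr0, mul_zero, hξ]
            congr 1; ring
          simp only [hm] at h1 h2
          have hm0 : 0 ≤ max ξ 0 := le_max_right _ _
          have hm2 : max ξ 0 ≤ 2 * L := max_le ((le_abs_self _).trans hξL) (by positivity)
          have hcz : |c - z| ≤ 2 * L * h + k := by
            rw [abs_of_nonneg (by linarith)]
            have : √(1 - z ^ 2) * max ξ 0 ≤ 1 * (2 * L) := by gcongr
            nlinarith
          have hrS := sqrt_one_sub_sq_le hc hz hcz
          refine ⟨?_, h1⟩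
          have : h * (√(1 - z ^ 2) * max ξ 0) ≤ h * (S * max ξ 0) := by gcongr
          linarith
      _ ≤ ENNReal.ofReal ((h * S * max ξ 0 + k) / 2) := by
          rw [lintegral_indicator_one measurableSet_Ico]
          refine (uniformHeight_Ico_le _ _).trans (le_of_eq ?_)
          congr 1; ring
      _ = ENNReal.ofReal (h * S / 2) * ENNReal.ofReal ξ + ENNReal.ofReal (k / 2) := by
          have : ENNReal.ofReal ξ = ENNReal.ofReal (max ξ 0) := by
            rcases le_total ξ 0 with h0 | h0
            · rw [max_eq_right h0, ENNReal.ofReal_of_nonpos h0, ENNReal.ofReal_zero]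
            · rw [max_eq_left h0]
          rw [this, ← ENNReal.ofReal_mul (by positivity), ← ENNReal.ofReal_add (by positivity)
            (by positivity)]
          congr 1; ring
  refine (lintegral_mono fun θ => lintegral_mono fun η => hbound θ η).trans (le_of_eq ?_)
  rw [lintegral_lintegral_add]
  · simp_rw [lintegral_const_mul' _ _ ENNReal.ofReal_ne_top]
    simp [meanApproach]
  · exact (measurable_ofReal_linear_cos v w).const_mul _

/-- The lower bound matching `lintegral_haar_upcrossUpper_le`. The bound `2 * L * h ≤ 1 + c` keeps the
interval of heights inside `[-1, 1]`. -/
theorem le_lintegral_haar_upcrossLower (hp : ‖p‖ = 1) (hp₁ : ‖p₁‖ = 1)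
    (hpp : inner ℝ p p₁ = 0) (hq : ‖q‖ = 1) (hq₁ : ‖q₁‖ = 1) (hqq : inner ℝ q q₁ = 0)
    (hc : c ∈ Icc (-1 : ℝ) 1) (hh : 0 ≤ h) (hk : 0 ≤ k) (hv : 0 ≤ v) (hw : 0 ≤ w) (hvL : v ≤ L)
    (hwL : w ≤ L) (hLh : 2 * L * h ≤ 1 + c) :
    ENNReal.ofReal (h * (√(1 - c ^ 2) - √(2 * (2 * L * h))) / 2) * meanApproach v w ≤
    ∫⁻ R, (upcrossLower c h k v w).indicator 1
      (inner ℝ p (R.1 q), inner ℝ p₁ (R.1 q), inner ℝ p (R.1 q₁)) ∂(Rot.haar) +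
        ENNReal.ofReal (k / 2) := by
  set S := √(1 - c ^ 2) - √(2 * (2 * L * h)) with hS
  have hL : 0 ≤ L := hv.trans hvL
  rcases le_or_gt S 0 with hS0 | hS0
  · rw [ENNReal.ofReal_of_nonpos, zero_mul]
    · exact bot_le
    · have := mul_nonpos_of_nonneg_of_nonpos hh hS0
      linarith
  have hS1 : S ≤ 1 := by
    have h1 : √(1 - c ^ 2) ≤ 1 := Real.sqrt_le_one.2 (by nlinarith)
    have h2 : 0 ≤ √(2 * (2 * L * h)) := Real.sqrt_nonneg _
    linarith
  have hmE := measurableSet_upcrossLower c h k v w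
  rw [lintegral_haar_frame hp hp₁ hpp hq hq₁ hqq
    (F := (upcrossLower c h k v w).indicator 1) (measurable_one.indicator hmE)]
  have hbound : ∀ θ η,
      ENNReal.ofReal (h * S / 2) * ENNReal.ofReal (v * Real.cos θ + w * Real.cos η) ≤
      ∫⁻ z, (upcrossLower c h k v w).indicator 1
        (z, √(1 - z ^ 2) * Real.cos θ, √(1 - z ^ 2) * Real.cos η) ∂uniformHeight +
        ENNReal.ofReal (k / 2) := by
    intro θ η
    set ξ := v * Real.cos θ + w * Real.cos η with hξ
    have hξL := abs_linear_cos_le hv hw hvL hwL θ η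
    rw [← hξ] at hξL
    rcases le_or_gt ξ 0 with hξ0 | hξ0
    · rw [ENNReal.ofReal_of_nonpos hξ0, mul_zero]; exact bot_le
    have hξ2 : ξ ≤ 2 * L := (le_abs_self _).trans hξL
    have hprod : h * S * ξ ≤ 2 * L * h := by
      have : S * ξ ≤ 1 * (2 * L) := by gcongr
      nlinarith
    calc ENNReal.ofReal (h * S / 2) * ENNReal.ofReal ξ
        = ENNReal.ofReal ((c - (c - (h * S * ξ - k))) / 2 + k / 2) := by
          rw [← ENNReal.ofReal_mul (by positivity)]
          congr 1; ring
      _ ≤ ENNReal.ofReal ((c - (c - (h * S * ξ - k))) / 2) + ENNReal.ofReal (k / 2) :=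
          ENNReal.ofReal_add_le
      _ = uniformHeight (Ico (c - (h * S * ξ - k)) c) + ENNReal.ofReal (k / 2) := by
          rw [uniformHeight_Ico (by linarith) hc.2]
      _ = ∫⁻ z, (Ico (c - (h * S * ξ - k)) c).indicator 1 z ∂uniformHeight +
            ENNReal.ofReal (k / 2) := by
          rw [lintegral_indicator_one measurableSet_Ico]
      _ ≤ _ := by
          gcongr ?_ + _
          refine lintegral_mono_ae ?_
          filter_upwards [ae_uniformHeight] with z hz
          refine indicator_one_le fun hE => ?_
          obtain ⟨h1, h2⟩ := hE
          have hcz : |z - c| ≤ 2 * L * h := by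
            rw [abs_of_neg (by linarith)]
            linarith
          have hrS := sqrt_one_sub_sq_le hz hc hcz
          refine ⟨h2, ?_⟩
          have h3 : S ≤ √(1 - z ^ 2) := by linarith
          have h4 : h * S * ξ ≤ h * √(1 - z ^ 2) * ξ := by gcongr
          have h5 : v * (√(1 - z ^ 2) * Real.cos θ) + w * (√(1 - z ^ 2) * Real.cos η) =
              √(1 - z ^ 2) * ξ := by rw [hξ]; ring
          simp only [h5]
          linarith
  calc ENNReal.ofReal (h * S / 2) * meanApproach v w
      = ∫⁻ θ, ∫⁻ η, ENNReal.ofReal (h * S / 2) *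
          ENNReal.ofReal (v * Real.cos θ + w * Real.cos η) ∂uniformAngle ∂uniformAngle := by
        simp_rw [lintegral_const_mul' _ _ ENNReal.ofReal_ne_top]
        simp [meanApproach]
    _ ≤ ∫⁻ θ, ∫⁻ η, (∫⁻ z, (upcrossLower c h k v w).indicator 1
          (z, √(1 - z ^ 2) * Real.cos θ, √(1 - z ^ 2) * Real.cos η) ∂uniformHeight +
          ENNReal.ofReal (k / 2)) ∂uniformAngle ∂uniformAngle :=
        lintegral_mono fun θ => lintegral_mono fun η => hbound θ η
    _ = _ := ?_
  rw [lintegral_lintegral_add]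
  · simp
  · have hm : Measurable fun x : (ℝ × ℝ) × ℝ => (upcrossLower c h k v w).indicator
        (1 : ℝ × ℝ × ℝ → ENNReal)
        (x.2, √(1 - x.2 ^ 2) * Real.cos x.1.1, √(1 - x.2 ^ 2) * Real.cos x.1.2) :=
      (measurable_one.indicator hmE).comp (by fun_prop)
    exact hm.lintegral_prod_right'

end

open Filter Topology

/-! ### Counting entries along a partition -/

/-- The times in `(a, b]` at which `g` enters the region `c ≤ g` from below. -/
def entries (g : ℝ → ℝ) (c a b : ℝ) : Set ℝ :=
  {t | t ∈ Ioc a b ∧ c ≤ g t ∧ ∀ᶠ u in 𝓝[<] t, g u < c}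

/-- The length of the intervals of the partition of `(a, b]` into `N + 1` equal intervals. -/
noncomputable def mesh (a b : ℝ) (N : ℕ) : ℝ := (b - a) / (N + 1)

/-- The `k`-th point of the partition of `(a, b]` into `N + 1` equal intervals. -/
noncomputable def grid (a b : ℝ) (N k : ℕ) : ℝ := a + k * mesh a b N

section
variable {a b : ℝ}

theorem mesh_pos (hab : a < b) (N : ℕ) : 0 < mesh a b N :=
  div_pos (sub_pos.2 hab) (by positivity)

theorem grid_succ (N k : ℕ) : grid a b N (k + 1) = grid a b N k + mesh a b N := by
  simp only [grid]; push_cast; ring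

theorem grid_zero (N : ℕ) : grid a b N 0 = a := by simp [grid]

theorem succ_mul_mesh (N : ℕ) : ((N : ℝ) + 1) * mesh a b N = b - a := by
  unfold mesh; field_simp

theorem grid_last (N : ℕ) : grid a b N (N + 1) = b := by
  have := succ_mul_mesh (a := a) (b := b) N
  simp only [grid]; push_cast; linarith

theorem grid_mono (hab : a < b) (N : ℕ) : Monotone (grid a b N) := by
  intro j k hjk
  have := mesh_pos hab N
  unfold grid
  gcongr

theorem tendsto_mesh (a b : ℝ) : Tendsto (mesh a b) atTop (𝓝 0) :=
  tendsto_const_nhds.div_atTop (tendsto_atTop_add_const_right _ _ tendsto_natCast_atTop_atTop)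

theorem exists_mem_Ioc_grid (hab : a < b) (N : ℕ) {t : ℝ} (ht : t ∈ Ioc a b) :
    ∃ k < N + 1, t ∈ Ioc (grid a b N k) (grid a b N (k + 1)) := by
  have hm := mesh_pos hab N
  have hex : ∃ k, t ≤ grid a b N (k + 1) := ⟨N, by rw [grid_last]; exact ht.2⟩
  classical
  refine ⟨Nat.find hex, ?_, ?_, Nat.find_spec hex⟩
  · exact Nat.lt_succ_of_le (Nat.find_min' hex (by rw [grid_last]; exact ht.2))
  · rcases Nat.eq_zero_or_pos (Nat.find hex) with h | h
    · rw [h, grid_zero]; exact ht.1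
    · have := Nat.find_min hex (Nat.sub_lt h one_pos)
      have h1 : Nat.find hex - 1 + 1 = Nat.find hex := Nat.sub_add_cancel h
      rw [h1] at this
      exact not_le.1 this

theorem disjoint_Ioc_grid (hab : a < b) (N : ℕ) {j k : ℕ} {t : ℝ}
    (hj : t ∈ Ioc (grid a b N j) (grid a b N (j + 1)))
    (hk : t ∈ Ioc (grid a b N k) (grid a b N (k + 1))) : j = k := by
  by_contra hne
  rcases lt_or_gt_of_ne hne with h | h
  · exact absurd (hj.2.trans (grid_mono hab N h)) (not_le.2 hk.1)
  · exact absurd (hk.2.trans (grid_mono hab N h)) (not_le.2 hj.1)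

/-- Every interval of a partition in which `g` goes from below the level to above it contains an
entry. -/
theorem card_le_encard_entries {g : ℝ → ℝ} (hg : Continuous g) (c : ℝ) (hab : a < b) (N : ℕ)
    {s : Finset ℕ} (hs : ∀ k ∈ s, k < N + 1 ∧ g (grid a b N k) < c ∧ c ≤ g (grid a b N (k + 1))) :
    (s.card : ℕ∞) ≤ (entries g c a b).encard := by
  have hex : ∀ k ∈ s, ∃ t ∈ Ioc (grid a b N k) (grid a b N (k + 1)), t ∈ entries g c a b := by
    intro k hk
    obtain ⟨hkN, h1, h2⟩ := hs k hk
    set K : Set ℝ := Icc (grid a b N k) (grid a b N (k + 1)) ∩ g ⁻¹' Ici c with hK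
    have hKc : IsCompact K := isCompact_Icc.inter_right (isClosed_Ici.preimage hg)
    obtain ⟨t, ⟨htI, htc⟩, hmin⟩ := hKc.exists_isLeast
      ⟨_, right_mem_Icc.2 (grid_mono hab N k.le_succ), h2⟩
    have hlt : grid a b N k < t := by
      refine lt_of_le_of_ne htI.1 fun h => ?_
      rw [h] at h1
      exact absurd htc (not_le.2 h1)
    refine ⟨t, ⟨hlt, htI.2⟩, ⟨?_, ?_⟩, htc, ?_⟩
    · exact lt_of_le_of_lt ((grid_zero N).symm.trans_le (grid_mono hab N k.zero_le)) hlt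
    · exact htI.2.trans ((grid_mono hab N hkN).trans_eq (grid_last N))
    · filter_upwards [Ioo_mem_nhdsLT hlt] with u hu
      by_contra hcu
      exact absurd (hmin ⟨⟨hu.1.le, hu.2.le.trans htI.2⟩, not_lt.1 hcu⟩) (not_le.2 hu.2)
  choose! τ hτ hτB using hex
  have hinj : Set.InjOn τ s := by
    intro j hj k hk hjk
    exact disjoint_Ioc_grid hab N (hτ j hj) (hjk ▸ hτ k hk)
  rw [← Set.encard_coe_eq_coe_finsetCard, ← hinj.encard_image]
  refine Set.encard_le_encard ?_
  rintro _ ⟨k, hk, rfl⟩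
  exact hτB k hk

/-- The number of entries is at most the lower limit of the number of partition intervals which
start below the level and meet the region above it. -/
theorem encard_entries_le_liminf {g : ℝ → ℝ} {c : ℝ} (hab : a < b) {Y : ℕ → ℕ → ENNReal}
    (hY : ∀ᶠ N in atTop, ∀ k < N + 1, g (grid a b N k) < c →
      (∃ s ∈ Icc (grid a b N k) (grid a b N (k + 1)), c ≤ g s) → 1 ≤ Y N k) :
    ((entries g c a b).encard : ENNReal) ≤
      liminf (fun N => ∑ k ∈ Finset.range (N + 1), Y N k) atTop := by
  have main : ∀ F : Finset ℝ, (F : Set ℝ) ⊆ entries g c a b →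
      (F.card : ENNReal) ≤ liminf (fun N => ∑ k ∈ Finset.range (N + 1), Y N k) atTop := by
    intro F hF
    refine le_liminf_of_le (by isBoundedDefault) ?_
    have hev : ∀ᶠ N in atTop, ∀ t ∈ F, ∀ u ∈ Ico (t - mesh a b N) t, g u < c := by
      refine (Finset.eventually_all F).2 fun t ht => ?_
      obtain ⟨l, hl, hlt⟩ := (mem_nhdsLT_iff_exists_Ioo_subset).1 (hF ht).2.2
      filter_upwards [(tendsto_mesh a b).eventually_lt_const (sub_pos.2 hl)] with N hN u hu
      exact hlt ⟨by linarith [hu.1], hu.2⟩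
    filter_upwards [hev, hY] with N hN hYN
    have hk : ∀ t ∈ F, ∃ k < N + 1, t ∈ Ioc (grid a b N k) (grid a b N (k + 1)) :=
      fun t ht => exists_mem_Ioc_grid hab N (hF ht).1
    choose! κ hκN hκ using hk
    have hstep : ∀ t ∈ F, t - mesh a b N ≤ grid a b N (κ t) := by
      intro t ht
      have := (hκ t ht).2
      rw [grid_succ] at this
      linarith
    have hsep : ∀ t ∈ F, ∀ t' ∈ F, κ t = κ t' → ¬ t < t' := by
      intro t ht t' ht' he hlt
      refine absurd (hF ht).2.1 (not_le.2 (hN t' ht' t ⟨?_, hlt⟩))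
      have h1 := hstep t' ht'
      have h2 := (hκ t ht).1
      rw [he] at h2
      linarith
    have hinj : Set.InjOn κ F := fun t ht t' ht' he =>
      le_antisymm (not_lt.1 (hsep t' ht' t ht he.symm)) (not_lt.1 (hsep t ht t' ht' he))
    classical
    calc (F.card : ENNReal) = ∑ t ∈ F, 1 := by simp
      _ ≤ ∑ t ∈ F, Y N (κ t) := by
          refine Finset.sum_le_sum fun t ht => ?_
          refine hYN _ (hκN t ht) ?_ ⟨t, Ioc_subset_Icc_self (hκ t ht), (hF ht).2.1⟩
          exact hN t ht _ ⟨hstep t ht, (hκ t ht).1⟩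
      _ = ∑ k ∈ F.image κ, Y N k := (Finset.sum_image hinj).symm
      _ ≤ ∑ k ∈ Finset.range (N + 1), Y N k := by
          refine Finset.sum_le_sum_of_subset fun k hk => ?_
          obtain ⟨t, ht, rfl⟩ := Finset.mem_image.1 hk
          exact Finset.mem_range.2 (hκN t ht)
  by_cases hfin : (entries g c a b).Finite
  · rw [hfin.encard_eq_coe_toFinset_card]
    simpa using main hfin.toFinset (by simp)
  · refine le_trans le_top (le_of_eq (Eq.symm ?_))
    refine ENNReal.eq_top_of_forall_nnreal_le fun r => ?_
    obtain ⟨F, hF, hcard⟩ := Set.Infinite.exists_subset_card_eq hfin ⌈r⌉₊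
    refine le_trans ?_ (main F hF)
    rw [hcard]
    exact_mod_cast Nat.le_ceil r

end

/-! ### Great circles -/

section
variable {u v : Space}

theorem greatCircle_add (u v : Space) (φ s : ℝ) : greatCircle u v (φ + s) =
    Real.cos s • greatCircle u v φ + Real.sin s • greatCircle u v (φ + Real.pi / 2) := by
  simp only [greatCircle, Real.cos_add, Real.sin_add, Real.cos_pi_div_two, Real.sin_pi_div_two]
  module

theorem greatCircle_zero (u v : Space) : greatCircle u v 0 = u := by
  simp [greatCircle]

theorem norm_sub_inner_smul_sq (hu : ‖u‖ = 1) (hv : ‖v‖ = 1) :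
    ‖v - inner ℝ u v • u‖ ^ 2 = 1 - inner ℝ u v ^ 2 := by
  rw [norm_sub_sq_real, norm_smul, real_inner_smul_right, real_inner_comm u v, hu, hv,
    Real.norm_eq_abs, mul_one, sq_abs]
  ring

theorem inner_greatCircle (hu : ‖u‖ = 1) (hv : ‖v‖ = 1) (h : inner ℝ u v ^ 2 < 1) (φ ψ : ℝ) :
    inner ℝ (greatCircle u v φ) (greatCircle u v ψ) = Real.cos (φ - ψ) := by
  have hn := norm_sub_inner_smul_sq hu hv
  set w := v - inner ℝ u v • u with hw
  have hw0 : ‖w‖ ≠ 0 := by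
    intro h0
    rw [h0] at hn
    linarith
  have huw : inner ℝ u w = 0 := by
    rw [hw, inner_sub_right, real_inner_smul_right, real_inner_self_eq_norm_sq, hu]; ring
  have hwu : inner ℝ w u = 0 := by rw [real_inner_comm]; exact huw
  have hww : inner ℝ w w = ‖w‖ ^ 2 := real_inner_self_eq_norm_sq w
  have huu : inner ℝ u u = (1 : ℝ) := by rw [real_inner_self_eq_norm_sq, hu]; norm_num
  simp only [greatCircle, ← hw, inner_add_left, inner_add_right, real_inner_smul_left,
    real_inner_smul_right, huw, hwu, hww, huu, Real.cos_sub]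
  field_simp
  ring

theorem norm_greatCircle (hu : ‖u‖ = 1) (hv : ‖v‖ = 1) (h : inner ℝ u v ^ 2 < 1) (φ : ℝ) :
    ‖greatCircle u v φ‖ = 1 := by
  rw [← sq_eq_sq₀ (norm_nonneg _) zero_le_one, ← real_inner_self_eq_norm_sq,
    inner_greatCircle hu hv h]
  simp

theorem norm_greatCircle_sub_le (hu : ‖u‖ = 1) (hv : ‖v‖ = 1) (h : inner ℝ u v ^ 2 < 1)
    (φ ψ : ℝ) : ‖greatCircle u v φ - greatCircle u v ψ‖ ≤ |φ - ψ| := by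
  refine le_of_sq_le_sq ?_ (abs_nonneg _)
  rw [norm_sub_sq_real, norm_greatCircle hu hv h, norm_greatCircle hu hv h,
    inner_greatCircle hu hv h, sq_abs]
  linarith [Real.one_sub_sq_div_two_le_cos (x := φ - ψ)]

theorem greatCircle_angle (hu : ‖u‖ = 1) (hv : ‖v‖ = 1) (h : inner ℝ u v ^ 2 < 1) :
    greatCircle u v (InnerProductGeometry.angle u v) = v := by
  have hn := norm_sub_inner_smul_sq hu hv
  have hcos : Real.cos (InnerProductGeometry.angle u v) = inner ℝ u v := by
    rw [InnerProductGeometry.cos_angle, hu, hv]; simp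
  have hsin : Real.sin (InnerProductGeometry.angle u v) = ‖v - inner ℝ u v • u‖ := by
    rw [← sq_eq_sq₀ (InnerProductGeometry.sin_angle_nonneg u v) (norm_nonneg _), hn, Real.sin_sq,
      hcos]
  have hw0 : ‖v - inner ℝ u v • u‖ ≠ 0 := by
    intro h0
    rw [h0] at hn
    linarith
  rw [greatCircle, hcos, hsin, smul_smul, mul_inv_cancel₀ hw0, one_smul]
  abel

theorem greatCircle_map (R : Rot) (u v : Space) (φ : ℝ) :
    greatCircle (R.1 u) (R.1 v) φ = R.1 (greatCircle u v φ) := by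
  simp only [greatCircle, Rot.inner_map_map, ← map_smul, ← map_sub, Rot.norm_map, ← map_add]

end

/-! ### Trajectories -/

/-- The direction of travel at time `t`: a quarter turn ahead of the position. -/
noncomputable def heading (ρ : ℝ) (d : Itinerary) (t : ℝ) : Space :=
  greatCircle (d (currentLeg ρ d t)).1 (d (currentLeg ρ d t + 1)).1
    ((d (currentLeg ρ d t)).2 * (t - waypointTime ρ d (currentLeg ρ d t)) / ρ + Real.pi / 2)

/-- The angular speed at time `t`. -/
noncomputable def angularSpeed (ρ : ℝ) (d : Itinerary) (t : ℝ) : ℝ :=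
  (d (currentLeg ρ d t)).2 / ρ

/-- The itinerary turned by a rotation. -/
def turnItinerary (R : Rot) (d : Itinerary) : Itinerary := fun l => (Rot.onSphere R (d l).1, (d l).2)

section
variable (ρ : ℝ) (R : Rot) (d : Itinerary) (t : ℝ)

theorem waypointTime_turn (l : ℕ) : waypointTime ρ (turnItinerary R d) l = waypointTime ρ d l := by
  unfold waypointTime legTime geoDist
  simp only [turnItinerary, Rot.onSphere, Rot.angle_map_map]

theorem currentLeg_turn : currentLeg ρ (turnItinerary R d) t = currentLeg ρ d t := by
  simp only [currentLeg, waypointTime_turn]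

theorem angularSpeed_turn : angularSpeed ρ (turnItinerary R d) t = angularSpeed ρ d t := by
  simp only [angularSpeed, currentLeg_turn, turnItinerary]

theorem position_turn : position ρ (turnItinerary R d) t = R.1 (position ρ d t) := by
  simp only [position, currentLeg_turn, waypointTime_turn, ← greatCircle_map]
  rfl

theorem heading_turn : heading ρ (turnItinerary R d) t = R.1 (heading ρ d t) := by
  simp only [heading, currentLeg_turn, waypointTime_turn, ← greatCircle_map]
  rfl

end

section Measurability

/-- Unbounded sets, for which `sSup` takes the junk value `0`, are allowed. -/
theorem measurable_sSup_nat {α : Type*} [MeasurableSpace α] {P : ℕ → α → Prop}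
    (hP : ∀ l, MeasurableSet {x | P l x}) : Measurable fun x => sSup {l | P l x} := by
  refine measurable_of_Ici fun n => ?_
  rcases Nat.eq_zero_or_pos n with rfl | hn
  · simp
  have : ((fun x => sSup {l | P l x}) ⁻¹' Ici n) =
      (⋃ m, ⋂ l, {x | P l x → l ≤ m}) ∩ ⋃ l ∈ Ici n, {x | P l x} := by
    ext x
    simp only [mem_preimage, mem_Ici, mem_inter_iff, mem_iUnion, mem_iInter, mem_ofPred_eq,
      exists_prop]
    constructor
    · intro h
      have hne : {l | P l x}.Nonempty := by
        by_contra hne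
        rw [not_nonempty_iff_eq_empty] at hne
        rw [hne] at h
        simp at h
        omega
      have hbdd : BddAbove {l | P l x} := by
        by_contra hb
        rw [Nat.sSup_of_not_bddAbove hb] at h
        omega
      exact ⟨⟨_, fun l hl => le_csSup hbdd hl⟩, _, h, Nat.sSup_mem hne hbdd⟩
    · rintro ⟨⟨m, hm⟩, l, hl, hPl⟩
      exact hl.trans (le_csSup ⟨m, fun l hl => hm l hl⟩ hPl)
  rw [this]
  refine (MeasurableSet.iUnion fun m => MeasurableSet.iInter fun l => ?_).inter
    (MeasurableSet.iUnion fun l => MeasurableSet.iUnion fun _ => hP l)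
  by_cases h : l ≤ m
  · simp [h]
  · have : {x | P l x → l ≤ m} = {x | P l x}ᶜ := by ext x; simp [h]
    rw [this]
    exact (hP l).compl

theorem measurable_apply_nat {α β : Type*} [MeasurableSpace α] [MeasurableSpace β]
    {f : ℕ → α → β} (hf : ∀ l, Measurable (f l)) {n : α → ℕ} (hn : Measurable n) :
    Measurable fun x => f (n x) x :=
  (measurable_from_prod_countable_left (f := fun q : α × ℕ => f q.2 q.1) hf).comp
    (measurable_id.prodMk hn)

variable (ρ : ℝ) {α : Type*} [MeasurableSpace α] {d : α → Itinerary} {τ : α → ℝ}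

theorem measurable_greatCircle {u v : α → Space} {φ : α → ℝ} (hu : Measurable u)
    (hv : Measurable v) (hφ : Measurable φ) : Measurable fun x => greatCircle (u x) (v x) (φ x) := by
  unfold greatCircle
  fun_prop

theorem measurable_waypoint (hd : Measurable d) (l : ℕ) :
    Measurable fun x => ((d x l).1 : Space) :=
  measurable_subtype_coe.comp ((measurable_pi_apply l).comp hd).fst

theorem measurable_speed (hd : Measurable d) (l : ℕ) : Measurable fun x => (d x l).2 :=
  ((measurable_pi_apply l).comp hd).snd

theorem measurable_waypointTime (hd : Measurable d) (l : ℕ) :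
    Measurable fun x => waypointTime ρ (d x) l := by
  unfold waypointTime
  refine Finset.measurable_sum _ fun i _ => ?_
  unfold legTime geoDist InnerProductGeometry.angle
  have h1 := measurable_waypoint hd i
  have h2 := measurable_waypoint hd (i + 1)
  have h3 := measurable_speed hd i
  have h4 : Measurable fun x => inner ℝ ((d x i).1 : Space) ((d x (i + 1)).1 : Space) /
      (‖((d x i).1 : Space)‖ * ‖((d x (i + 1)).1 : Space)‖) := by fun_prop
  exact ((Real.measurable_arccos.comp h4).const_mul ρ).div h3

theorem measurable_currentLeg (hd : Measurable d) (hτ : Measurable τ) :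
    Measurable fun x => currentLeg ρ (d x) (τ x) :=
  measurable_sSup_nat fun l => measurableSet_le (measurable_waypointTime ρ hd l) hτ

theorem measurable_position (hd : Measurable d) (hτ : Measurable τ) :
    Measurable fun x => position ρ (d x) (τ x) := by
  refine measurable_apply_nat (f := fun l x => greatCircle (d x l).1 (d x (l + 1)).1
    ((d x l).2 * (τ x - waypointTime ρ (d x) l) / ρ)) (fun l => ?_) (measurable_currentLeg ρ hd hτ)
  exact measurable_greatCircle (measurable_waypoint hd l) (measurable_waypoint hd (l + 1))
    (((measurable_speed hd l).mul (hτ.sub (measurable_waypointTime ρ hd l))).div_const ρ)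

theorem measurable_heading (hd : Measurable d) (hτ : Measurable τ) :
    Measurable fun x => heading ρ (d x) (τ x) := by
  refine measurable_apply_nat (f := fun l x => greatCircle (d x l).1 (d x (l + 1)).1
    ((d x l).2 * (τ x - waypointTime ρ (d x) l) / ρ + Real.pi / 2)) (fun l => ?_)
    (measurable_currentLeg ρ hd hτ)
  exact measurable_greatCircle (measurable_waypoint hd l) (measurable_waypoint hd (l + 1))
    ((((measurable_speed hd l).mul (hτ.sub (measurable_waypointTime ρ hd l))).div_const ρ).add_const _)

theorem measurable_angularSpeed (hd : Measurable d) (hτ : Measurable τ) :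
    Measurable fun x => angularSpeed ρ (d x) (τ x) :=
  (measurable_apply_nat (f := fun l x => (d x l).2) (fun l => measurable_speed hd l)
    (measurable_currentLeg ρ hd hτ)).div_const ρ

end Measurability

/-- The itineraries to which the trajectory analysis applies: admissible speeds, no two successive
waypoints equal or antipodal, and infinitely long travel. Almost every itinerary is of this kind. -/
structure Regular (ρ smin smax : ℝ) (d : Itinerary) : Prop where
  speed : ∀ l, (d l).2 ∈ Icc smin smax
  inner_sq : ∀ l, inner ℝ ((d l).1 : Space) ((d (l + 1)).1 : Space) ^ 2 < 1
  tendsto : Tendsto (waypointTime ρ d) atTop atTop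

theorem norm_waypoint (d : Itinerary) (l : ℕ) : ‖((d l).1 : Space)‖ = 1 :=
  mem_sphere_zero_iff_norm.1 (d l).1.2

/-- The motion along leg `l`, extended to all times. -/
noncomputable def legPosition (ρ : ℝ) (d : Itinerary) (l : ℕ) (t : ℝ) : Space :=
  greatCircle (d l).1 (d (l + 1)).1 ((d l).2 * (t - waypointTime ρ d l) / ρ)

theorem position_eq_legPosition (ρ : ℝ) (d : Itinerary) (t : ℝ) :
    position ρ d t = legPosition ρ d (currentLeg ρ d t) t := rfl

namespace Regular
variable {ρ smin smax : ℝ} {d : Itinerary}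

theorem speed_pos (hd : Regular ρ smin smax d) (hs : 0 < smin) (l : ℕ) : 0 < (d l).2 :=
  hs.trans_le (hd.speed l).1

theorem waypointTime_succ (ρ : ℝ) (d : Itinerary) (l : ℕ) :
    waypointTime ρ d (l + 1) = waypointTime ρ d l + legTime ρ d l :=
  Finset.sum_range_succ _ _

theorem legTime_pos (hd : Regular ρ smin smax d) (hρ : 0 < ρ) (hs : 0 < smin) (l : ℕ) :
    0 < legTime ρ d l := by
  refine div_pos (mul_pos hρ ?_) (hd.speed_pos hs l)
  refine lt_of_le_of_ne (InnerProductGeometry.angle_nonneg _ _) fun h => ?_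
  have h1 := InnerProductGeometry.cos_angle ((d l).1 : Space) ((d (l + 1)).1 : Space)
  rw [← h, norm_waypoint, norm_waypoint, Real.cos_zero] at h1
  have h2 := hd.inner_sq l
  norm_num at h1
  rw [← h1] at h2
  norm_num at h2

theorem strictMono (hd : Regular ρ smin smax d) (hρ : 0 < ρ) (hs : 0 < smin) :
    StrictMono (waypointTime ρ d) :=
  strictMono_nat_of_lt_succ fun l => by
    rw [waypointTime_succ]; linarith [hd.legTime_pos hρ hs l]

theorem bddAbove (hd : Regular ρ smin smax d) (t : ℝ) :
    BddAbove {l : ℕ | waypointTime ρ d l ≤ t} := by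
  obtain ⟨m, hm⟩ := (hd.tendsto.eventually_gt_atTop t).exists_forall_of_atTop
  exact ⟨m, fun l hl => not_lt.1 fun h => absurd hl (not_le.2 (hm l h.le))⟩

theorem lt_waypointTime (hd : Regular ρ smin smax d) (t : ℝ) :
    t < waypointTime ρ d (currentLeg ρ d t + 1) := by
  by_contra h
  have := le_csSup (hd.bddAbove t) (not_lt.1 h)
  exact absurd this (by unfold currentLeg; omega)

theorem waypointTime_le (hd : Regular ρ smin smax d) {t : ℝ} (h : currentLeg ρ d t ≠ 0) :
    waypointTime ρ d (currentLeg ρ d t) ≤ t := by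
  have hne : {l : ℕ | waypointTime ρ d l ≤ t}.Nonempty := by
    by_contra hne
    rw [not_nonempty_iff_eq_empty] at hne
    exact h (by unfold currentLeg; rw [hne]; simp)
  exact Nat.sSup_mem hne (hd.bddAbove t)

theorem currentLeg_mono (hd : Regular ρ smin smax d) : Monotone (currentLeg ρ d) := by
  intro s t hst
  rcases Nat.eq_zero_or_pos (currentLeg ρ d s) with h | h
  · rw [h]; exact Nat.zero_le _
  · exact le_csSup (hd.bddAbove t) ((hd.waypointTime_le h.ne').trans hst)

theorem norm_legPosition_sub_le (hd : Regular ρ smin smax d) (hρ : 0 < ρ) (hs : 0 < smin) (l : ℕ)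
    {s t : ℝ} (hst : s ≤ t) :
    ‖legPosition ρ d l t - legPosition ρ d l s‖ ≤ smax / ρ * (t - s) := by
  refine (norm_greatCircle_sub_le (norm_waypoint d l) (norm_waypoint d (l + 1)) (hd.inner_sq l)
    _ _).trans ?_
  have h1 : (d l).2 * (t - waypointTime ρ d l) / ρ - (d l).2 * (s - waypointTime ρ d l) / ρ =
      (d l).2 / ρ * (t - s) := by ring
  have h2 := hd.speed_pos hs l
  rw [h1, abs_of_nonneg (mul_nonneg (by positivity) (sub_nonneg.2 hst))]
  have := (hd.speed l).2
  have := sub_nonneg.2 hst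
  gcongr

theorem legPosition_start (l : ℕ) : legPosition ρ d l (waypointTime ρ d l) = (d l).1 := by
  simp [legPosition, greatCircle_zero]

theorem legPosition_end (hd : Regular ρ smin smax d) (hρ : 0 < ρ) (hs : 0 < smin) (l : ℕ) :
    legPosition ρ d l (waypointTime ρ d (l + 1)) = (d (l + 1)).1 := by
  have h2 := hd.speed_pos hs l
  rw [legPosition, waypointTime_succ, add_sub_cancel_left, legTime, geoDist,
    mul_div_cancel₀ _ h2.ne', mul_div_cancel_left₀ _ hρ.ne']
  exact greatCircle_angle (norm_waypoint d l) (norm_waypoint d (l + 1)) (hd.inner_sq l)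

/-- The speed bound across changes of leg, by induction along the legs between the two times. -/
theorem norm_waypoint_sub_position_le (hd : Regular ρ smin smax d) (hρ : 0 < ρ) (hs : 0 < smin)
    (m : ℕ) {s : ℝ} (hm : currentLeg ρ d s ≤ m) :
    ‖((d (m + 1)).1 : Space) - position ρ d s‖ ≤ smax / ρ * (waypointTime ρ d (m + 1) - s) := by
  induction m with
  | zero =>
    have h0 : currentLeg ρ d s = 0 := Nat.le_zero.1 hm
    have hlt := hd.lt_waypointTime s
    rw [position_eq_legPosition, ← hd.legPosition_end hρ hs 0]
    rw [h0] at hlt ⊢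
    exact hd.norm_legPosition_sub_le hρ hs 0 hlt.le
  | succ m ih =>
    rcases Nat.lt_or_ge m (currentLeg ρ d s) with h | h
    · have h0 : currentLeg ρ d s = m + 1 := le_antisymm hm h
      have hlt := hd.lt_waypointTime s
      rw [position_eq_legPosition, ← hd.legPosition_end hρ hs (m + 1)]
      rw [h0] at hlt ⊢
      exact hd.norm_legPosition_sub_le hρ hs _ hlt.le
    · have h1 := ih h
      have h2 := hd.norm_legPosition_sub_le hρ hs (m + 1)
        (hd.strictMono hρ hs (Nat.lt_succ_self (m + 1))).le
      rw [hd.legPosition_end hρ hs, legPosition_start] at h2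
      calc ‖((d (m + 1 + 1)).1 : Space) - position ρ d s‖
          ≤ ‖((d (m + 1 + 1)).1 : Space) - (d (m + 1)).1‖ +
            ‖((d (m + 1)).1 : Space) - position ρ d s‖ := norm_sub_le_norm_sub_add_norm_sub _ _ _
        _ ≤ smax / ρ * (waypointTime ρ d (m + 1 + 1) - waypointTime ρ d (m + 1)) +
            smax / ρ * (waypointTime ρ d (m + 1) - s) := add_le_add h2 h1
        _ = _ := by ring

theorem norm_position_sub_le (hd : Regular ρ smin smax d) (hρ : 0 < ρ) (hs : 0 < smin)
    {s t : ℝ} (hst : s ≤ t) :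
    ‖position ρ d t - position ρ d s‖ ≤ smax / ρ * (t - s) := by
  rcases (hd.currentLeg_mono hst).eq_or_lt with h | h
  · rw [position_eq_legPosition, position_eq_legPosition, h]
    exact hd.norm_legPosition_sub_le hρ hs _ hst
  · obtain ⟨m, hm⟩ := Nat.exists_eq_succ_of_ne_zero (Nat.ne_zero_of_lt h)
    have h1 := hd.norm_waypoint_sub_position_le hρ hs m (s := s) (by omega)
    have h2 := hd.norm_legPosition_sub_le hρ hs (currentLeg ρ d t)
      (hd.waypointTime_le (Nat.ne_zero_of_lt h))
    rw [legPosition_start, ← position_eq_legPosition, hm] at h2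
    calc ‖position ρ d t - position ρ d s‖
        ≤ ‖position ρ d t - (d (m + 1)).1‖ + ‖((d (m + 1)).1 : Space) - position ρ d s‖ :=
          norm_sub_le_norm_sub_add_norm_sub _ _ _
      _ ≤ smax / ρ * (t - waypointTime ρ d (m + 1)) +
          smax / ρ * (waypointTime ρ d (m + 1) - s) := add_le_add h2 h1
      _ = _ := by ring

theorem continuous_position (hd : Regular ρ smin smax d) (hρ : 0 < ρ) (hs : 0 < smin) :
    Continuous (position ρ d) := by
  have hL : 0 ≤ smax / ρ := div_nonneg ((hd.speed_pos hs 0).le.trans (hd.speed 0).2) hρ.le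
  refine (LipschitzWith.of_dist_le_mul (K := ⟨smax / ρ, hL⟩) fun s t => ?_).continuous
  rw [dist_eq_norm, Real.dist_eq]
  rcases le_total s t with h | h
  · rw [norm_sub_rev, abs_sub_comm, abs_of_nonneg (sub_nonneg.2 h)]
    exact hd.norm_position_sub_le hρ hs h
  · rw [abs_of_nonneg (sub_nonneg.2 h)]
    exact hd.norm_position_sub_le hρ hs h

theorem norm_position (hd : Regular ρ smin smax d) (t : ℝ) : ‖position ρ d t‖ = 1 :=
  norm_greatCircle (norm_waypoint d _) (norm_waypoint d _) (hd.inner_sq _) _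

theorem norm_heading (hd : Regular ρ smin smax d) (t : ℝ) : ‖heading ρ d t‖ = 1 :=
  norm_greatCircle (norm_waypoint d _) (norm_waypoint d _) (hd.inner_sq _) _

theorem inner_position_heading (hd : Regular ρ smin smax d) (t : ℝ) :
    inner ℝ (position ρ d t) (heading ρ d t) = 0 := by
  unfold position heading
  rw [inner_greatCircle (norm_waypoint d _) (norm_waypoint d _) (hd.inner_sq _)]
  rw [sub_add_cancel_left, Real.cos_neg, Real.cos_pi_div_two]

theorem position_eq_of_currentLeg_eq {s t : ℝ} (h : currentLeg ρ d s = currentLeg ρ d t) :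
    position ρ d s = Real.cos (angularSpeed ρ d t * (s - t)) • position ρ d t +
      Real.sin (angularSpeed ρ d t * (s - t)) • heading ρ d t := by
  unfold position heading angularSpeed
  rw [← greatCircle_add, h]
  congr 1
  ring

theorem angularSpeed_mem (hd : Regular ρ smin smax d) (hρ : 0 < ρ) (t : ℝ) :
    angularSpeed ρ d t ∈ Icc (smin / ρ) (smax / ρ) := by
  have := hd.speed (currentLeg ρ d t)
  exact ⟨by unfold angularSpeed; gcongr; exact this.1, by unfold angularSpeed; gcongr; exact this.2⟩

end Regular

theorem sum_currentLeg_ne_le {n : ℕ → ℕ} (hn : Monotone n) (N : ℕ) :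
    ∑ k ∈ Finset.range N, (if n k = n (k + 1) then 0 else 1 : ℕ) ≤ n N := by
  induction N with
  | zero => simp
  | succ N ih =>
    rw [Finset.sum_range_succ]
    have := hn N.le_succ
    split_ifs with h
    · rw [add_zero]; exact ih.trans this
    · have : n N < n (N + 1) := lt_of_le_of_ne this h
      omega

/-- First order expansion, with a second order error, of the height over each other of two points
moving on great circles. -/
theorem abs_inner_rotation_sub_le {p p₁ q q₁ : Space} (hp : ‖p‖ = 1) (hp₁ : ‖p₁‖ = 1)
    (hq : ‖q‖ = 1) (hq₁ : ‖q₁‖ = 1) {x y δ : ℝ} (hx : |x| ≤ δ) (hy : |y| ≤ δ) (hδ : δ ≤ 1) :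
    |inner ℝ (Real.cos x • p + Real.sin x • p₁) (Real.cos y • q + Real.sin y • q₁) -
      inner ℝ p q - (x * inner ℝ p₁ q + y * inner ℝ p q₁)| ≤ 16 * δ ^ 2 := by
  have hδ0 : 0 ≤ δ := (abs_nonneg x).trans hx
  have hcos : ∀ z : ℝ, |z| ≤ δ → |Real.cos z - 1| ≤ δ ^ 2 := by
    intro z hz
    have h1 := Real.one_sub_sq_div_two_le_cos (x := z)
    have h2 := Real.cos_le_one z
    have h3 : z ^ 2 ≤ δ ^ 2 := by rw [← sq_abs]; gcongr
    rw [abs_le]; constructor <;> nlinarith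
  have hsin : ∀ z : ℝ, |z| ≤ δ → |Real.sin z - z| ≤ δ ^ 2 := by
    intro z hz
    have h1 := Real.sin_bound (hz.trans hδ)
    have h3 : |z| ^ 5 ≤ δ ^ 5 := by gcongr
    have h4 : |z| ^ 3 ≤ δ ^ 3 := by gcongr
    have h5 : |z ^ 3 / 6| ≤ δ ^ 3 / 6 := by
      rw [abs_div, abs_pow]; norm_num; linarith
    have h6 : δ ^ 3 ≤ δ ^ 2 := pow_le_pow_of_le_one hδ0 hδ (by norm_num)
    have h7 : δ ^ 5 ≤ δ ^ 2 := pow_le_pow_of_le_one hδ0 hδ (by norm_num)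
    calc |Real.sin z - z| = |(Real.sin z - (z - z ^ 3 / 6)) - z ^ 3 / 6| := by congr 1; ring
      _ ≤ |Real.sin z - (z - z ^ 3 / 6)| + |z ^ 3 / 6| := abs_sub _ _
      _ ≤ δ ^ 2 := by nlinarith [sq_nonneg δ]
  have hinner : ∀ {a b : Space}, ‖a‖ = 1 → ‖b‖ = 1 → |inner ℝ a b| ≤ 1 := by
    intro a b ha hb
    have := abs_real_inner_le_norm a b
    simpa [ha, hb] using this
  have e : inner ℝ (Real.cos x • p + Real.sin x • p₁) (Real.cos y • q + Real.sin y • q₁) -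
      inner ℝ p q - (x * inner ℝ p₁ q + y * inner ℝ p q₁) =
      (Real.cos x * (Real.cos y - 1) + (Real.cos x - 1)) * inner ℝ p q +
      ((Real.sin x * (Real.cos y - 1)) + (Real.sin x - x)) * inner ℝ p₁ q +
      ((Real.cos x - 1) * Real.sin y + (Real.sin y - y)) * inner ℝ p q₁ +
      (Real.sin x * Real.sin y) * inner ℝ p₁ q₁ := by
    simp only [inner_add_left, inner_add_right, real_inner_smul_left, real_inner_smul_right]
    ring
  have hmul : ∀ {a b A B : ℝ}, |a| ≤ A → |b| ≤ B → |a * b| ≤ A * B := by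
    intro a b A B ha hb
    rw [abs_mul]
    exact mul_le_mul ha hb (abs_nonneg _) ((abs_nonneg _).trans ha)
  have hsx : |Real.sin x| ≤ δ := (Real.abs_sin_le_abs).trans hx
  have hsy : |Real.sin y| ≤ δ := (Real.abs_sin_le_abs).trans hy
  have k1 := hmul (Real.abs_cos_le_one x) (hcos y hy)
  have k2 := hmul (Real.abs_sin_le_one x) (hcos y hy)
  have k3 := hmul (hcos x hx) (Real.abs_sin_le_one y)
  have k4 := hmul hsx hsy
  have l1 := hmul ((abs_add_le _ _).trans (add_le_add k1 (hcos x hx))) (hinner hp hq)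
  have l2 := hmul ((abs_add_le _ _).trans (add_le_add k2 (hsin x hx))) (hinner hp₁ hq)
  have l3 := hmul ((abs_add_le _ _).trans (add_le_add k3 (hsin y hy))) (hinner hp hq₁)
  have l4 := hmul k4 (hinner hp₁ hq₁)
  rw [e]
  refine (abs_add_le _ _).trans ((add_le_add ((abs_add_le _ _).trans
    (add_le_add ((abs_add_le _ _).trans (add_le_add l1 l2)) l3)) l4).trans ?_)
  nlinarith [sq_nonneg δ]

/-! ### The law of the itineraries -/

/-- The law of all waypoints and speeds. -/
noncomputable def movement (M : ℕ) (smin smax : ℝ) : Measure (Fin M × ℕ → UnitSphere × ℝ) :=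
  Measure.infinitePi fun _ : Fin M × ℕ => uniformSphere.prod (uniformSpeed smin smax)

instance (M : ℕ) (smin smax : ℝ) : IsProbabilityMeasure (movement M smin smax) := by
  unfold movement; infer_instance

/-- Each waypoint turned by its own rotation. -/
def turn {M : ℕ} (R : Fin M × ℕ → Rot) (ω : Fin M × ℕ → UnitSphere × ℝ) :
    Fin M × ℕ → UnitSphere × ℝ := fun j => (Rot.onSphere (R j) (ω j).1, (ω j).2)

section
variable {M : ℕ} {smin smax : ℝ}

theorem measurePreserving_turn (R : Fin M × ℕ → Rot) :
    MeasurePreserving (turn R) (movement M smin smax) (movement M smin smax) := by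
  have hm : ∀ j, Measurable fun x : UnitSphere × ℝ => (Rot.onSphere (R j) x.1, x.2) := fun j =>
    (Rot.measurable_onSphere measurable_const measurable_fst).prodMk measurable_snd
  refine ⟨measurable_pi_lambda _ fun j => (hm j).comp (measurable_pi_apply j), ?_⟩
  unfold movement turn
  rw [Measure.infinitePi_map_pi _ hm]
  congr 1
  funext j
  exact ((Rot.measurePreserving_onSphere (R j)).prod (MeasurePreserving.id _)).map_eq

theorem measurable_turn {Θ : Type*} [MeasurableSpace Θ] {fam : Θ → Fin M × ℕ → Rot}
    (hfam : ∀ j, Measurable fun θ => fam θ j) :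
    Measurable fun x : (Fin M × ℕ → UnitSphere × ℝ) × Θ => turn (fam x.2) x.1 := by
  refine measurable_pi_lambda _ fun j => Measurable.prodMk ?_ ?_
  · exact Rot.measurable_onSphere ((hfam j).comp measurable_snd)
      ((measurable_pi_apply j).comp measurable_fst).fst
  · exact ((measurable_pi_apply j).comp measurable_fst).snd

/-- By rotation invariance, an expectation may first be averaged over any random rotation of the
waypoints. -/
theorem lintegral_turn {Θ : Type*} [MeasurableSpace Θ] (ν : Measure Θ) [IsProbabilityMeasure ν]
    {fam : Θ → Fin M × ℕ → Rot} (hfam : ∀ j, Measurable fun θ => fam θ j)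
    {F : (Fin M × ℕ → UnitSphere × ℝ) → ENNReal} (hF : Measurable F) :
    ∫⁻ ω, F ω ∂movement M smin smax =
      ∫⁻ ω, ∫⁻ θ, F (turn (fam θ) ω) ∂ν ∂movement M smin smax := by
  rw [lintegral_lintegral_swap (f := fun ω θ => F (turn (fam θ) ω)) (hF.comp (measurable_turn hfam)).aemeasurable]
  have : ∀ θ, ∫⁻ ω, F (turn (fam θ) ω) ∂movement M smin smax = ∫⁻ ω, F ω ∂movement M smin smax :=
    fun θ => (measurePreserving_turn (fam θ)).lintegral_comp hF
  simp_rw [this]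
  simp

/-- The averaging principle of `lintegral_turn`, for bounded complex functions. -/
theorem integral_turn {Θ : Type*} [MeasurableSpace Θ] (ν : Measure Θ) [IsProbabilityMeasure ν]
    {fam : Θ → Fin M × ℕ → Rot} (hfam : ∀ j, Measurable fun θ => fam θ j)
    {F : (Fin M × ℕ → UnitSphere × ℝ) → ℂ} (hF : Measurable F) {B : ℝ} (hB : ∀ ω, ‖F ω‖ ≤ B) :
    ∫ ω, F ω ∂movement M smin smax = ∫ ω, ∫ θ, F (turn (fam θ) ω) ∂ν ∂movement M smin smax := by
  rw [integral_integral_swap (f := fun ω θ => F (turn (fam θ) ω)) (Integrable.of_bound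
    (hF.comp (measurable_turn hfam)).aestronglyMeasurable B (Filter.Eventually.of_forall fun _ => hB _))]
  have : ∀ θ, ∫ ω, F (turn (fam θ) ω) ∂movement M smin smax = ∫ ω, F ω ∂movement M smin smax := by
    intro θ
    conv_rhs => rw [← (measurePreserving_turn (smin := smin) (smax := smax) (fam θ)).map_eq]
    rw [integral_map
      (measurePreserving_turn (smin := smin) (smax := smax) (fam θ)).measurable.aemeasurable
      hF.aestronglyMeasurable]
  simp_rw [this]
  simp

open Classical in
/-- The same rotation for the waypoints with index in `J`, and no rotation for the others. -/
noncomputable def turnOn (J : Set (Fin M × ℕ)) (R : Rot) : Fin M × ℕ → Rot :=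
  fun j => if j ∈ J then R else 1

theorem measurable_turnOn (J : Set (Fin M × ℕ)) (j : Fin M × ℕ) :
    Measurable fun R => turnOn J R j := by
  unfold turnOn
  split_ifs
  · exact measurable_id
  · exact measurable_const

theorem onSphere_one (u : UnitSphere) : Rot.onSphere 1 u = u := Subtype.ext rfl

theorem turn_turnOn_of_mem {J : Set (Fin M × ℕ)} {j : Fin M × ℕ} (hj : j ∈ J) (R : Rot)
    (ω : Fin M × ℕ → UnitSphere × ℝ) :
    turn (turnOn J R) ω j = (Rot.onSphere R (ω j).1, (ω j).2) := by simp [turn, turnOn, hj]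

theorem turn_turnOn_of_notMem {J : Set (Fin M × ℕ)} {j : Fin M × ℕ} (hj : j ∉ J) (R : Rot)
    (ω : Fin M × ℕ → UnitSphere × ℝ) : turn (turnOn J R) ω j = ω j := by
  simp [turn, turnOn, hj, onSphere_one]

/-- The itinerary of device `i`. -/
def itinerary (ω : Fin M × ℕ → UnitSphere × ℝ) (i : Fin M) : Itinerary := fun l => ω (i, l)

theorem measurable_itinerary (i : Fin M) :
    Measurable fun ω : Fin M × ℕ → UnitSphere × ℝ => itinerary ω i :=
  measurable_pi_lambda _ fun _ => measurable_pi_apply _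

theorem ae_speed_mem (hs : smin ≤ smax) :
    ∀ᵐ ω ∂movement M smin smax, ∀ j, (ω j).2 ∈ Icc smin smax := by
  rw [ae_all_iff]
  intro j
  have h1 := measurePreserving_eval_infinitePi
    (fun _ : Fin M × ℕ => uniformSphere.prod (uniformSpeed smin smax)) j
  have h2 : MeasurePreserving (fun ω : Fin M × ℕ → UnitSphere × ℝ => (ω j).2)
      (movement M smin smax) (uniformSpeed smin smax) := measurePreserving_snd.comp h1
  refine h2.quasiMeasurePreserving.ae ?_
  unfold uniformSpeed
  rw [ae_map_iff (p := fun x => x ∈ Icc smin smax) (by fun_prop) measurableSet_Icc]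
  filter_upwards [ae_restrict_mem measurableSet_Icc] with u hu
  constructor <;> nlinarith [hu.1, hu.2]

/-- Successive waypoints are almost surely neither equal nor antipodal. -/
theorem ae_inner_sq_lt_one : ∀ᵐ ω ∂movement M smin smax, ∀ (i : Fin M) (l : ℕ),
    inner ℝ ((ω (i, l)).1 : Space) ((ω (i, l + 1)).1 : Space) ^ 2 < 1 := by
  simp_rw [ae_all_iff]
  intro i l
  have hm : ∀ l, Measurable fun ω : Fin M × ℕ → UnitSphere × ℝ => ((ω (i, l)).1 : Space) := fun l =>
    measurable_subtype_coe.comp (measurable_pi_apply _).fst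
  have hS : MeasurableSet ({1, -1} : Set ℝ) := (Set.toFinite _).measurableSet
  have hFm : Measurable fun ω : Fin M × ℕ → UnitSphere × ℝ => ({1, -1} : Set ℝ).indicator
      (1 : ℝ → ENNReal) (inner ℝ ((ω (i, l)).1 : Space) ((ω (i, l + 1)).1 : Space)) :=
    (measurable_one.indicator hS).comp ((hm l).inner (hm (l + 1)))
  have h0 : ∫⁻ ω, ({1, -1} : Set ℝ).indicator 1
      (inner ℝ ((ω (i, l)).1 : Space) ((ω (i, l + 1)).1 : Space)) ∂movement M smin smax = 0 := by
    rw [lintegral_turn Rot.haar (measurable_turnOn {(i, l + 1)}) hFm]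
    refine (lintegral_congr fun ω => ?_).trans lintegral_zero
    have hne : ((i, l) : Fin M × ℕ) ∉ ({(i, l + 1)} : Set (Fin M × ℕ)) := by simp
    simp only [turn_turnOn_of_mem (mem_singleton _), turn_turnOn_of_notMem hne]
    change ∫⁻ R, ({1, -1} : Set ℝ).indicator 1
      (inner ℝ ((ω (i, l)).1 : Space) (R.1 (ω (i, l + 1)).1)) ∂(Rot.haar) = 0
    rw [← lintegral_map (μ := Rot.haar) (f := ({1, -1} : Set ℝ).indicator 1)
      (g := fun R => inner ℝ ((ω (i, l)).1 : Space) (R.1 (ω (i, l + 1)).1))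
      (measurable_one.indicator hS) (by fun_prop),
      map_inner_haar (mem_sphere_zero_iff_norm.1 (ω (i, l)).1.2)
        (mem_sphere_zero_iff_norm.1 (ω (i, l + 1)).1.2), lintegral_indicator_one hS, uniformHeight]
    simp only [Measure.smul_apply, smul_eq_mul, mul_eq_zero]
    right
    exact le_antisymm ((Measure.restrict_apply_le _ _).trans
      (Set.Finite.measure_zero (Set.toFinite _) _).le) bot_le
  rw [lintegral_eq_zero_iff hFm] at h0
  filter_upwards [h0] with ω hω
  have h1 := inner_mem_Icc (mem_sphere_zero_iff_norm.1 (ω (i, l)).1.2)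
    (mem_sphere_zero_iff_norm.1 (ω (i, l + 1)).1.2)
  refine lt_of_le_of_ne (by nlinarith [h1.1, h1.2]) fun h => ?_
  have h2 : inner ℝ ((ω (i, l)).1 : Space) ((ω (i, l + 1)).1 : Space) ∈ ({1, -1} : Set ℝ)  := by
    simpa using sq_eq_one_iff.1 h
  simp [indicator_of_mem h2] at hω

/-- A long run of consecutive waypoints at acute angles is unlikely: each further waypoint can be
rotated independently, and lies in the hemisphere about the previous one with probability `1 / 2`. -/
theorem measure_acute_run_le (i : Fin M) (m K : ℕ) :
    movement M smin smax {ω | ∀ l ∈ Finset.Ico m (m + K),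
      0 < inner ℝ ((ω (i, l)).1 : Space) ((ω (i, l + 1)).1 : Space)} ≤ (1 / 2) ^ K := by
  have hm : ∀ l, Measurable fun ω : Fin M × ℕ → UnitSphere × ℝ => ((ω (i, l)).1 : Space) := fun l =>
    measurable_subtype_coe.comp (measurable_pi_apply _).fst
  have hpos : ∀ l, MeasurableSet {ω : Fin M × ℕ → UnitSphere × ℝ |
      0 < inner ℝ ((ω (i, l)).1 : Space) ((ω (i, l + 1)).1 : Space)} := fun l =>
    measurableSet_lt measurable_const ((hm l).inner (hm (l + 1)))
  have hmeas : ∀ K, MeasurableSet {ω : Fin M × ℕ → UnitSphere × ℝ | ∀ l ∈ Finset.Ico m (m + K),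
      0 < inner ℝ ((ω (i, l)).1 : Space) ((ω (i, l + 1)).1 : Space)} := by
    intro K
    have : {ω : Fin M × ℕ → UnitSphere × ℝ | ∀ l ∈ Finset.Ico m (m + K),
        0 < inner ℝ ((ω (i, l)).1 : Space) ((ω (i, l + 1)).1 : Space)} =
        ⋂ l ∈ Finset.Ico m (m + K), {ω | 0 < inner ℝ ((ω (i, l)).1 : Space)
          ((ω (i, l + 1)).1 : Space)} := by
      ext ω; simp
    rw [this]
    exact Finset.measurableSet_biInter _ fun l _ => hpos l
  induction K with
  | zero => simp
  | succ K ih =>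
    set A : Set (Fin M × ℕ → UnitSphere × ℝ) := {ω | ∀ l ∈ Finset.Ico m (m + K),
      0 < inner ℝ ((ω (i, l)).1 : Space) ((ω (i, l + 1)).1 : Space)} with hA
    rw [← lintegral_indicator_one (hmeas (K + 1)),
      lintegral_turn Rot.haar (measurable_turnOn {(i, m + K + 1)})
        (measurable_one.indicator (hmeas (K + 1)))]
    have hle : ∀ ω, ∫⁻ R, indicator {ω : Fin M × ℕ → UnitSphere × ℝ |
        ∀ l ∈ Finset.Ico m (m + (K + 1)),
          0 < inner ℝ ((ω (i, l)).1 : Space) ((ω (i, l + 1)).1 : Space)} 1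
        (turn (turnOn {(i, m + K + 1)} R) ω) ∂(Rot.haar) ≤ A.indicator 1 ω * (1 / 2) := by
      intro ω
      have hold : ∀ R l, l ≤ m + K → turn (turnOn {(i, m + K + 1)} R) ω (i, l) = ω (i, l) := by
        intro R l hl
        refine turn_turnOn_of_notMem ?_ _ _
        simp only [mem_singleton_iff, Prod.mk.injEq, true_and]
        omega
      calc _ ≤ ∫⁻ R, A.indicator 1 ω * (Ioc (0 : ℝ) 1).indicator 1
            (inner ℝ ((ω (i, m + K)).1 : Space) (R.1 (ω (i, m + K + 1)).1)) ∂(Rot.haar) := by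
            refine lintegral_mono fun R => ?_
            by_cases hT : turn (turnOn {(i, m + K + 1)} R) ω ∈ {ω : Fin M × ℕ → UnitSphere × ℝ |
              ∀ l ∈ Finset.Ico m (m + (K + 1)),
              0 < inner ℝ ((ω (i, l)).1 : Space) ((ω (i, l + 1)).1 : Space)}
            swap
            · rw [indicator_of_notMem hT]; exact bot_le
            have hωA : ω ∈ A := by
              intro l hl
              rw [Finset.mem_Ico] at hl
              have := hT l (Finset.mem_Ico.2 (by omega))
              rwa [hold R l (by omega), hold R (l + 1) (by omega)] at this
            have hlast := hT (m + K) (Finset.mem_Ico.2 (by omega))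
            rw [hold R (m + K) le_rfl, turn_turnOn_of_mem (mem_singleton _)] at hlast
            have h1 : inner ℝ ((ω (i, m + K)).1 : Space) (R.1 (ω (i, m + K + 1)).1) ≤ 1 :=
              (inner_mem_Icc (mem_sphere_zero_iff_norm.1 (ω (i, m + K)).1.2)
              (by rw [Rot.norm_map]; exact mem_sphere_zero_iff_norm.1 (ω (i, m + K + 1)).1.2)).2
            rw [indicator_of_mem hT, indicator_of_mem hωA, indicator_of_mem (by exact ⟨hlast, h1⟩)]
            simp
        _ = A.indicator 1 ω * uniformHeight (Ioc 0 1) := by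
            rw [lintegral_const_mul]
            swap
            · exact (measurable_one.indicator measurableSet_Ioc).comp (by fun_prop)
            congr 1
            rw [← map_inner_haar (mem_sphere_zero_iff_norm.1 (ω (i, m + K)).1.2)
              (mem_sphere_zero_iff_norm.1 (ω (i, m + K + 1)).1.2),
              ← lintegral_indicator_one measurableSet_Ioc,
              lintegral_map (measurable_one.indicator measurableSet_Ioc) (by fun_prop)]
        _ ≤ A.indicator 1 ω * (1 / 2) := by
            gcongr
            rw [uniformHeight, Measure.smul_apply, smul_eq_mul]
            refine (mul_le_mul_right (Measure.restrict_apply_le _ _) _).trans ?_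
            rw [Real.volume_Ioc]
            simp
    refine (lintegral_mono hle).trans ?_
    rw [lintegral_mul_const _ (measurable_one.indicator (hmeas K)),
      lintegral_indicator_one (hmeas K), pow_succ]
    gcongr

theorem ae_frequently_obtuse : ∀ᵐ ω ∂movement M smin smax, ∀ (i : Fin M) (m : ℕ), ∃ l, m ≤ l ∧
    inner ℝ ((ω (i, l)).1 : Space) ((ω (i, l + 1)).1 : Space) ≤ 0 := by
  simp_rw [ae_all_iff]
  intro i m
  rw [ae_iff]
  refine le_antisymm (ge_of_tendsto' (ENNReal.tendsto_pow_atTop_nhds_zero_of_lt_one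
    (by norm_num : (1 / 2 : ENNReal) < 1)) fun K => ?_) bot_le
  refine (measure_mono fun ω hω => ?_).trans (measure_acute_run_le (smin := smin) (smax := smax) i m K)
  intro l hl
  by_contra hcon
  exact hω ⟨l, (Finset.mem_Ico.1 hl).1, not_lt.1 hcon⟩

/-- Infinitely many legs are at least a quarter circle long, so the waypoint times are unbounded. -/
theorem ae_regular {ρ : ℝ} (hρ : 0 < ρ) (hs0 : 0 < smin) (hs : smin ≤ smax) :
    ∀ᵐ ω ∂movement M smin smax, ∀ i, Regular ρ smin smax (itinerary ω i) := by
  filter_upwards [ae_speed_mem hs, ae_inner_sq_lt_one, ae_frequently_obtuse] with ω h1 h2 h3 i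
  refine ⟨fun l => h1 (i, l), fun l => h2 i l, ?_⟩
  have hnn : ∀ l, 0 ≤ legTime ρ (itinerary ω i) l := fun l =>
    div_nonneg (mul_nonneg hρ.le (InnerProductGeometry.angle_nonneg _ _))
      (hs0.le.trans (h1 (i, l)).1)
  refine (not_summable_iff_tendsto_nat_atTop_of_nonneg hnn).1 fun hsum => ?_
  have hlim := hsum.tendsto_atTop_zero
  have hsm : 0 < smax := hs0.trans_le hs
  have hc : 0 < ρ * (Real.pi / 2) / smax := by have := Real.pi_pos; positivity
  obtain ⟨m, hm⟩ := (hlim.eventually_lt_const hc).exists_forall_of_atTop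
  obtain ⟨l, hl, hobt⟩ := h3 i m
  refine absurd (hm l hl) (not_lt.2 ?_)
  have hang : Real.pi / 2 ≤ InnerProductGeometry.angle (itinerary ω i l).1.1
      (itinerary ω i (l + 1)).1.1 := by
    have h4 : Real.arcsin (inner ℝ ((itinerary ω i l).1 : Space)
        ((itinerary ω i (l + 1)).1 : Space) / (‖((itinerary ω i l).1 : Space)‖ *
          ‖((itinerary ω i (l + 1)).1 : Space)‖)) ≤ 0 :=
      Real.arcsin_nonpos.2 (div_nonpos_of_nonpos_of_nonneg hobt (by positivity))
    rw [InnerProductGeometry.angle, Real.arccos]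
    linarith
  have hv := h1 (i, l)
  have hv0 : 0 < (itinerary ω i l).2 := hs0.trans_le hv.1
  unfold legTime geoDist
  exact div_le_div₀ (mul_nonneg hρ.le (InnerProductGeometry.angle_nonneg _ _)) (by gcongr) hv0 hv.2

end

/-! ### The probability of a crossing in a short interval -/

section
variable {M : ℕ} (ρ : ℝ) (ω : Fin M × ℕ → UnitSphere × ℝ) (i k : Fin M)

/-- The cosine of the angle between the devices `i` and `k` at time `t`. -/
noncomputable def height (t : ℝ) : ℝ :=
  inner ℝ (position ρ (itinerary ω i) t) (position ρ (itinerary ω k) t)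

/-- The height at time `t`, and the inner products whose combination, weighted with the angular
speeds of `i` and `k`, is its derivative for time running in the direction `ε = ±1`. -/
noncomputable def jet (ε t : ℝ) : ℝ × ℝ × ℝ :=
  (height ρ ω i k t,
    inner ℝ (ε • heading ρ (itinerary ω i) t) (position ρ (itinerary ω k) t),
    inner ℝ (position ρ (itinerary ω i) t) (ε • heading ρ (itinerary ω k) t))

/-- Neither device changes its leg between the times `t` and `t'`. -/
def SameLegs (t t' : ℝ) : Prop :=
  currentLeg ρ (itinerary ω i) t = currentLeg ρ (itinerary ω i) t' ∧
    currentLeg ρ (itinerary ω k) t = currentLeg ρ (itinerary ω k) t'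

open Classical in
/-- Indicator of a change of leg of one of the devices between the times `t` and `t'`. -/
noncomputable def legChange (t t' : ℝ) : ENNReal := if SameLegs ρ ω i k t t' then 0 else 1

open Classical in
/-- Upper bound for the indicator of the event that the height reaches level `c` from below between
the times `t` and `t + ε * h`, where `L` bounds the angular speeds. If a leg changes, only the
Lipschitz bound `2 * L` for the height is used. -/
noncomputable def upperTerm (c L ε h t : ℝ) : ENNReal :=
  if SameLegs ρ ω i k t (t + ε * h) then
    (upcrossUpper c h (16 * (L * h) ^ 2) (angularSpeed ρ (itinerary ω i) t)
      (angularSpeed ρ (itinerary ω k) t)).indicator 1 (jet ρ ω i k ε t)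
  else (Ico (c - 2 * L * h) c).indicator 1 (height ρ ω i k t)

open Classical in
/-- Lower bound for the indicator of the event that the height is below level `c` at time `t` and
above it at time `t + ε * h`; zero if a leg changes in between. -/
noncomputable def lowerTerm (c L ε h t : ℝ) : ENNReal :=
  if SameLegs ρ ω i k t (t + ε * h) then
    (upcrossLower c h (16 * (L * h) ^ 2) (angularSpeed ρ (itinerary ω i) t)
      (angularSpeed ρ (itinerary ω k) t)).indicator 1 (jet ρ ω i k ε t)
  else 0

end

theorem measurable_indicator_one_comp {α β : Type*} [MeasurableSpace α] [MeasurableSpace β]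
    {s : Set β} (hs : MeasurableSet s) {f : α → β} (hf : Measurable f) :
    Measurable fun x => s.indicator (1 : β → ENNReal) (f x) :=
  (measurable_one.indicator hs).comp hf

section Measurability
variable {M : ℕ} (ρ : ℝ) (i k : Fin M)

theorem measurable_height {α : Type*} [MeasurableSpace α] {ω : α → Fin M × ℕ → UnitSphere × ℝ}
    {τ : α → ℝ} (hω : Measurable ω) (hτ : Measurable τ) :
    Measurable fun x => height ρ (ω x) i k (τ x) :=
  (measurable_position ρ ((measurable_itinerary i).comp hω) hτ).inner
    (measurable_position ρ ((measurable_itinerary k).comp hω) hτ)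

theorem measurable_jet (ε t : ℝ) :
    Measurable fun ω : Fin M × ℕ → UnitSphere × ℝ => jet ρ ω i k ε t := by
  have hp : ∀ i : Fin M, Measurable fun ω : Fin M × ℕ → UnitSphere × ℝ =>
      position ρ (itinerary ω i) t := fun i =>
    measurable_position ρ (measurable_itinerary i) measurable_const
  have hh : ∀ i : Fin M, Measurable fun ω : Fin M × ℕ → UnitSphere × ℝ =>
      heading ρ (itinerary ω i) t := fun i =>
    measurable_heading ρ (measurable_itinerary i) measurable_const
  exact (measurable_height ρ i k measurable_id measurable_const).prodMk
    ((((hh i).const_smul ε).inner (hp k)).prodMk ((hp i).inner ((hh k).const_smul ε)))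

theorem measurableSet_sameLegs (t t' : ℝ) :
    MeasurableSet {ω : Fin M × ℕ → UnitSphere × ℝ | SameLegs ρ ω i k t t'} := by
  have hl : ∀ (i : Fin M) (t : ℝ), Measurable fun ω : Fin M × ℕ → UnitSphere × ℝ =>
      currentLeg ρ (itinerary ω i) t := fun i t =>
    measurable_currentLeg ρ (measurable_itinerary i) measurable_const
  exact (measurableSet_eq_fun (hl i t) (hl i t')).inter (measurableSet_eq_fun (hl k t) (hl k t'))

theorem measurable_legChange (t t' : ℝ) :
    Measurable fun ω : Fin M × ℕ → UnitSphere × ℝ => legChange ρ ω i k t t' :=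
  Measurable.ite (measurableSet_sameLegs ρ i k t t') measurable_const measurable_const

theorem measurable_indicator_jet (ε t : ℝ) {E : ℝ → ℝ → Set (ℝ × ℝ × ℝ)}
    (hE : MeasurableSet {x : ℝ × ℝ × ℝ × ℝ × ℝ | x.2.2 ∈ E x.1 x.2.1}) :
    Measurable fun ω : Fin M × ℕ → UnitSphere × ℝ =>
      (E (angularSpeed ρ (itinerary ω i) t) (angularSpeed ρ (itinerary ω k) t)).indicator
        (1 : ℝ × ℝ × ℝ → ENNReal) (jet ρ ω i k ε t) := by
  have hs : ∀ i : Fin M, Measurable fun ω : Fin M × ℕ → UnitSphere × ℝ =>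
      angularSpeed ρ (itinerary ω i) t := fun i =>
    measurable_angularSpeed ρ (measurable_itinerary i) measurable_const
  have hm : Measurable fun ω : Fin M × ℕ → UnitSphere × ℝ =>
      (angularSpeed ρ (itinerary ω i) t, angularSpeed ρ (itinerary ω k) t, jet ρ ω i k ε t) :=
    (hs i).prodMk ((hs k).prodMk (measurable_jet ρ i k ε t))
  exact measurable_indicator_one_comp hE hm

theorem measurable_upperTerm (c L ε h t : ℝ) :
    Measurable fun ω : Fin M × ℕ → UnitSphere × ℝ => upperTerm ρ ω i k c L ε h t := by
  refine Measurable.ite (measurableSet_sameLegs ρ i k _ _) (measurable_indicator_jet ρ i k ε t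
    (E := fun v w => upcrossUpper c h (16 * (L * h) ^ 2) v w) ?_) ?_
  · refine (measurableSet_lt (f := fun x : ℝ × ℝ × ℝ × ℝ × ℝ => x.2.2.1) (by fun_prop)
      measurable_const).inter (measurableSet_le (f := fun _ => c) measurable_const
      (g := fun x : ℝ × ℝ × ℝ × ℝ × ℝ =>
        x.2.2.1 + h * max (x.1 * x.2.2.2.1 + x.2.1 * x.2.2.2.2) 0 + 16 * (L * h) ^ 2) (by fun_prop))
  · exact measurable_indicator_one_comp measurableSet_Ico
      (measurable_height ρ i k measurable_id measurable_const)

theorem measurable_lowerTerm (c L ε h t : ℝ) :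
    Measurable fun ω : Fin M × ℕ → UnitSphere × ℝ => lowerTerm ρ ω i k c L ε h t := by
  refine Measurable.ite (measurableSet_sameLegs ρ i k _ _) (measurable_indicator_jet ρ i k ε t
    (E := fun v w => upcrossLower c h (16 * (L * h) ^ 2) v w) ?_) measurable_const
  refine (measurableSet_lt (f := fun x : ℝ × ℝ × ℝ × ℝ × ℝ => x.2.2.1) (by fun_prop)
      measurable_const).inter (measurableSet_le (f := fun _ => c) measurable_const
      (g := fun x : ℝ × ℝ × ℝ × ℝ × ℝ =>
        x.2.2.1 + h * (x.1 * x.2.2.2.1 + x.2.1 * x.2.2.2.2) - 16 * (L * h) ^ 2) (by fun_prop))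

end Measurability

section Turn
variable {M : ℕ} (ρ : ℝ) (ω : Fin M × ℕ → UnitSphere × ℝ) {i k : Fin M} (R : Rot)

theorem itinerary_turn_self (k : Fin M) :
    itinerary (turn (turnOn {j | j.1 = k} R) ω) k = turnItinerary R (itinerary ω k) := by
  funext l
  exact turn_turnOn_of_mem (J := {j | j.1 = k}) (j := (k, l)) rfl R ω

theorem itinerary_turn_of_ne (hik : i ≠ k) :
    itinerary (turn (turnOn {j | j.1 = k} R) ω) i = itinerary ω i := by
  funext l
  exact turn_turnOn_of_notMem (J := {j | j.1 = k}) (j := (i, l)) hik R ω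

theorem sameLegs_turn (hik : i ≠ k) (t t' : ℝ) :
    SameLegs ρ (turn (turnOn {j | j.1 = k} R) ω) i k t t' ↔ SameLegs ρ ω i k t t' := by
  simp only [SameLegs, itinerary_turn_self, itinerary_turn_of_ne ω R hik, currentLeg_turn]

theorem height_turn (hik : i ≠ k) (t : ℝ) :
    height ρ (turn (turnOn {j | j.1 = k} R) ω) i k t =
      inner ℝ (position ρ (itinerary ω i) t) (R.1 (position ρ (itinerary ω k) t)) := by
  simp only [height, itinerary_turn_self, itinerary_turn_of_ne ω R hik, position_turn]

theorem jet_turn (hik : i ≠ k) (ε t : ℝ) :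
    jet ρ (turn (turnOn {j | j.1 = k} R) ω) i k ε t =
      (inner ℝ (position ρ (itinerary ω i) t) (R.1 (position ρ (itinerary ω k) t)),
      inner ℝ (ε • heading ρ (itinerary ω i) t) (R.1 (position ρ (itinerary ω k) t)),
      inner ℝ (position ρ (itinerary ω i) t) (R.1 (ε • heading ρ (itinerary ω k) t))) := by
  simp only [jet, height_turn ρ ω R hik]
  simp only [itinerary_turn_self, itinerary_turn_of_ne ω R hik, position_turn, heading_turn,
    map_smul]

theorem angularSpeed_turnOn (t : ℝ) :
    angularSpeed ρ (itinerary (turn (turnOn {j | j.1 = k} R) ω) k) t =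
      angularSpeed ρ (itinerary ω k) t := by
  rw [itinerary_turn_self, angularSpeed_turn]

end Turn

section Expectation
variable {M : ℕ} {ρ smin smax : ℝ} {i k : Fin M} {c ε h t : ℝ}

/-- The first two terms come from times without a change of leg. A change of leg costs only the
probability, of order `h`, that the height is close to the level: the rotation of device `k` leaves
the times of the changes of leg unchanged, and so is independent of them. -/
theorem lintegral_upperTerm_le (hρ : 0 < ρ) (hs0 : 0 < smin) (hs : smin ≤ smax) (hik : i ≠ k)
    (hc : c ∈ Icc (-1 : ℝ) 1) (hε : |ε| = 1) (hh : 0 ≤ h) :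
    ∫⁻ ω, upperTerm ρ ω i k c (smax / ρ) ε h t ∂movement M smin smax ≤
      ENNReal.ofReal (h * (√(1 - c ^ 2) + √(2 * (2 * (smax / ρ) * h + 16 * (smax / ρ * h) ^ 2))) / 2) *
        meanApproach (smax / ρ) (smax / ρ) + ENNReal.ofReal (16 * (smax / ρ * h) ^ 2 / 2) +
      ENNReal.ofReal (smax / ρ * h) *
        ∫⁻ ω, legChange ρ ω i k t (t + ε * h) ∂movement M smin smax := by
  set L := smax / ρ with hL
  have hL0 : 0 < L := div_pos (hs0.trans_le hs) hρ
  rw [lintegral_turn Rot.haar (measurable_turnOn {j | j.1 = k}) (measurable_upperTerm ρ i k c L ε h t)]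
  set K := ENNReal.ofReal (h * (√(1 - c ^ 2) + √(2 * (2 * L * h + 16 * (L * h) ^ 2))) / 2) *
        meanApproach L L + ENNReal.ofReal (16 * (L * h) ^ 2 / 2) with hK
  have hbound : ∀ᵐ ω ∂movement M smin smax,
      ∫⁻ R, upperTerm ρ (turn (turnOn {j | j.1 = k} R) ω) i k c L ε h t ∂(Rot.haar) ≤
        K + ENNReal.ofReal (L * h) * legChange ρ ω i k t (t + ε * h) := by
    filter_upwards [ae_regular hρ hs0 hs] with ω hω
    have hp := fun i => (hω i).norm_position t
    have hv := fun i => (hω i).angularSpeed_mem hρ t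
    have hv0 : ∀ i, 0 ≤ angularSpeed ρ (itinerary ω i) t := fun i =>
      (div_pos hs0 hρ).le.trans (hv i).1
    have hh1 : ∀ i, ‖ε • heading ρ (itinerary ω i) t‖ = 1 := fun i => by
      rw [norm_smul, (hω i).norm_heading, Real.norm_eq_abs, hε, one_mul]
    have ho : ∀ i, inner ℝ (position ρ (itinerary ω i) t) (ε • heading ρ (itinerary ω i) t) = 0 :=
      fun i => by rw [real_inner_smul_right, (hω i).inner_position_heading, mul_zero]
    by_cases hleg : SameLegs ρ ω i k t (t + ε * h)
    · have e : ∀ R, upperTerm ρ (turn (turnOn {j | j.1 = k} R) ω) i k c L ε h t = _ := fun R => by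
        rw [upperTerm, if_pos ((sameLegs_turn ρ ω R hik _ _).2 hleg), jet_turn ρ ω R hik,
          angularSpeed_turnOn, itinerary_turn_of_ne ω R hik]
      simp_rw [e]
      rw [legChange, if_pos hleg, mul_zero, add_zero]
      refine (lintegral_haar_upcrossUpper_le (k := 16 * (L * h) ^ 2) (hp i) (hh1 i) (ho i) (hp k)
        (hh1 k) (ho k) hc hh (by positivity) (hv0 i) (hv0 k) (hv i).2 (hv k).2).trans ?_
      rw [hK]
      gcongr
      exact meanApproach_mono (hv0 i) (hv0 k) (hv i).2 (hv k).2
    · have e : ∀ R, upperTerm ρ (turn (turnOn {j | j.1 = k} R) ω) i k c L ε h t = _ := fun R => by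
        rw [upperTerm, if_neg (mt (sameLegs_turn ρ ω R hik _ _).1 hleg), height_turn ρ ω R hik]
      simp_rw [e]
      rw [legChange, if_neg hleg, mul_one]
      refine (lintegral_haar_Ico_le (hp i) (hp k) _ _).trans ?_
      refine le_trans (le_of_eq ?_) le_add_self
      congr 1; ring
  refine (lintegral_mono_ae hbound).trans (le_of_eq ?_)
  rw [lintegral_add_left measurable_const, lintegral_const_mul _ (measurable_legChange ρ i k _ _)]
  simp

theorem le_lintegral_lowerTerm (hρ : 0 < ρ) (hs0 : 0 < smin) (hs : smin ≤ smax) (hik : i ≠ k)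
    (hc : c ∈ Icc (-1 : ℝ) 1) (hε : |ε| = 1) (hh : 0 ≤ h) (hLh : 2 * (smax / ρ) * h ≤ 1 + c) :
    ENNReal.ofReal (h * (√(1 - c ^ 2) - √(2 * (2 * (smax / ρ) * h))) / 2) *
        meanApproach (smin / ρ) (smin / ρ) ≤
      ∫⁻ ω, lowerTerm ρ ω i k c (smax / ρ) ε h t ∂movement M smin smax +
      ENNReal.ofReal (16 * (smax / ρ * h) ^ 2 / 2) +
      ENNReal.ofReal (h * (√(1 - c ^ 2) - √(2 * (2 * (smax / ρ) * h))) / 2) *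
        meanApproach (smin / ρ) (smin / ρ) *
        ∫⁻ ω, legChange ρ ω i k t (t + ε * h) ∂movement M smin smax := by
  set L := smax / ρ with hL
  have hl0 : 0 < smin / ρ := div_pos hs0 hρ
  have hm := measurable_lowerTerm ρ i k c L ε h t
  rw [lintegral_turn Rot.haar (measurable_turnOn {j | j.1 = k}) hm]
  set K := ENNReal.ofReal (h * (√(1 - c ^ 2) - √(2 * (2 * L * h))) / 2) *
        meanApproach (smin / ρ) (smin / ρ) with hK
  have hbound : ∀ᵐ ω ∂movement M smin smax, K ≤
      ∫⁻ R, lowerTerm ρ (turn (turnOn {j | j.1 = k} R) ω) i k c L ε h t ∂(Rot.haar) +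
        ENNReal.ofReal (16 * (L * h) ^ 2 / 2) + K * legChange ρ ω i k t (t + ε * h) := by
    filter_upwards [ae_regular hρ hs0 hs] with ω hω
    have hp := fun i => (hω i).norm_position t
    have hv := fun i => (hω i).angularSpeed_mem hρ t
    have hv0 : ∀ i, 0 ≤ angularSpeed ρ (itinerary ω i) t := fun i => hl0.le.trans (hv i).1
    have hh1 : ∀ i, ‖ε • heading ρ (itinerary ω i) t‖ = 1 := fun i => by
      rw [norm_smul, (hω i).norm_heading, Real.norm_eq_abs, hε, one_mul]
    have ho : ∀ i, inner ℝ (position ρ (itinerary ω i) t) (ε • heading ρ (itinerary ω i) t) = 0 :=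
      fun i => by rw [real_inner_smul_right, (hω i).inner_position_heading, mul_zero]
    by_cases hleg : SameLegs ρ ω i k t (t + ε * h)
    · have e : ∀ R, lowerTerm ρ (turn (turnOn {j | j.1 = k} R) ω) i k c L ε h t = _ := fun R => by
        rw [lowerTerm, if_pos ((sameLegs_turn ρ ω R hik _ _).2 hleg), jet_turn ρ ω R hik,
          angularSpeed_turnOn, itinerary_turn_of_ne ω R hik]
      simp_rw [e]
      rw [legChange, if_pos hleg, mul_zero, add_zero]
      refine le_trans ?_ (le_lintegral_haar_upcrossLower (k := 16 * (L * h) ^ 2) (hp i) (hh1 i)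
        (ho i) (hp k) (hh1 k) (ho k) hc hh (by positivity) (hv0 i) (hv0 k) (hv i).2 (hv k).2 hLh)
      rw [hK]
      gcongr
      exact meanApproach_mono hl0.le hl0.le (hv i).1 (hv k).1
    · rw [legChange, if_neg hleg, mul_one]
      exact le_add_self
  have := lintegral_mono_ae hbound
  rw [lintegral_const, measure_univ, mul_one, lintegral_add_right _
    ((measurable_legChange ρ i k _ _).const_mul _), lintegral_add_right _ measurable_const,
    lintegral_const_mul _ (measurable_legChange ρ i k _ _)] at this
  simpa using this

/-- At a fixed time the height has a continuous distribution. -/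
theorem ae_height_ne (hρ : 0 < ρ) (hs0 : 0 < smin) (hs : smin ≤ smax) (hik : i ≠ k) (c t : ℝ) :
    ∀ᵐ ω ∂movement M smin smax, height ρ ω i k t ≠ c := by
  have hm : Measurable fun ω : Fin M × ℕ → UnitSphere × ℝ =>
      ({c} : Set ℝ).indicator (1 : ℝ → ENNReal) (height ρ ω i k t) :=
    (measurable_one.indicator (measurableSet_singleton c)).comp
      (measurable_height ρ i k measurable_id measurable_const)
  have h0 : ∫⁻ ω, ({c} : Set ℝ).indicator 1 (height ρ ω i k t) ∂movement M smin smax = 0 := by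
    rw [lintegral_turn Rot.haar (measurable_turnOn {j | j.1 = k}) hm]
    have hz : ∀ᵐ ω ∂movement M smin smax, ∫⁻ R, ({c} : Set ℝ).indicator 1
        (height ρ (turn (turnOn {j | j.1 = k} R) ω) i k t) ∂(Rot.haar) = 0 := by
      filter_upwards [ae_regular hρ hs0 hs] with ω hω
      simp only [height_turn ρ ω _ hik]
      refine le_antisymm (ge_of_tendsto (f := fun δ : ℝ => ENNReal.ofReal ((c + δ - c) / 2))
        (x := 𝓝[>] (0:ℝ)) ?_ (eventually_mem_nhdsWithin.mono fun δ hδ => ?_)) bot_le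
      · have : Tendsto (fun δ : ℝ => ENNReal.ofReal ((c + δ - c) / 2)) (𝓝 0)
            (𝓝 (ENNReal.ofReal ((c + 0 - c) / 2))) :=
          ENNReal.tendsto_ofReal (Continuous.tendsto (by fun_prop) 0)
        simp only [add_zero, sub_self, zero_div, ENNReal.ofReal_zero] at this
        exact this.mono_left nhdsWithin_le_nhds
      · refine (lintegral_mono fun R => indicator_one_le (t := Ico c (c + δ)) (y := inner ℝ
          (position ρ (itinerary ω i) t) (R.1 (position ρ (itinerary ω k) t))) fun h => ?_).trans
          (lintegral_haar_Ico_le ((hω i).norm_position t) ((hω k).norm_position t) c (c + δ))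
        rw [mem_singleton_iff] at h
        rw [h]
        exact ⟨le_rfl, lt_add_of_pos_right c hδ⟩
    rw [lintegral_congr_ae hz, lintegral_zero]
  rw [lintegral_eq_zero_iff hm] at h0
  filter_upwards [h0] with ω hω h
  simp [h] at hω

end Expectation

/-! ### Crossings along regular trajectories -/

theorem sum_currentLeg_ne_le' {n : ℕ → ℕ} (hn : Antitone n) (N : ℕ) :
    ∑ k ∈ Finset.range N, (if n k = n (k + 1) then 0 else 1 : ℕ) + n N ≤ n 0 := by
  induction N with
  | zero => simp
  | succ N ih =>
    rw [Finset.sum_range_succ]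
    have := hn N.le_succ
    split_ifs with h
    · omega
    · have : n (N + 1) < n N := lt_of_le_of_ne this (Ne.symm h)
      omega

section Pathwise
variable {M : ℕ} {ρ smin smax : ℝ} {ω : Fin M × ℕ → UnitSphere × ℝ} {i k : Fin M}
  {c ε h t : ℝ}

theorem Regular.norm_position_sub_le_abs {d : Itinerary} (hd : Regular ρ smin smax d) (hρ : 0 < ρ)
    (hs : 0 < smin) (s t : ℝ) : ‖position ρ d t - position ρ d s‖ ≤ smax / ρ * |t - s| := by
  rcases le_total s t with h | h
  · rw [abs_of_nonneg (sub_nonneg.2 h)]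
    exact hd.norm_position_sub_le hρ hs h
  · rw [norm_sub_rev, abs_sub_comm, abs_of_nonneg (sub_nonneg.2 h)]
    exact hd.norm_position_sub_le hρ hs h

theorem abs_height_sub_le (hω : ∀ i, Regular ρ smin smax (itinerary ω i)) (hρ : 0 < ρ)
    (hs : 0 < smin) (s t : ℝ) :
    |height ρ ω i k t - height ρ ω i k s| ≤ 2 * (smax / ρ) * |t - s| := by
  have e : height ρ ω i k t - height ρ ω i k s =
      inner ℝ (position ρ (itinerary ω i) t - position ρ (itinerary ω i) s)
        (position ρ (itinerary ω k) t) +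
      inner ℝ (position ρ (itinerary ω i) s)
        (position ρ (itinerary ω k) t - position ρ (itinerary ω k) s) := by
    rw [inner_sub_left, inner_sub_right]; unfold height; ring
  have h1 := (hω i).norm_position_sub_le_abs hρ hs s t
  have h2 := (hω k).norm_position_sub_le_abs hρ hs s t
  have h3 := abs_real_inner_le_norm (position ρ (itinerary ω i) t - position ρ (itinerary ω i) s)
        (position ρ (itinerary ω k) t)
  have h4 := abs_real_inner_le_norm (position ρ (itinerary ω i) s)
        (position ρ (itinerary ω k) t - position ρ (itinerary ω k) s)
  rw [(hω k).norm_position, mul_one] at h3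
  rw [(hω i).norm_position, one_mul] at h4
  rw [e]
  refine (abs_add_le _ _).trans ?_
  linarith

theorem continuous_height (hω : ∀ i, Regular ρ smin smax (itinerary ω i)) (hρ : 0 < ρ)
    (hs : 0 < smin) : Continuous (height ρ ω i k) :=
  ((hω i).continuous_position hρ hs).inner ((hω k).continuous_position hρ hs)

/-- The height, to first order, at a time before which no leg has changed. -/
theorem abs_height_sub_jet_le (hω : ∀ i, Regular ρ smin smax (itinerary ω i)) (hρ : 0 < ρ)
    (hs : 0 < smin) (hε : |ε| = 1) {θ : ℝ} (hθ : θ ∈ Icc 0 h) (hLh : smax / ρ * h ≤ 1)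
    (hleg : SameLegs ρ ω i k t (t + ε * θ)) :
    |height ρ ω i k (t + ε * θ) - height ρ ω i k t -
      θ * (angularSpeed ρ (itinerary ω i) t * (jet ρ ω i k ε t).2.1 +
        angularSpeed ρ (itinerary ω k) t * (jet ρ ω i k ε t).2.2)| ≤ 16 * (smax / ρ * h) ^ 2 := by
  have hb : ∀ i, |angularSpeed ρ (itinerary ω i) t * (t + ε * θ - t)| ≤ smax / ρ * h := fun i => by
    have h1 := (hω i).angularSpeed_mem hρ t
    have h0 : 0 ≤ angularSpeed ρ (itinerary ω i) t := (div_pos hs hρ).le.trans h1.1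
    rw [add_sub_cancel_left, abs_mul, abs_mul, hε, one_mul, abs_of_nonneg h0, abs_of_nonneg hθ.1]
    exact mul_le_mul h1.2 hθ.2 hθ.1 (h0.trans h1.2)
  have := abs_inner_rotation_sub_le ((hω i).norm_position t) ((hω i).norm_heading t)
    ((hω k).norm_position t) ((hω k).norm_heading t) (hb i) (hb k) hLh
  rw [← Regular.position_eq_of_currentLeg_eq hleg.1.symm,
    ← Regular.position_eq_of_currentLeg_eq hleg.2.symm] at this
  refine le_of_eq_of_le ?_ this
  simp only [height, jet, real_inner_smul_left, real_inner_smul_right]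
  congr 1
  ring

theorem SameLegs.of_le (hω : ∀ i, Regular ρ smin smax (itinerary ω i)) (hε : |ε| = 1)
    (hleg : SameLegs ρ ω i k t (t + ε * h)) {θ : ℝ} (hθ : θ ∈ Icc 0 h) :
    SameLegs ρ ω i k t (t + ε * θ) := by
  have key : ∀ i, currentLeg ρ (itinerary ω i) t = currentLeg ρ (itinerary ω i) (t + ε * h) →
      currentLeg ρ (itinerary ω i) t = currentLeg ρ (itinerary ω i) (t + ε * θ) := fun i e => by
    have hm := (hω i).currentLeg_mono
    rcases eq_or_eq_neg_of_abs_eq hε with rfl | rfl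
    · refine le_antisymm (hm (by linarith [hθ.1])) ?_
      rw [e]
      exact hm (by linarith [hθ.2])
    · refine le_antisymm ?_ (hm (by linarith [hθ.1]))
      rw [e]
      exact hm (by linarith [hθ.2])
  exact ⟨key i hleg.1, key k hleg.2⟩

theorem one_le_upperTerm (hω : ∀ i, Regular ρ smin smax (itinerary ω i)) (hρ : 0 < ρ)
    (hs : 0 < smin) (hε : |ε| = 1) (hLh : smax / ρ * h ≤ 1) {θ : ℝ} (hθ : θ ∈ Icc 0 h)
    (h1 : height ρ ω i k t < c) (h2 : c ≤ height ρ ω i k (t + ε * θ)) :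
    1 ≤ upperTerm ρ ω i k c (smax / ρ) ε h t := by
  unfold upperTerm
  split_ifs with hleg
  · have := (abs_le.1 (abs_height_sub_jet_le hω hρ hs hε hθ hLh (hleg.of_le hω hε hθ))).2
    rw [indicator_of_mem]
    · exact le_rfl
    · refine ⟨h1, ?_⟩
      set X := angularSpeed ρ (itinerary ω i) t * (jet ρ ω i k ε t).2.1 +
        angularSpeed ρ (itinerary ω k) t * (jet ρ ω i k ε t).2.2
      have h3 : θ * X ≤ h * max X 0 :=
        (mul_le_mul_of_nonneg_left (le_max_left X 0) hθ.1).trans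
          (mul_le_mul_of_nonneg_right hθ.2 (le_max_right X 0))
      have h4 : (jet ρ ω i k ε t).1 = height ρ ω i k t := rfl
      rw [h4]
      linarith
  · rw [indicator_of_mem]
    · exact le_rfl
    · refine ⟨?_, h1⟩
      have h3 := (abs_le.1 (abs_height_sub_le (i := i) (k := k) hω hρ hs t (t + ε * θ))).2
      rw [add_sub_cancel_left, abs_mul, hε, one_mul, abs_of_nonneg hθ.1] at h3
      have hL : 0 ≤ smax / ρ := (div_pos hs hρ).le.trans
        (((hω i).angularSpeed_mem hρ t).1.trans ((hω i).angularSpeed_mem hρ t).2)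
      have := mul_le_mul_of_nonneg_left hθ.2 (mul_nonneg zero_le_two hL)
      linarith

theorem crossing_of_lowerTerm_ne_zero (hω : ∀ i, Regular ρ smin smax (itinerary ω i)) (hρ : 0 < ρ)
    (hs : 0 < smin) (hε : |ε| = 1) (hh : 0 ≤ h) (hLh : smax / ρ * h ≤ 1)
    (h0 : lowerTerm ρ ω i k c (smax / ρ) ε h t ≠ 0) :
    height ρ ω i k t < c ∧ c ≤ height ρ ω i k (t + ε * h) := by
  unfold lowerTerm at h0
  split_ifs at h0 with hleg
  · have := (abs_le.1 (abs_height_sub_jet_le hω hρ hs hε (right_mem_Icc.2 hh) hLh hleg)).1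
    obtain ⟨h1, h2⟩ := mem_of_indicator_ne_zero h0
    have h4 : (jet ρ ω i k ε t).1 = height ρ ω i k t := rfl
    rw [h4] at h1 h2
    exact ⟨h1, by linarith⟩
  · exact absurd rfl h0

theorem lowerTerm_le_one (L : ℝ) : lowerTerm ρ ω i k c L ε h t ≤ 1 := by
  unfold lowerTerm
  split_ifs
  · exact indicator_le_self' (fun _ _ => zero_le_one) _ 
  · exact zero_le_one

theorem legChange_le (t t' : ℝ) : legChange ρ ω i k t t' ≤
    ((if currentLeg ρ (itinerary ω i) t = currentLeg ρ (itinerary ω i) t' then 0 else 1 : ℕ) : ENNReal)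
    + ((if currentLeg ρ (itinerary ω k) t = currentLeg ρ (itinerary ω k) t' then 0 else 1 : ℕ) :
      ENNReal) := by
  unfold legChange SameLegs
  split_ifs <;> simp_all

theorem legChange_le_one (t t' : ℝ) : legChange ρ ω i k t t' ≤ 1 := by
  unfold legChange
  split_ifs <;> simp

end Pathwise

/-! ### The expected number of crossings -/

section Time
variable {M : ℕ} {ρ smin smax : ℝ} {ω : Fin M × ℕ → UnitSphere × ℝ} {i k : Fin M}
  {c ε β a b : ℝ}

theorem affine_grid_succ (N j : ℕ) :
    β + ε * grid a b N (j + 1) = β + ε * grid a b N j + ε * mesh a b N := by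
  rw [grid_succ]; ring

/-- The number of partition intervals with a change of leg is bounded by the total number of
changes of leg, uniformly in the partition. -/
theorem sum_legChange_le (hω : ∀ i, Regular ρ smin smax (itinerary ω i)) (hε : |ε| = 1)
    (hab : a < b) (N : ℕ) :
    ∑ j ∈ Finset.range (N + 1), legChange ρ ω i k (β + ε * grid a b N j)
        (β + ε * grid a b N j + ε * mesh a b N) ≤
      ((currentLeg ρ (itinerary ω i) (max (β + ε * a) (β + ε * b)) +
        currentLeg ρ (itinerary ω k) (max (β + ε * a) (β + ε * b)) : ℕ) : ENNReal) := by
  have key : ∀ i, ∑ j ∈ Finset.range (N + 1),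
      (if currentLeg ρ (itinerary ω i) (β + ε * grid a b N j) =
        currentLeg ρ (itinerary ω i) (β + ε * grid a b N (j + 1)) then 0 else 1 : ℕ) ≤
      currentLeg ρ (itinerary ω i) (max (β + ε * a) (β + ε * b)) := by
    intro i
    have hm := (hω i).currentLeg_mono
    rcases eq_or_eq_neg_of_abs_eq hε with rfl | rfl
    · refine (sum_currentLeg_ne_le (n := fun j => currentLeg ρ (itinerary ω i)
        (β + 1 * grid a b N j)) (fun j l hjl => hm ?_) (N + 1)).trans (hm ?_)
      · have := grid_mono hab N hjl
        linarith
      · rw [grid_last]; exact le_max_right _ _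
    · refine (le_self_add.trans (sum_currentLeg_ne_le' (n := fun j => currentLeg ρ (itinerary ω i)
        (β + -1 * grid a b N j)) (fun j l hjl => hm ?_) (N + 1))).trans (hm ?_)
      · have := grid_mono hab N hjl
        linarith
      · rw [grid_zero]; exact le_max_left _ _
  refine (Finset.sum_le_sum fun j _ => legChange_le _ _).trans ?_
  rw [Finset.sum_add_distrib, ← Nat.cast_sum, ← Nat.cast_sum, ← Nat.cast_add]
  simp only [← affine_grid_succ]
  exact_mod_cast add_le_add (key i) (key k)

/-- The expected proportion of partition intervals with a change of leg tends to zero, by dominated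
convergence. This needs no moment bound on the number of changes of leg. -/
theorem tendsto_sum_legChange (hρ : 0 < ρ) (hs0 : 0 < smin) (hs : smin ≤ smax) (i k : Fin M)
    (hε : |ε| = 1) (hab : a < b) :
    Tendsto (fun N : ℕ => ENNReal.ofReal (mesh a b N) * ∑ j ∈ Finset.range (N + 1),
      ∫⁻ ω, legChange ρ ω i k (β + ε * grid a b N j)
        (β + ε * grid a b N j + ε * mesh a b N) ∂movement M smin smax) atTop (𝓝 0) := by
  have hm : ∀ N j, Measurable fun ω : Fin M × ℕ → UnitSphere × ℝ =>
      legChange ρ ω i k (β + ε * grid a b N j) (β + ε * grid a b N j + ε * mesh a b N) :=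
    fun N j => measurable_legChange ρ i k _ _
  have e : ∀ N : ℕ, ENNReal.ofReal (mesh a b N) * ∑ j ∈ Finset.range (N + 1),
      ∫⁻ ω, legChange ρ ω i k (β + ε * grid a b N j)
        (β + ε * grid a b N j + ε * mesh a b N) ∂movement M smin smax =
      ∫⁻ ω, ENNReal.ofReal (mesh a b N) * ∑ j ∈ Finset.range (N + 1),
        legChange ρ ω i k (β + ε * grid a b N j)
        (β + ε * grid a b N j + ε * mesh a b N) ∂movement M smin smax := fun N => by
    rw [lintegral_const_mul _ (Finset.measurable_sum _ fun j _ => hm N j),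
      lintegral_finsetSum _ fun j _ => hm N j]
  simp_rw [e]
  rw [← lintegral_zero (μ := movement M smin smax)]
  refine tendsto_lintegral_of_dominated_convergence (fun _ => ENNReal.ofReal (b - a))
    (fun N => (Finset.measurable_sum _ fun j _ => hm N j).const_mul _) (fun N => ?_) ?_ ?_
  · refine Eventually.of_forall fun ω => ?_
    calc _ ≤ ENNReal.ofReal (mesh a b N) * ∑ j ∈ Finset.range (N + 1), 1 := by
          exact mul_le_mul_right (Finset.sum_le_sum fun j _ => legChange_le_one _ _) _
      _ = _ := by
          rw [Finset.sum_const, Finset.card_range, nsmul_eq_mul, mul_one,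
            ← succ_mul_mesh (a := a) (b := b) N, ENNReal.ofReal_mul (by positivity), mul_comm]
          congr 1
          rw [← ENNReal.ofReal_natCast]; push_cast; rfl
  · simp
  · filter_upwards [ae_regular hρ hs0 hs] with ω hω
    refine tendsto_of_tendsto_of_tendsto_of_le_of_le tendsto_const_nhds ?_ (fun _ => bot_le)
      (fun N => mul_le_mul_right (sum_legChange_le hω hε hab N) _)
    have := ENNReal.Tendsto.mul_const (b := ((currentLeg ρ (itinerary ω i)
        (max (β + ε * a) (β + ε * b)) +
        currentLeg ρ (itinerary ω k) (max (β + ε * a) (β + ε * b)) : ℕ) : ENNReal))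
      (ENNReal.tendsto_ofReal (tendsto_mesh a b)) (Or.inr (ENNReal.natCast_ne_top _))
    simpa using this

end Time

section Rates
variable {M : ℕ} {ρ smin smax : ℝ} {ω : Fin M × ℕ → UnitSphere × ℝ} {i k : Fin M}
  {c ε β a b : ℝ}

theorem ofReal_mesh_mul (N : ℕ) {x : ℝ} :
    ((N + 1 : ℕ) : ENNReal) * ENNReal.ofReal (mesh a b N * x) = ENNReal.ofReal ((b - a) * x) := by
  rw [← ENNReal.ofReal_natCast, ← ENNReal.ofReal_mul (by positivity), ← mul_assoc,
    ← succ_mul_mesh (a := a) (b := b) N]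
  push_cast
  rfl

/-- The leading term of the expected number of crossings is attained in the limit. -/
theorem tendsto_ofReal_mesh {f : ℝ → ℝ} (hf : ContinuousAt f 0) {y : ℝ} (hy : f 0 = y) :
    Tendsto (fun N => ENNReal.ofReal ((b - a) * f (mesh a b N))) atTop
      (𝓝 (ENNReal.ofReal ((b - a) * y))) := by
  rw [← hy]
  exact ENNReal.tendsto_ofReal ((hf.tendsto.comp (tendsto_mesh a b)).const_mul _)

theorem eventually_mesh_le (a b L : ℝ) {x : ℝ} (hx : 0 < x) :
    ∀ᶠ N in atTop, L * mesh a b N ≤ x := by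
  have := (tendsto_mesh a b).const_mul L
  rw [mul_zero] at this
  exact this.eventually (eventually_le_nhds hx)

/-- Along an affine reparametrization of time with slope `±1`, the number of crossings of level `c`
from below has a measurable majorant whose expectation is at most that given by Rice's formula with
the maximal speeds. The majorant, a lower limit of the upper bounds along partitions, spares a proof
that the number of crossings is itself measurable. -/
theorem exists_majorant_entries (hρ : 0 < ρ) (hs0 : 0 < smin) (hs : smin ≤ smax) (hik : i ≠ k)
    (hc : c ∈ Icc (-1 : ℝ) 1) (hε : |ε| = 1) (hab : a < b) :
    ∃ U : (Fin M × ℕ → UnitSphere × ℝ) → ENNReal, Measurable U ∧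
      (∀ᵐ ω ∂movement M smin smax,
        ((entries (fun s => height ρ ω i k (β + ε * s)) c a b).encard : ENNReal) ≤ U ω) ∧
      ∫⁻ ω, U ω ∂movement M smin smax ≤
        ENNReal.ofReal ((b - a) * (√(1 - c ^ 2) / 2)) * meanApproach (smax / ρ) (smax / ρ) := by
  set L := smax / ρ with hL
  have hL0 : 0 < L := div_pos (hs0.trans_le hs) hρ
  set Y : (Fin M × ℕ → UnitSphere × ℝ) → ℕ → ℕ → ENNReal := fun ω N j =>
    upperTerm ρ ω i k c L ε (mesh a b N) (β + ε * grid a b N j) with hY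
  have hm : ∀ N j, Measurable fun ω => Y ω N j := fun N j => measurable_upperTerm ρ i k _ _ _ _ _
  have hmS : ∀ N, Measurable fun ω => ∑ j ∈ Finset.range (N + 1), Y ω N j := fun N =>
    Finset.measurable_sum _ fun j _ => hm N j
  refine ⟨fun ω => liminf (fun N => ∑ j ∈ Finset.range (N + 1), Y ω N j) atTop,
    Measurable.liminf hmS, ?_, ?_⟩
  · filter_upwards [ae_regular hρ hs0 hs] with ω hω
    refine encard_entries_le_liminf hab ?_
    filter_upwards [eventually_mesh_le a b L one_pos] with N hN j _ h1 ⟨s, hs, h2⟩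
    refine one_le_upperTerm (θ := s - grid a b N j) hω hρ hs0 hε hN ⟨by linarith [hs.1], ?_⟩ h1 ?_
    · have := hs.2
      rw [grid_succ] at this
      linarith
    · convert h2 using 2; ring
  · refine (lintegral_liminf_le hmS).trans ?_
    set m := meanApproach L L with hm'
    have hmtop : m ≠ ⊤ := by rw [hm', meanApproach_self hL0.le]; exact ENNReal.ofReal_ne_top
    set F : ℝ → ℝ := fun h => (√(1 - c ^ 2) + √(2 * (2 * L * h + 16 * (L * h) ^ 2))) / 2 with hF
    set G : ℝ → ℝ := fun h => 16 * L ^ 2 * h / 2 with hG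
    set Z : ℕ → ENNReal := fun N => ∑ j ∈ Finset.range (N + 1), ∫⁻ ω, legChange ρ ω i k
        (β + ε * grid a b N j) (β + ε * grid a b N j + ε * mesh a b N) ∂movement M smin smax with hZ
    have hb : ∀ N, ∫⁻ ω, ∑ j ∈ Finset.range (N + 1), Y ω N j ∂movement M smin smax ≤
        ENNReal.ofReal ((b - a) * F (mesh a b N)) * m + ENNReal.ofReal ((b - a) * G (mesh a b N)) +
          ENNReal.ofReal L * (ENNReal.ofReal (mesh a b N) * Z N) := by
      intro N
      rw [lintegral_finsetSum _ fun j _ => hm N j]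
      refine (Finset.sum_le_sum fun j _ => lintegral_upperTerm_le hρ hs0 hs hik hc hε
        (mesh_pos hab N).le).trans (le_of_eq ?_)
      rw [Finset.sum_add_distrib, Finset.sum_const, Finset.card_range, nsmul_eq_mul, mul_add,
        ← Finset.mul_sum, ← mul_assoc, mul_div_assoc, ofReal_mesh_mul]
      refine congrArg₂ _ (congrArg₂ _ rfl ?_) ?_
      · rw [← ofReal_mesh_mul (N := N)]
        congr 3
        simp only [hG, hL]; ring
      · rw [← mul_assoc, ← ENNReal.ofReal_mul hL0.le]
    have hlim : Tendsto (fun N => ENNReal.ofReal ((b - a) * F (mesh a b N)) * m +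
        ENNReal.ofReal ((b - a) * G (mesh a b N)) +
          ENNReal.ofReal L * (ENNReal.ofReal (mesh a b N) * Z N)) atTop
        (𝓝 (ENNReal.ofReal ((b - a) * (√(1 - c ^ 2) / 2)) * m + ENNReal.ofReal ((b - a) * 0) +
          ENNReal.ofReal L * 0)) := by
      refine ((ENNReal.Tendsto.mul_const (tendsto_ofReal_mesh ?_ ?_) (Or.inr hmtop)).add
        (tendsto_ofReal_mesh ?_ ?_)).add (ENNReal.Tendsto.const_mul
        (tendsto_sum_legChange hρ hs0 hs i k hε hab) (Or.inr ENNReal.ofReal_ne_top))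
      · exact Continuous.continuousAt (by fun_prop)
      · simp [hF]
      · exact Continuous.continuousAt (by fun_prop)
      · simp [hG]
    simp only [mul_zero, ENNReal.ofReal_zero, add_zero] at hlim
    rw [← hlim.liminf_eq]
    exact liminf_le_liminf (Eventually.of_forall hb)

/-- The expected number of crossings of level `c` from below is at least that given by Rice's
formula with the minimal speeds. (The lower Lebesgue integral of a function that is not known to be
measurable may be bounded below by those of measurable minorants.) -/
theorem le_lintegral_encard_entries (hρ : 0 < ρ) (hs0 : 0 < smin) (hs : smin ≤ smax) (hik : i ≠ k)
    (hc : c ∈ Ioo (-1 : ℝ) 1) (hε : |ε| = 1) (hab : a < b) :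
    ENNReal.ofReal ((b - a) * (√(1 - c ^ 2) / 2)) * meanApproach (smin / ρ) (smin / ρ) ≤
      ∫⁻ ω, ((entries (fun s => height ρ ω i k (β + ε * s)) c a b).encard : ENNReal)
        ∂movement M smin smax := by
  set L := smax / ρ with hL
  have hL0 : 0 < L := div_pos (hs0.trans_le hs) hρ
  set X : (Fin M × ℕ → UnitSphere × ℝ) → ℕ → ℕ → ENNReal := fun ω N j =>
    lowerTerm ρ ω i k c L ε (mesh a b N) (β + ε * grid a b N j) with hX
  have hm : ∀ N j, Measurable fun ω => X ω N j := fun N j => measurable_lowerTerm ρ i k _ _ _ _ _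
  set I := ∫⁻ ω, ((entries (fun s => height ρ ω i k (β + ε * s)) c a b).encard : ENNReal)
        ∂movement M smin smax with hI
  have hXI : ∀ᶠ N in atTop, ∑ j ∈ Finset.range (N + 1), ∫⁻ ω, X ω N j ∂movement M smin smax ≤ I := by
    filter_upwards [eventually_mesh_le a b L one_pos] with N hN
    rw [← lintegral_finsetSum _ fun j _ => hm N j]
    refine lintegral_mono_ae ?_
    filter_upwards [ae_regular hρ hs0 hs] with ω hω
    classical
    set s : Finset ℕ := (Finset.range (N + 1)).filter fun j => X ω N j ≠ 0 with hsdef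
    have hcard : ((s.card : ℕ∞) : ENNReal) ≤
        ((entries (fun s => height ρ ω i k (β + ε * s)) c a b).encard : ENNReal) := by
      refine ENat.toENNReal_le.2 (card_le_encard_entries ?_ c hab N fun j hj => ?_)
      · exact (continuous_height hω hρ hs0).comp (by fun_prop)
      · rw [hsdef, Finset.mem_filter, Finset.mem_range] at hj
        refine ⟨hj.1, ?_⟩
        rw [affine_grid_succ]
        exact crossing_of_lowerTerm_ne_zero hω hρ hs0 hε (mesh_pos hab N).le hN hj.2
    refine le_trans ?_ hcard
    rw [← Finset.sum_filter_ne_zero]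
    refine (Finset.sum_le_card_nsmul _ _ 1 fun j _ => lowerTerm_le_one _).trans ?_
    simp [hsdef]
  set m := meanApproach (smin / ρ) (smin / ρ) with hm'
  have hmtop : m ≠ ⊤ := by
    rw [hm', meanApproach_self (div_pos hs0 hρ).le]; exact ENNReal.ofReal_ne_top
  set F : ℝ → ℝ := fun h => (√(1 - c ^ 2) - √(2 * (2 * L * h))) / 2 with hF
  set G : ℝ → ℝ := fun h => 16 * L ^ 2 * h / 2 with hG
  set Z : ℕ → ENNReal := fun N => ∑ j ∈ Finset.range (N + 1), ∫⁻ ω, legChange ρ ω i k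
      (β + ε * grid a b N j) (β + ε * grid a b N j + ε * mesh a b N) ∂movement M smin smax with hZ
  have hb : ∀ᶠ N in atTop, ENNReal.ofReal ((b - a) * F (mesh a b N)) * m ≤
      I + ENNReal.ofReal ((b - a) * G (mesh a b N)) +
        ENNReal.ofReal (1 / 2) * m * (ENNReal.ofReal (mesh a b N) * Z N) := by
    filter_upwards [hXI, eventually_mesh_le a b (2 * L) (x := 1 + c) (by linarith [hc.1])] with N hN hN2
    have hpos := (mesh_pos hab N).le
    have h1 := Finset.sum_le_sum fun j (_ : j ∈ Finset.range (N + 1)) =>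
      le_lintegral_lowerTerm (t := β + ε * grid a b N j) hρ hs0 hs hik (Ioo_subset_Icc_self hc) hε
        hpos hN2
    rw [Finset.sum_const, Finset.card_range, nsmul_eq_mul, ← mul_assoc, mul_div_assoc,
      ofReal_mesh_mul, Finset.sum_add_distrib, Finset.sum_add_distrib, Finset.sum_const,
      Finset.card_range, nsmul_eq_mul, ← Finset.mul_sum] at h1
    refine h1.trans (add_le_add (add_le_add hN (le_of_eq ?_)) ?_)
    · rw [← ofReal_mesh_mul (N := N)]
      congr 2
      simp only [hG, hL]; ring
    · have h2 : √(1 - c ^ 2) ≤ 1 := Real.sqrt_le_one.2 (by linarith [sq_nonneg c])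
      have h3 := Real.sqrt_nonneg (2 * (2 * L * mesh a b N))
      have h4 : ENNReal.ofReal (mesh a b N * ((√(1 - c ^ 2) - √(2 * (2 * L * mesh a b N))) / 2)) ≤
          ENNReal.ofReal (1 / 2) * ENNReal.ofReal (mesh a b N) := by
        rw [← ENNReal.ofReal_mul (by norm_num), mul_comm (1 / 2 : ℝ)]
        exact ENNReal.ofReal_le_ofReal (mul_le_mul_of_nonneg_left (by linarith) hpos)
      refine (mul_le_mul_left (mul_le_mul_left h4 m) (Z N)).trans (le_of_eq ?_)
      ring
  have hl : Tendsto (fun N => ENNReal.ofReal ((b - a) * F (mesh a b N)) * m) atTop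
      (𝓝 (ENNReal.ofReal ((b - a) * (√(1 - c ^ 2) / 2)) * m)) :=
    ENNReal.Tendsto.mul_const (tendsto_ofReal_mesh (Continuous.continuousAt (by fun_prop))
      (by simp [hF])) (Or.inr hmtop)
  have hr : Tendsto (fun N => I + ENNReal.ofReal ((b - a) * G (mesh a b N)) +
        ENNReal.ofReal (1 / 2) * m * (ENNReal.ofReal (mesh a b N) * Z N)) atTop
      (𝓝 (I + ENNReal.ofReal ((b - a) * 0) + ENNReal.ofReal (1 / 2) * m * 0)) :=
    (tendsto_const_nhds.add (tendsto_ofReal_mesh (Continuous.continuousAt (by fun_prop))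
      (by simp [hG]))).add (ENNReal.Tendsto.const_mul
        (tendsto_sum_legChange hρ hs0 hs i k hε hab)
        (Or.inr (ENNReal.mul_ne_top ENNReal.ofReal_ne_top hmtop)))
  simp only [mul_zero, ENNReal.ofReal_zero, add_zero] at hr
  exact le_of_tendsto_of_tendsto hl hr hb

end Rates

/-! ### Contacts as level crossings -/

section Contact
variable {M : ℕ} {ρ smin smax r : ℝ} {i k : Fin M} {a b : ℝ}

theorem inRange_iff {ω : Outcome M} (hω : ∀ i, Regular ρ smin smax (itinerary ω.1 i)) (hρ : 0 < ρ)
    (hr : 0 ≤ r) (hrπ : r / ρ ≤ Real.pi) (t : ℝ) :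
    InRange ρ r ω i k t ↔ Real.cos (r / ρ) ≤ height ρ ω.1 i k t := by
  set p := position ρ (itinerary ω.1 i) t
  set q := position ρ (itinerary ω.1 k) t
  have e : height ρ ω.1 i k t = Real.cos (InnerProductGeometry.angle p q) := by
    rw [InnerProductGeometry.cos_angle, (hω i).norm_position, (hω k).norm_position, mul_one, div_one]
    rfl
  rw [e, Real.strictAntiOn_cos.le_iff_ge ⟨by positivity, hrπ⟩
    ⟨InnerProductGeometry.angle_nonneg _ _, InnerProductGeometry.angle_le_pi _ _⟩, le_div_iff₀' hρ]
  rfl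

theorem inRange_of_pi_le {ω : Outcome M} (hρ : 0 < ρ) (hrπ : Real.pi ≤ r / ρ) (t : ℝ) :
    InRange ρ r ω i k t := by
  unfold InRange geoDist
  rw [← le_div_iff₀' hρ]
  exact (InnerProductGeometry.angle_le_pi _ _).trans hrπ

theorem setOf_contactBegins_eq {ω : Outcome M} (hω : ∀ i, Regular ρ smin smax (itinerary ω.1 i))
    (hρ : 0 < ρ) (hr : 0 ≤ r) (hrπ : r / ρ ≤ Real.pi) :
    {t ∈ Ioc a b | ContactBegins ρ r ω i k t} =
      entries (fun s => height ρ ω.1 i k (0 + 1 * s)) (Real.cos (r / ρ)) a b := by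
  ext t
  simp only [ContactBegins, inRange_iff hω hρ hr hrπ, entries, not_le, zero_add, one_mul,
    mem_ofPred_eq]

theorem tendsto_sub_nhdsLT (x s : ℝ) : Tendsto (fun u => x - u) (𝓝[<] s) (𝓝[>] (x - s)) :=
  tendsto_nhdsWithin_iff.2 ⟨(Continuous.tendsto (by fun_prop) s).mono_left nhdsWithin_le_nhds,
    eventually_mem_nhdsWithin.mono fun u hu => sub_lt_sub_left (mem_Iio.1 hu) x⟩

theorem tendsto_sub_nhdsGT (x s : ℝ) : Tendsto (fun u => x - u) (𝓝[>] s) (𝓝[<] (x - s)) :=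
  tendsto_nhdsWithin_iff.2 ⟨(Continuous.tendsto (by fun_prop) s).mono_left nhdsWithin_le_nhds,
    eventually_mem_nhdsWithin.mono fun u hu => sub_lt_sub_left (mem_Ioi.1 hu) x⟩

/-- Departures are arrivals when time is reversed about the middle of the interval. The endpoints
have to be excluded, as the interval is open on the left and closed on the right. -/
theorem encard_contactEnds_eq {ω : Outcome M} (hω : ∀ i, Regular ρ smin smax (itinerary ω.1 i))
    (hρ : 0 < ρ) (hs : 0 < smin) (hr : 0 ≤ r) (hrπ : r / ρ ≤ Real.pi)
    (ha : height ρ ω.1 i k a ≠ Real.cos (r / ρ)) (hb : height ρ ω.1 i k b ≠ Real.cos (r / ρ)) :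
    {t ∈ Ioc a b | ContactEnds ρ r ω i k t}.encard =
      (entries (fun s => height ρ ω.1 i k (a + b + -1 * s)) (Real.cos (r / ρ)) a b).encard := by
  have hcont : Continuous (height ρ ω.1 i k) := continuous_height hω hρ hs
  have key : ∀ t, Real.cos (r / ρ) ≤ height ρ ω.1 i k t →
      (∀ᶠ u in 𝓝[>] t, height ρ ω.1 i k u < Real.cos (r / ρ)) →
      height ρ ω.1 i k t = Real.cos (r / ρ) := fun t h1 h2 =>
    le_antisymm (le_of_tendsto ((hcont.tendsto t).mono_left nhdsWithin_le_nhds)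
      (h2.mono fun u hu => hu.le)) h1
  rw [← (sub_right_injective (b := a + b)).encard_image]
  congr 1
  ext s
  simp only [mem_image, ContactEnds, inRange_iff hω hρ hr hrπ, entries, not_le, mem_ofPred_eq]
  constructor
  · rintro ⟨t, ⟨ht, h1, h2⟩, rfl⟩
    have htb : t ≠ b := fun h => hb (by rw [← h]; exact key t h1 h2)
    refine ⟨⟨by linarith [lt_of_le_of_ne ht.2 htb], by linarith [ht.1]⟩, ?_, ?_⟩
    · rw [show a + b + -1 * (a + b - t) = t by ring]
      exact h1
    · have := (tendsto_sub_nhdsLT (a + b) (a + b - t))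
      rw [sub_sub_cancel] at this
      filter_upwards [this.eventually h2] with u hu
      rw [neg_one_mul, ← sub_eq_add_neg]
      exact hu
  · rintro ⟨ht, h1, h2⟩
    have h1' : Real.cos (r / ρ) ≤ height ρ ω.1 i k (a + b - s) := by convert h1 using 2; ring
    have h2' : ∀ᶠ u in 𝓝[>] (a + b - s), height ρ ω.1 i k u < Real.cos (r / ρ) := by
      have := (tendsto_sub_nhdsGT (a + b) (a + b - s))
      rw [sub_sub_cancel] at this
      filter_upwards [this.eventually h2] with u hu
      convert hu using 2; ring
    have hta : a + b - s ≠ a := fun h => ha (by rw [← h]; exact key _ h1' h2')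
    exact ⟨a + b - s, ⟨⟨lt_of_le_of_ne (by linarith [ht.2]) (Ne.symm hta), by linarith [ht.1]⟩,
      h1', h2'⟩, by ring⟩

theorem not_contactBegins_of_pi_le {ω : Outcome M} (hρ : 0 < ρ) (hrπ : Real.pi ≤ r / ρ) (t : ℝ) :
    ¬ ContactBegins ρ r ω i k t := fun h =>
  let ⟨u, hu⟩ := h.2.exists
  hu (inRange_of_pi_le hρ hrπ u)

theorem not_contactEnds_of_pi_le {ω : Outcome M} (hρ : 0 < ρ) (hrπ : Real.pi ≤ r / ρ) (t : ℝ) :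
    ¬ ContactEnds ρ r ω i k t := fun h =>
  let ⟨u, hu⟩ := h.2.exists
  hu (inRange_of_pi_le hρ hrπ u)

end Contact

/-! ### Transfer to the law of the model -/

section Law
variable {M n : ℕ} {smin smax : ℝ}

theorem isProbabilityMeasure_uniformOn_card (hn : n ≤ M) :
    IsProbabilityMeasure (ProbabilityTheory.uniformOn {S : Finset (Fin M) | S.card = n}) := by
  refine ProbabilityTheory.isProbabilityMeasure_uniformOn (toFinite _) ?_
  obtain ⟨S, -, hS⟩ := Finset.exists_subset_card_eq (s := (Finset.univ : Finset (Fin M))) (n := n)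
    (by simpa using hn)
  exact ⟨S, hS⟩

theorem measurePreserving_fst_law (hn : n ≤ M) :
    MeasurePreserving Prod.fst (law M n smin smax) (movement M smin smax) :=
  haveI := isProbabilityMeasure_uniformOn_card hn
  measurePreserving_fst

/-- The counts need not be known to be measurable: a measurable majorant suffices. -/
theorem lintegral_law_sum_le (hn : n ≤ M) (s : Finset (Fin M))
    {e : Fin M → (Fin M × ℕ → UnitSphere × ℝ) → ENNReal} {A : ENNReal}
    (he : ∀ k ∈ s, ∃ U, Measurable U ∧ (∀ᵐ ω ∂movement M smin smax, e k ω ≤ U ω) ∧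
      ∫⁻ ω, U ω ∂movement M smin smax ≤ A) :
    ∫⁻ ω, ∑ k ∈ s, e k ω.1 ∂law M n smin smax ≤ s.card * A := by
  choose! U hU1 hU2 hU3 using he
  calc _ ≤ ∫⁻ ω, ∑ k ∈ s, U k ω.1 ∂law M n smin smax := by
        refine lintegral_mono_ae ((measurePreserving_fst_law hn).quasiMeasurePreserving.ae
          (p := fun ω => ∑ k ∈ s, e k ω ≤ ∑ k ∈ s, U k ω) ?_)
        have : ∀ᵐ ω ∂movement M smin smax, ∀ k : s, e k ω ≤ U k ω :=
          ae_all_iff.2 fun k => hU2 k k.2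
        filter_upwards [this] with ω hω
        exact Finset.sum_le_sum fun k hk => hω ⟨k, hk⟩
    _ = ∑ k ∈ s, ∫⁻ ω, U k ω ∂movement M smin smax := by
        rw [(measurePreserving_fst_law hn).lintegral_comp
          (f := fun ω => ∑ k ∈ s, U k ω) (Finset.measurable_sum _ hU1), lintegral_finsetSum _ hU1]
    _ ≤ _ := by
        rw [← nsmul_eq_mul]
        exact Finset.sum_le_card_nsmul _ _ _ hU3

/-- Lower Lebesgue integrals are superadditive, so no measurability is needed for lower bounds. -/
theorem le_lintegral_law_sum (hn : n ≤ M) (s : Finset (Fin M))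
    {e : Fin M → (Fin M × ℕ → UnitSphere × ℝ) → ENNReal} {B : ENNReal}
    (he : ∀ k ∈ s, B ≤ ∫⁻ ω, e k ω ∂movement M smin smax) :
    s.card * B ≤ ∫⁻ ω, ∑ k ∈ s, e k ω.1 ∂law M n smin smax := by
  have h1 : ∑ k ∈ s, ∫⁻ ω, e k ω ∂movement M smin smax ≤
      ∫⁻ ω, ∑ k ∈ s, e k ω ∂movement M smin smax := by
    clear he
    classical
    induction s using Finset.induction_on with
    | empty => simp
    | insert k s hk ih =>
      simp only [Finset.sum_insert hk]
      exact (add_le_add le_rfl ih).trans (le_lintegral_add _ _)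
  rw [← nsmul_eq_mul]
  refine (Finset.card_nsmul_le_sum _ _ _ he).trans (h1.trans ?_)
  rw [← (measurePreserving_fst_law (n := n) hn).map_eq]
  exact lintegral_map_le _ _

end Law

section Counts
variable {M n : ℕ} {ρ smin smax r : ℝ} {i k : Fin M} {a b : ℝ}

/-- An expectation between the values for two speeds is the value for some speed in between. -/
theorem exists_eq_ofReal_mul {I : ENNReal} {K : ℝ} (hK : 0 ≤ K) (hs0 : 0 < smin)
    (hs : smin ≤ smax) (h1 : ENNReal.ofReal (K * smin) ≤ I) (h2 : I ≤ ENNReal.ofReal (K * smax)) :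
    ∃ v ∈ Icc smin smax, I = ENNReal.ofReal (K * v) := by
  rcases hK.eq_or_lt with rfl | hK
  · refine ⟨smin, left_mem_Icc.2 hs, ?_⟩
    simp only [zero_mul, ENNReal.ofReal_zero] at h2 ⊢
    exact le_antisymm h2 bot_le
  · have hI : I ≠ ⊤ := ne_top_of_le_ne_top ENNReal.ofReal_ne_top h2
    refine ⟨I.toReal / K, ⟨?_, ?_⟩, ?_⟩
    · rw [le_div_iff₀' hK]
      exact (ENNReal.ofReal_le_iff_le_toReal hI).1 h1
    · rw [div_le_iff₀' hK]
      exact ENNReal.toReal_le_of_le_ofReal (mul_nonneg hK.le (hs0.le.trans hs)) h2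
    · rw [mul_div_cancel₀ _ hK.ne', ENNReal.ofReal_toReal hI]

theorem card_erase_univ (i : Fin M) [DecidableEq (Fin M)] :
    (((Finset.univ.erase i).card : ℕ) : ℝ) = M - 1 := by
  rw [Finset.card_erase_of_mem (Finset.mem_univ i), Finset.card_univ, Fintype.card_fin,
    Nat.cast_pred (Fin.pos i)]

/-- Rice's formula with the speeds known up to a factor: the expected number of crossings, by all
devices other than `i`, of the boundary of the range of device `i`. -/
theorem exists_lintegral_law_eq (hn : n ≤ M) (hρ : 0 < ρ) (hs0 : 0 < smin) (hs : smin ≤ smax)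
    (hr : 0 < r) (hrπ : r / ρ < Real.pi) (hab : a < b) [DecidableEq (Fin M)] (i : Fin M)
    {e : Fin M → (Fin M × ℕ → UnitSphere × ℝ) → ENNReal} {β ε : ℝ} (hε : |ε| = 1)
    (he : ∀ k ≠ i, ∀ᵐ ω ∂movement M smin smax, e k ω =
      (entries (fun s => height ρ ω i k (β + ε * s)) (Real.cos (r / ρ)) a b).encard) :
    ∃ v ∈ Icc smin smax, ∫⁻ ω, ∑ k ∈ Finset.univ.erase i, e k ω.1 ∂law M n smin smax =
      ENNReal.ofReal ((M - 1) * (b - a) * (2 / Real.pi ^ 2 * Real.sin (r / ρ) / ρ) * v) := by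
  have hα : 0 < r / ρ := div_pos hr hρ
  have hM : (0 : ℝ) ≤ M - 1 := by rw [← card_erase_univ i]; positivity
  have hsin : 0 < Real.sin (r / ρ) := Real.sin_pos_of_pos_of_lt_pi hα hrπ
  have hc : Real.cos (r / ρ) ∈ Ioo (-1 : ℝ) 1 := by
    have := Real.sin_sq_add_cos_sq (r / ρ)
    rw [mem_Ioo, ← abs_lt, ← sq_lt_one_iff_abs_lt_one]
    nlinarith
  have hsq : √(1 - Real.cos (r / ρ) ^ 2) = Real.sin (r / ρ) := by
    rw [← Real.sin_sq, Real.sqrt_sq hsin.le]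
  have hval : ∀ v : ℝ, 0 ≤ v → ((Finset.univ.erase i).card : ENNReal) *
      (ENNReal.ofReal ((b - a) * (√(1 - Real.cos (r / ρ) ^ 2) / 2)) *
        meanApproach (v / ρ) (v / ρ)) =
      ENNReal.ofReal ((M - 1) * (b - a) * (2 / Real.pi ^ 2 * Real.sin (r / ρ) / ρ) * v) := by
    intro v hv
    have hba : 0 ≤ b - a := (sub_pos.2 hab).le
    rw [meanApproach_self (by positivity), hsq, ← ENNReal.ofReal_natCast, card_erase_univ,
      ← ENNReal.ofReal_mul (by positivity), ← ENNReal.ofReal_mul hM]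
    congr 1
    ring
  refine exists_eq_ofReal_mul ?_ hs0 hs ?_ ?_
  · have hba : 0 ≤ b - a := (sub_pos.2 hab).le
    positivity
  · rw [← hval smin hs0.le]
    refine le_lintegral_law_sum hn _ fun k hk => ?_
    rw [lintegral_congr_ae (he k (Finset.ne_of_mem_erase hk))]
    exact le_lintegral_encard_entries hρ hs0 hs (Finset.ne_of_mem_erase hk).symm hc hε hab
  · rw [← hval smax (hs0.le.trans hs)]
    refine lintegral_law_sum_le hn _ fun k hk => ?_
    obtain ⟨U, h1, h2, h3⟩ := exists_majorant_entries (β := β) hρ hs0 hs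
      (Finset.ne_of_mem_erase hk).symm (Ioo_subset_Icc_self hc) hε hab
    refine ⟨U, h1, ?_, h3⟩
    filter_upwards [h2, he k (Finset.ne_of_mem_erase hk)] with ω h2 h4
    rw [h4]; exact h2

theorem exists_lintegral_arrivals_eq (hn : n ≤ M) (hρ : 0 < ρ) (hs0 : 0 < smin) (hs : smin ≤ smax)
    (hr : 0 < r) (hrπ : r / ρ < Real.pi) (hab : a < b) (i : Fin M) :
    ∃ v ∈ Icc smin smax, ∫⁻ ω, arrivals ρ r ω i a b ∂law M n smin smax =
      ENNReal.ofReal ((M - 1) * (b - a) * (2 / Real.pi ^ 2 * Real.sin (r / ρ) / ρ) * v) := by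
  classical
  have := exists_lintegral_law_eq (n := n) (β := 0) (ε := 1) hn hρ hs0 hs hr hrπ hab i
    (e := fun k ω => (({t ∈ Ioc a b | ContactBegins ρ r (ω, ∅) i k t}.encard : ℕ∞) : ENNReal))
    (by simp) fun k _ => by
      filter_upwards [ae_regular hρ hs0 hs] with ω hω
      rw [setOf_contactBegins_eq (ω := (ω, ∅)) hω hρ hr.le hrπ.le]
  exact this

theorem exists_lintegral_departures_eq (hn : n ≤ M) (hρ : 0 < ρ) (hs0 : 0 < smin)
    (hs : smin ≤ smax) (hr : 0 < r) (hrπ : r / ρ < Real.pi) (hab : a < b) (i : Fin M) :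
    ∃ v ∈ Icc smin smax, ∫⁻ ω, departures ρ r ω i a b ∂law M n smin smax =
      ENNReal.ofReal ((M - 1) * (b - a) * (2 / Real.pi ^ 2 * Real.sin (r / ρ) / ρ) * v) := by
  classical
  have := exists_lintegral_law_eq (n := n) (β := a + b) (ε := -1) hn hρ hs0 hs hr hrπ hab i
    (e := fun k ω => (({t ∈ Ioc a b | ContactEnds ρ r (ω, ∅) i k t}.encard : ℕ∞) : ENNReal))
    (by simp) fun k hk => by
      filter_upwards [ae_regular hρ hs0 hs, ae_height_ne hρ hs0 hs hk.symm (Real.cos (r / ρ)) a,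
        ae_height_ne hρ hs0 hs hk.symm (Real.cos (r / ρ)) b] with ω hω h1 h2
      rw [encard_contactEnds_eq (ω := (ω, ∅)) hω hρ hs0 hr.le hrπ.le h1 h2]
  exact this

theorem arrivals_eq_zero (hρ : 0 < ρ) (hrπ : Real.pi ≤ r / ρ) (ω : Outcome M) (i : Fin M) :
    arrivals ρ r ω i a b = 0 := by
  unfold arrivals
  simp [not_contactBegins_of_pi_le hρ hrπ]

theorem departures_eq_zero (hρ : 0 < ρ) (hrπ : Real.pi ≤ r / ρ) (ω : Outcome M) (i : Fin M) :
    departures ρ r ω i a b = 0 := by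
  unfold departures
  simp [not_contactEnds_of_pi_le hρ hrπ]

end Counts

/-! ### The probability of a contact and the expected contact time -/

/-- The area of a spherical cap of angular radius `α`, as a proportion of that of the sphere; it is
`1` for `α ≥ π`. -/
noncomputable def capProb (α : ℝ) : ℝ := (1 - Real.cos (min α Real.pi)) / 2

theorem capProb_nonneg (α : ℝ) : 0 ≤ capProb α := by
  unfold capProb; linarith [Real.cos_le_one (min α Real.pi)]

section
variable {M n : ℕ} {ρ smin smax r : ℝ} {i k : Fin M} {a b : ℝ}

theorem geoDist_le_iff {u v : Space} (hu : ‖u‖ = 1) (hv : ‖v‖ = 1) (hρ : 0 < ρ) (hr : 0 ≤ r) :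
    geoDist ρ u v ≤ r ↔ Real.cos (min (r / ρ) Real.pi) ≤ inner ℝ u v := by
  have e : inner ℝ u v = Real.cos (InnerProductGeometry.angle u v) := by
    rw [InnerProductGeometry.cos_angle, hu, hv, mul_one, div_one]
  rw [e, Real.strictAntiOn_cos.le_iff_ge ⟨le_min (by positivity) Real.pi_pos.le, min_le_right _ _⟩
    ⟨InnerProductGeometry.angle_nonneg _ _, InnerProductGeometry.angle_le_pi _ _⟩, le_min_iff,
    le_div_iff₀' hρ, and_iff_left (InnerProductGeometry.angle_le_pi _ _)]
  rfl

theorem measurable_geoDist {α : Type*} [MeasurableSpace α] {u v : α → Space} (hu : Measurable u)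
    (hv : Measurable v) : Measurable fun x => geoDist ρ (u x) (v x) := by
  unfold geoDist InnerProductGeometry.angle
  fun_prop

theorem haar_geoDist_le {u v : Space} (hu : ‖u‖ = 1) (hv : ‖v‖ = 1) (hρ : 0 < ρ) (hr : 0 ≤ r) :
    Rot.haar {R : Rot | geoDist ρ u (R.1 v) ≤ r} = ENNReal.ofReal (capProb (r / ρ)) := by
  have h1 : {R : Rot | geoDist ρ u (R.1 v) ≤ r} =
      (fun R : Rot => inner ℝ u (R.1 v)) ⁻¹' Ici (Real.cos (min (r / ρ) Real.pi)) := by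
    ext R
    exact geoDist_le_iff hu ((Rot.norm_map R v).trans hv) hρ hr
  have hm : Measurable fun R : Rot => inner ℝ u (R.1 v) := by fun_prop
  rw [h1, ← Measure.map_apply hm measurableSet_Ici, map_inner_haar hu hv, uniformHeight_Ici,
    max_eq_left (Real.neg_one_le_cos _), capProb]

theorem measurableSet_inRange {α : Type*} [MeasurableSpace α] {ω : α → Outcome M} {τ : α → ℝ}
    (hω : Measurable ω) (hτ : Measurable τ) :
    MeasurableSet {x | InRange ρ r (ω x) i k (τ x)} :=
  measurableSet_le (measurable_geoDist
    (measurable_position ρ ((measurable_itinerary i).comp hω.fst) hτ)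
    (measurable_position ρ ((measurable_itinerary k).comp hω.fst) hτ)) measurable_const

theorem movement_inRange (hρ : 0 < ρ) (hs0 : 0 < smin) (hs : smin ≤ smax) (hr : 0 ≤ r)
    (hik : i ≠ k) (t : ℝ) :
    movement M smin smax {ω | InRange ρ r (ω, ∅) i k t} = ENNReal.ofReal (capProb (r / ρ)) := by
  have hm : MeasurableSet {ω : Fin M × ℕ → UnitSphere × ℝ | InRange ρ r (ω, ∅) i k t} :=
    measurableSet_inRange (measurable_id.prodMk measurable_const) measurable_const
  rw [← lintegral_indicator_one hm, lintegral_turn Rot.haar (measurable_turnOn {j | j.1 = k})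
    (measurable_one.indicator hm)]
  have : ∀ᵐ ω ∂movement M smin smax, ∫⁻ R, {ω | InRange ρ r (ω, ∅) i k t}.indicator 1
      (turn (turnOn {j | j.1 = k} R) ω) ∂(Rot.haar) = ENNReal.ofReal (capProb (r / ρ)) := by
    filter_upwards [ae_regular hρ hs0 hs] with ω hω
    rw [← haar_geoDist_le ((hω i).norm_position t) ((hω k).norm_position t) hρ hr,
      ← lintegral_indicator_one (measurableSet_le (measurable_geoDist (by fun_prop) (by fun_prop))
        measurable_const)]
    congr 1
    funext R
    have e : InRange ρ r (turn (turnOn {j | j.1 = k} R) ω, ∅) i k t ↔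
        geoDist ρ (position ρ (itinerary ω i) t) (R.1 (position ρ (itinerary ω k) t)) ≤ r := by
      rw [← position_turn, ← itinerary_turn_self, ← itinerary_turn_of_ne ω R hik]
      rfl
    classical
    simp only [indicator_apply, mem_ofPred_eq, e, Pi.one_apply]
  rw [lintegral_congr_ae this]
  simp

theorem law_inRange (hn : n ≤ M) (hρ : 0 < ρ) (hs0 : 0 < smin) (hs : smin ≤ smax) (hr : 0 ≤ r)
    (hik : i ≠ k) (t : ℝ) :
    law M n smin smax {ω | InRange ρ r ω i k t} = ENNReal.ofReal (capProb (r / ρ)) := by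
  rw [← movement_inRange hρ hs0 hs hr hik t]
  exact (measurePreserving_fst_law hn).measure_preimage (measurableSet_inRange
    (measurable_id.prodMk measurable_const) measurable_const).nullMeasurableSet

theorem deviceCount_eq_sum [DecidableEq (Fin M)] (ω : Outcome M) (i : Fin M) (t : ℝ) :
    (deviceCount ρ r ω i t : ENNReal) =
      ∑ k ∈ Finset.univ.erase i, {x : Outcome M × ℝ | InRange ρ r x.1 i k x.2}.indicator 1 (ω, t) := by
  classical
  have : neighbours ρ r ω i t =
      ((Finset.univ.erase i).filter fun k => InRange ρ r ω i k t : Finset (Fin M)) := by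
    ext k; simp [neighbours]
  rw [deviceCount, this, ncard_coe_finset, Finset.card_filter]
  push_cast
  refine Finset.sum_congr rfl fun k _ => ?_
  simp [indicator_apply]

theorem lintegral_contactTime (hn : n ≤ M) (hρ : 0 < ρ) (hs0 : 0 < smin) (hs : smin ≤ smax)
    (hr : 0 ≤ r) (i : Fin M) :
    ∫⁻ ω, contactTime ρ r ω i a b ∂law M n smin smax =
      ENNReal.ofReal ((M - 1) * (b - a) * capProb (r / ρ)) := by
  classical
  have : IsProbabilityMeasure (law M n smin smax) := by
    have := isProbabilityMeasure_uniformOn_card hn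
    exact inferInstanceAs (IsProbabilityMeasure ((movement M smin smax).prod _))
  have hm : ∀ k, MeasurableSet {x : Outcome M × ℝ | InRange ρ r x.1 i k x.2} := fun k =>
    measurableSet_inRange measurable_fst measurable_snd
  unfold contactTime
  simp only [deviceCount_eq_sum]
  rw [lintegral_lintegral_swap (Finset.measurable_sum _ fun k _ =>
    measurable_one.indicator (hm k)).aemeasurable]
  have h1 : ∀ t, ∫⁻ ω, ∑ k ∈ Finset.univ.erase i,
      {x : Outcome M × ℝ | InRange ρ r x.1 i k x.2}.indicator 1 (ω, t) ∂law M n smin smax =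
      ENNReal.ofReal ((M - 1) * capProb (r / ρ)) := by
    intro t
    have hk : ∀ k ∈ Finset.univ.erase i, ∫⁻ ω,
        {x : Outcome M × ℝ | InRange ρ r x.1 i k x.2}.indicator 1 (ω, t) ∂law M n smin smax =
        ENNReal.ofReal (capProb (r / ρ)) := fun k hk => by
      rw [← law_inRange hn hρ hs0 hs hr (Finset.ne_of_mem_erase hk).symm t,
        ← lintegral_indicator_one (measurableSet_inRange (ω := fun ω => ω) measurable_id
          measurable_const)]
      rfl
    have hmk : ∀ k, Measurable fun ω : Outcome M =>
        {x : Outcome M × ℝ | InRange ρ r x.1 i k x.2}.indicator (1 : Outcome M × ℝ → ENNReal) (ω, t) := fun k =>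
      (measurable_one.indicator (hm k)).comp (measurable_id.prodMk measurable_const)
    rw [lintegral_finsetSum _ fun k _ => hmk k,
      Finset.sum_congr rfl hk, Finset.sum_const, nsmul_eq_mul, ← card_erase_univ i,
      ENNReal.ofReal_mul (by positivity), ENNReal.ofReal_natCast]
  simp only [h1]
  rw [lintegral_const, Measure.restrict_apply_univ, Real.volume_Ioc, ← ENNReal.ofReal_mul]
  · congr 1; ring
  · rw [← card_erase_univ i]
    exact mul_nonneg (by positivity) (capProb_nonneg _)

end

/-! ### Comparison of the rates -/

theorem sub_sin_le_cube {x : ℝ} (hx : 0 < x) (hx' : x ≤ Real.pi) : x - Real.sin x ≤ x ^ 3 := by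
  rcases le_or_gt x 1 with h | h
  · have := Real.sin_gt_sub_cube hx
    have := pow_pos hx 3
    linarith
  · have := Real.sin_nonneg_of_nonneg_of_le_pi hx.le hx'
    nlinarith [mul_pos hx (sub_pos.2 h)]

theorem abs_mul_cot_sub_one_le {x : ℝ} (hx : 0 < x) (hx' : x < Real.pi / 2) :
    |x * (Real.cos x / Real.sin x) - 1| ≤ x ^ 2 := by
  have hs : 0 < Real.sin x := Real.sin_pos_of_pos_of_lt_pi hx (by linarith)
  have hc : 0 < Real.cos x := Real.cos_pos_of_mem_Ioo ⟨by linarith, hx'⟩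
  have h1 : x * Real.cos x ≤ Real.sin x := by
    have := (Real.lt_tan hx hx').le
    rwa [Real.tan_eq_sin_div_cos, le_div_iff₀ hc] at this
  have e : x * (Real.cos x / Real.sin x) - 1 = -((Real.sin x - x * Real.cos x) / Real.sin x) := by
    field_simp; ring
  rw [e, abs_neg, abs_of_nonneg (div_nonneg (by linarith) hs.le), div_le_iff₀ hs]
  rcases le_or_gt x 1 with h | h
  · have h2 := Real.sin_gt_sub_cube hx
    have h3 := Real.one_sub_sq_div_two_le_cos (x := x)
    have h4 := Real.sin_le hx.le
    nlinarith [mul_le_mul_of_nonneg_left h3 hx.le, mul_le_mul_of_nonneg_left h2.le (sq_nonneg x),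
      pow_pos hx 3, pow_le_one₀ hx.le h (n := 2), mul_le_mul_of_nonneg_left
      (pow_le_one₀ hx.le h (n := 2)) (pow_pos hx 3).le]
  · have h2 : 0 < x ^ 2 - 1 := by nlinarith
    nlinarith [mul_pos hx hc, mul_pos hs h2]

section
variable {M : ℕ} {ρ r smin smax v : ℝ}

theorem abs_sub_mean_le (hs0 : 0 < smin) (hs : smin ≤ smax) (hv : v ∈ Icc smin smax) :
    |v - (smax + smin) / 2| ≤ (smax - smin) / (smax + smin) * ((smax + smin) / 2) := by
  have : (smax - smin) / (smax + smin) * ((smax + smin) / 2) = (smax - smin) / 2 := by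
    have : smax + smin ≠ 0 := by linarith
    field_simp
  rw [this, abs_le]
  constructor <;> linarith [hv.1, hv.2]

/-- If a quantity `y` is close to `1`, then a rate proportional to `y` and a speed in
`[smin, smax]` is close to the rate for the mean speed. -/
theorem abs_rate_sub_le (hs0 : 0 < smin) (hs : smin ≤ smax) (hv : v ∈ Icc smin smax) {y x K : ℝ}
    (hK : 0 ≤ K) (hy : |y - 1| ≤ 4 * x ^ 2) :
    |K * (y * v) - K * ((smax + smin) / 2)| ≤
      (8 * x ^ 2 + (smax - smin) / (smax + smin)) * (K * ((smax + smin) / 2)) := by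
  have h1 := abs_sub_mean_le hs0 hs hv
  have hv0 : 0 ≤ v := hs0.le.trans hv.1
  have e : K * (y * v) - K * ((smax + smin) / 2) =
      K * ((y - 1) * v + (v - (smax + smin) / 2)) := by ring
  rw [e, abs_mul, abs_of_nonneg hK]
  have h2 : |(y - 1) * v + (v - (smax + smin) / 2)| ≤ 4 * x ^ 2 * (smax + smin) +
      (smax - smin) / (smax + smin) * ((smax + smin) / 2) := by
    refine (abs_add_le _ _).trans (add_le_add ?_ h1)
    rw [abs_mul, abs_of_nonneg hv0]
    exact mul_le_mul hy (by linarith [hv.2]) hv0 (by positivity)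
  calc _ ≤ K * (4 * x ^ 2 * (smax + smin) +
      (smax - smin) / (smax + smin) * ((smax + smin) / 2)) := mul_le_mul_of_nonneg_left h2 hK
    _ = _ := by ring

theorem arrivalRate_nonneg (hM : 1 ≤ M) (hr : 0 < r) (hs0 : 0 < smin) (hs : smin ≤ smax) :
    0 ≤ arrivalRate M ρ r smin smax := by
  have : (1 : ℝ) ≤ M := by exact_mod_cast hM
  have h2 : 0 < smax + smin := by linarith
  unfold arrivalRate relSpeed
  have := sub_nonneg.2 this
  positivity

theorem departureRate_pos (hr : 0 < r) (hs0 : 0 < smin) (hs : smin ≤ smax) :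
    0 < departureRate r smin smax := by
  have h2 : 0 < smax + smin := by linarith
  unfold departureRate relSpeed
  positivity

/-- Here `y = sin α / α` with `α = r / ρ`. -/
theorem abs_arrival_sub_le (hM : 1 ≤ M) (hρ : 0 < ρ) (hr : 0 < r) (hs0 : 0 < smin)
    (hs : smin ≤ smax) (hrπ : r / ρ < Real.pi) (hv : v ∈ Icc smin smax) :
    |(M - 1) * (2 / Real.pi ^ 2 * Real.sin (r / ρ) / ρ) * v - arrivalRate M ρ r smin smax| ≤
      (8 * (r / (2 * ρ)) ^ 2 + (smax - smin) / (smax + smin)) * arrivalRate M ρ r smin smax := by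
  have hα : 0 < r / ρ := div_pos hr hρ
  have hM' : (0 : ℝ) ≤ M - 1 := sub_nonneg.2 (by exact_mod_cast hM)
  have hr0 := hr.ne'
  have hρ0 := hρ.ne'
  have h := abs_rate_sub_le hs0 hs hv (y := Real.sin (r / ρ) / (r / ρ)) (x := r / (2 * ρ))
    (K := (M - 1) * (2 / Real.pi ^ 2) * (r / ρ) / ρ) (by positivity) (by
      have e : Real.sin (r / ρ) / (r / ρ) - 1 = -((r / ρ - Real.sin (r / ρ)) / (r / ρ)) := by
        field_simp; ring
      rw [e, abs_neg, abs_of_nonneg (div_nonneg (sub_nonneg.2 (Real.sin_le hα.le)) hα.le),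
        div_le_iff₀ hα]
      refine (sub_sin_le_cube hα hrπ.le).trans (le_of_eq ?_)
      field_simp; ring)
  have e1 : (M - 1) * (2 / Real.pi ^ 2 * Real.sin (r / ρ) / ρ) * v =
      (M - 1) * (2 / Real.pi ^ 2) * (r / ρ) / ρ * (Real.sin (r / ρ) / (r / ρ) * v) := by
    field_simp
  have e2 : arrivalRate M ρ r smin smax =
      (M - 1) * (2 / Real.pi ^ 2) * (r / ρ) / ρ * ((smax + smin) / 2) := by
    unfold arrivalRate relSpeed
    have := Real.pi_ne_zero
    field_simp
    ring
  rw [e1, e2]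
  exact h

/-- Here `y = x * cot x` with `x = r / (2 * ρ)`. -/
theorem abs_departure_sub_le (hρ : 0 < ρ) (hr : 0 < r) (hs0 : 0 < smin)
    (hs : smin ≤ smax) (hrπ : r / ρ < Real.pi) (hv : v ∈ Icc smin smax) :
    |2 / Real.pi ^ 2 * Real.sin (r / ρ) / ρ * v / capProb (r / ρ) - departureRate r smin smax| ≤
      (8 * (r / (2 * ρ)) ^ 2 + (smax - smin) / (smax + smin)) * departureRate r smin smax := by
  set x := r / (2 * ρ) with hx
  have hx0 : 0 < x := by positivity
  have hα : r / ρ = 2 * x := by rw [hx]; field_simp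
  have hxπ : x < Real.pi / 2 := by linarith
  have hrx : r = 2 * ρ * x := by rw [hx]; field_simp
  have hs' : 0 < Real.sin x := Real.sin_pos_of_pos_of_lt_pi hx0 (by linarith)
  have h := abs_rate_sub_le hs0 hs hv (y := x * (Real.cos x / Real.sin x)) (x := x)
    (K := 4 / (Real.pi ^ 2 * ρ * x)) (by positivity)
    ((abs_mul_cot_sub_one_le hx0 hxπ).trans (by nlinarith [sq_nonneg x]))
  have hcap : capProb (r / ρ) = Real.sin x ^ 2 := by
    rw [capProb, min_eq_left hrπ.le, hα, Real.cos_two_mul, Real.sin_sq]; ring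
  have e1 : 2 / Real.pi ^ 2 * Real.sin (r / ρ) / ρ * v / capProb (r / ρ) =
      4 / (Real.pi ^ 2 * ρ * x) * (x * (Real.cos x / Real.sin x) * v) := by
    rw [hcap, hα, Real.sin_two_mul]
    field_simp
    ring
  have e2 : departureRate r smin smax = 4 / (Real.pi ^ 2 * ρ * x) * ((smax + smin) / 2) := by
    unfold departureRate relSpeed
    rw [hrx]
    field_simp
    ring
  rw [e1, e2]
  exact h

/-- If the range exceeds the whole sphere there are no crossings, but the claimed error exceeds the
rate `L` itself. -/
theorem abs_zero_sub_le {δ η x L : ℝ} (hL : 0 ≤ L) (hδ : 1 ≤ δ) (hη : 0 ≤ η) (hx : 1 ≤ x) :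
    |0 - L| ≤ (δ * x ^ 2 + η) * L := by
  rw [zero_sub, abs_neg, abs_of_nonneg hL]
  have : 1 ≤ x ^ 2 := one_le_pow₀ hx
  have h2 : 1 ≤ δ * x ^ 2 + η := by nlinarith
  nlinarith

theorem one_le_of_pi_le (hρ : 0 < ρ) (h : Real.pi ≤ r / ρ) : 1 ≤ r / (2 * ρ) := by
  have e : r / (2 * ρ) = r / ρ / 2 := by field_simp
  rw [e]; linarith [Real.pi_gt_three]

theorem capProb_pos (hα : 0 < r) : 0 < capProb r := by
  have : Real.cos (min r Real.pi) < Real.cos 0 := Real.strictAntiOn_cos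
    ⟨le_rfl, Real.pi_pos.le⟩ ⟨(lt_min hα Real.pi_pos).le, min_le_right _ _⟩ (lt_min hα Real.pi_pos)
  rw [Real.cos_zero] at this
  unfold capProb; linarith

end

section
variable {M n : ℕ} {ρ r smin smax C a b : ℝ}

theorem arrivals_rate (hn : n ≤ M) (hρ : 0 < ρ) (hr : 0 < r) (hs0 : 0 < smin) (hs : smin ≤ smax)
    (hC : 8 ≤ C) (i : Fin M) (hab : a < b) :
    ∫⁻ ω, arrivals ρ r ω i a b ∂law M n smin smax ≠ ⊤ ∧
    |(∫⁻ ω, arrivals ρ r ω i a b ∂law M n smin smax).toReal / (b - a)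
        - arrivalRate M ρ r smin smax| ≤
      (C * (r / (2 * ρ)) ^ 2 + (smax - smin) / (smax + smin)) * arrivalRate M ρ r smin smax := by
  have hM : 1 ≤ M := Fin.pos i
  have hη : 0 ≤ (smax - smin) / (smax + smin) := div_nonneg (by linarith) (by linarith)
  have hrate := arrivalRate_nonneg (ρ := ρ) hM hr hs0 hs
  rcases lt_or_ge (r / ρ) Real.pi with hrπ | hrπ
  · obtain ⟨v, hv, he⟩ := exists_lintegral_arrivals_eq hn hρ hs0 hs hr hrπ hab i
    have hba : 0 < b - a := sub_pos.2 hab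
    have hM' : (0 : ℝ) ≤ M - 1 := sub_nonneg.2 (by exact_mod_cast hM)
    have hv0 : 0 ≤ v := hs0.le.trans hv.1
    have hsin : 0 ≤ Real.sin (r / ρ) :=
      Real.sin_nonneg_of_nonneg_of_le_pi (by positivity) hrπ.le
    rw [he, ENNReal.toReal_ofReal (by positivity)]
    refine ⟨ENNReal.ofReal_ne_top, ?_⟩
    have e : (M - 1) * (b - a) * (2 / Real.pi ^ 2 * Real.sin (r / ρ) / ρ) * v / (b - a) =
        (M - 1) * (2 / Real.pi ^ 2 * Real.sin (r / ρ) / ρ) * v := by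
      field_simp
    rw [e]
    refine (abs_arrival_sub_le hM hρ hr hs0 hs hrπ hv).trans ?_
    gcongr
  · simp only [arrivals_eq_zero hρ hrπ, lintegral_zero, ENNReal.toReal_zero, zero_div]
    exact ⟨ENNReal.zero_ne_top, abs_zero_sub_le hrate (by linarith) hη (one_le_of_pi_le hρ hrπ)⟩

theorem departures_rate (hn : n ≤ M) (hρ : 0 < ρ) (hr : 0 < r) (hs0 : 0 < smin) (hs : smin ≤ smax)
    (hC : 8 ≤ C) (i : Fin M) (hab : a < b) :
    ∫⁻ ω, departures ρ r ω i a b ∂law M n smin smax ≠ ⊤ ∧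
    ∫⁻ ω, contactTime ρ r ω i a b ∂law M n smin smax ≠ ⊤ ∧
    (2 ≤ M → ∫⁻ ω, contactTime ρ r ω i a b ∂law M n smin smax ≠ 0 ∧
      |(∫⁻ ω, departures ρ r ω i a b ∂law M n smin smax).toReal /
          (∫⁻ ω, contactTime ρ r ω i a b ∂law M n smin smax).toReal
          - departureRate r smin smax| ≤
        (C * (r / (2 * ρ)) ^ 2 + (smax - smin) / (smax + smin)) * departureRate r smin smax) := by
  have hη : 0 ≤ (smax - smin) / (smax + smin) := div_nonneg (by linarith) (by linarith)
  have hμ := (departureRate_pos hr hs0 hs).le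
  have hba : 0 < b - a := sub_pos.2 hab
  have hp := capProb_pos (div_pos hr hρ)
  rw [lintegral_contactTime hn hρ hs0 hs hr.le i]
  have hM' : 2 ≤ M → (0 : ℝ) < M - 1 := fun hM => by
    have : (2 : ℝ) ≤ M := by exact_mod_cast hM
    linarith
  rcases lt_or_ge (r / ρ) Real.pi with hrπ | hrπ
  · obtain ⟨v, hv, he⟩ := exists_lintegral_departures_eq hn hρ hs0 hs hr hrπ hab i
    have hv0 : 0 ≤ v := hs0.le.trans hv.1
    have hsin : 0 ≤ Real.sin (r / ρ) :=
      Real.sin_nonneg_of_nonneg_of_le_pi (by positivity) hrπ.le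
    rw [he]
    refine ⟨ENNReal.ofReal_ne_top, ENNReal.ofReal_ne_top, fun hM => ?_⟩
    have hM1 := hM' hM
    refine ⟨by rw [ne_eq, ENNReal.ofReal_eq_zero, not_le]; positivity, ?_⟩
    rw [ENNReal.toReal_ofReal (by positivity), ENNReal.toReal_ofReal (by positivity)]
    have e : (M - 1) * (b - a) * (2 / Real.pi ^ 2 * Real.sin (r / ρ) / ρ) * v /
        ((M - 1) * (b - a) * capProb (r / ρ)) =
        2 / Real.pi ^ 2 * Real.sin (r / ρ) / ρ * v / capProb (r / ρ) := by
      rw [mul_assoc ((M - 1) * (b - a)), mul_div_mul_left _ _ (by positivity)]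
    rw [e]
    refine (abs_departure_sub_le hρ hr hs0 hs hrπ hv).trans ?_
    gcongr
  · simp only [departures_eq_zero hρ hrπ, lintegral_zero, ENNReal.toReal_zero, zero_div]
    refine ⟨ENNReal.zero_ne_top, ENNReal.ofReal_ne_top, fun hM => ?_⟩
    have hM1 := hM' hM
    exact ⟨by rw [ne_eq, ENNReal.ofReal_eq_zero, not_le]; positivity,
      abs_zero_sub_le hμ (by linarith) hη (one_le_of_pi_le hρ hrπ)⟩

end

/-! ### Poisson approximation by Fourier inversion -/

theorem integral_cexp_int_mul (m : ℤ) :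
    ∫ θ in (-Real.pi)..Real.pi, Complex.exp (m * Complex.I * θ) =
      if m = 0 then (2 : ℂ) * Real.pi else 0 := by
  split_ifs with h
  · subst h
    simp
    ring
  · have hc : (m : ℂ) * Complex.I ≠ 0 := mul_ne_zero (by exact_mod_cast h) Complex.I_ne_zero
    rw [integral_exp_mul_complex hc, div_eq_zero_iff]
    left
    have := Complex.exp_periodic.int_mul m ((m : ℂ) * Complex.I * ((-Real.pi : ℝ) : ℂ))
    rw [← this, sub_eq_zero]
    congr 1
    push_cast
    ring

/-- A coefficient of a Fourier series is bounded by the mean of the modulus of its sum. -/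
theorem norm_coeff_le {h : ℕ → ℂ} (hh : Summable fun j => ‖h j‖) {f : ℝ → ℂ}
    (hf : ∀ θ : ℝ, HasSum (fun j => h j * Complex.exp (θ * Complex.I) ^ j) (f θ)) {g : ℝ → ℝ}
    (hg : Continuous g) (hfg : ∀ θ ∈ Icc (-Real.pi) Real.pi, ‖f θ‖ ≤ g θ) (k : ℕ) :
    2 * Real.pi * ‖h k‖ ≤ ∫ θ in (-Real.pi)..Real.pi, g θ := by
  have hπ : -Real.pi ≤ Real.pi := by linarith [Real.pi_pos]
  have hnorm : ∀ (m : ℤ) (θ : ℝ), ‖Complex.exp (m * Complex.I * θ)‖ = 1 := fun m θ => by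
    rw [show (m : ℂ) * Complex.I * θ = ((m * θ : ℝ) : ℂ) * Complex.I by push_cast; ring,
      Complex.norm_exp_ofReal_mul_I]
  have e : ∀ (j : ℕ) (θ : ℝ), h j * Complex.exp (θ * Complex.I) ^ j *
      Complex.exp (((-k : ℤ) : ℂ) * Complex.I * θ) =
      h j * Complex.exp (((j - k : ℤ) : ℂ) * Complex.I * θ) := fun j θ => by
    rw [← Complex.exp_nat_mul, mul_assoc, ← Complex.exp_add]
    congr 2
    push_cast
    ring
  have hs := intervalIntegral.hasSum_integral_of_dominated_convergence (μ := volume)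
    (a := -Real.pi) (b := Real.pi) (bound := fun j _ => ‖h j‖)
    (F := fun j θ => h j * Complex.exp (((j - k : ℤ) : ℂ) * Complex.I * θ))
    (f := fun θ => f θ * Complex.exp (((-k : ℤ) : ℂ) * Complex.I * θ))
    (fun j => Continuous.aestronglyMeasurable (by fun_prop))
    (fun j => Eventually.of_forall fun θ _ => by rw [norm_mul, hnorm, mul_one])
    (Eventually.of_forall fun _ _ => hh) intervalIntegrable_const
    (Eventually.of_forall fun θ _ => by
      have := (hf θ).mul_right (Complex.exp (((-k : ℤ) : ℂ) * Complex.I * θ))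
      simp only [e] at this
      exact this)
  simp only [intervalIntegral.integral_const_mul, integral_cexp_int_mul] at hs
  have h1 := hs.unique (hasSum_single k fun j hj => by
    rw [if_neg (by omega), mul_zero])
  rw [if_pos (sub_self _)] at h1
  have h2 : 2 * Real.pi * ‖h k‖ = ‖h k * (2 * Real.pi)‖ := by
    rw [norm_mul, norm_mul, Complex.norm_real, Complex.norm_ofNat, Real.norm_eq_abs,
      abs_of_pos Real.pi_pos]
    ring
  rw [h2, ← h1]
  refine intervalIntegral.norm_integral_le_of_norm_le hπ (Eventually.of_forall fun θ hθ => ?_)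
    (hg.intervalIntegrable _ _)
  rw [norm_mul, hnorm, mul_one]
  exact hfg θ (Ioc_subset_Icc_self hθ)

theorem norm_cexp_sub_cexp_le {a b : ℂ} {c : ℝ} (ha : a.re ≤ c) (hb : b.re ≤ c) :
    ‖Complex.exp a - Complex.exp b‖ ≤ ‖a - b‖ * Real.exp c := by
  rw [mul_comm]
  refine (convex_halfSpace_re_le c).norm_image_sub_le_of_norm_hasDerivWithin_le
    (fun x _ => (Complex.hasDerivAt_exp x).hasDerivWithinAt) (fun x hx => ?_) hb ha
  rw [Complex.norm_exp]
  exact Real.exp_le_exp.2 hx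

theorem norm_pow_sub_pow_le' {A B : ℂ} {D : ℝ} (hA : ‖A‖ ≤ D) (hB : ‖B‖ ≤ D) (m : ℕ) :
    ‖A ^ (m + 1) - B ^ (m + 1)‖ ≤ (m + 1) * ‖A - B‖ * D ^ m := by
  induction m with
  | zero => simp
  | succ m ih =>
    have hD : 0 ≤ D := (norm_nonneg _).trans hA
    have e : A ^ (m + 1 + 1) - B ^ (m + 1 + 1) =
        A * (A ^ (m + 1) - B ^ (m + 1)) + (A - B) * B ^ (m + 1) := by ring
    rw [e]
    refine (norm_add_le _ _).trans ?_
    rw [norm_mul, norm_mul, norm_pow]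
    have h1 : ‖A‖ * ‖A ^ (m + 1) - B ^ (m + 1)‖ ≤ D * ((m + 1) * ‖A - B‖ * D ^ m) :=
      mul_le_mul hA ih (norm_nonneg _) hD
    have h2 : ‖A - B‖ * ‖B‖ ^ (m + 1) ≤ ‖A - B‖ * D ^ (m + 1) :=
      mul_le_mul_of_nonneg_left (pow_le_pow_left₀ (norm_nonneg _) hB _) (norm_nonneg _)
    refine (add_le_add h1 h2).trans (le_of_eq ?_)
    push_cast
    ring

theorem mul_exp_neg_half_le (y : ℝ) : y * Real.exp (-(y / 2)) ≤ 1 := by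
  rw [Real.exp_neg, ← div_eq_mul_inv, div_le_one (Real.exp_pos _)]
  have h1 := Real.add_one_le_exp (y / 4)
  have h2 : Real.exp (y / 2) = Real.exp (y / 4) ^ 2 := by rw [← Real.exp_nat_mul]; congr 1; ring
  rw [h2]
  rcases le_or_gt 0 y with h | h
  · nlinarith [sq_nonneg (y / 4 - 1)]
  · nlinarith [sq_nonneg (Real.exp (y / 4))]

section
variable (θ : ℝ)

/-- The point `e ^ (i θ) - 1`. -/
noncomputable def chord : ℂ := Complex.exp (θ * Complex.I) - 1

theorem chord_re : (chord θ).re = -(1 - Real.cos θ) := by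
  simp [chord, Complex.exp_ofReal_mul_I_re]

theorem norm_chord_sq : ‖chord θ‖ ^ 2 = 2 * (1 - Real.cos θ) := by
  rw [← Complex.normSq_eq_norm_sq, Complex.normSq_apply, chord_re]
  have : (chord θ).im = Real.sin θ := by simp [chord, Complex.exp_ofReal_mul_I_im]
  rw [this]
  nlinarith [Real.sin_sq_add_cos_sq θ]

theorem norm_chord_le_two : ‖chord θ‖ ≤ 2 := by
  refine le_of_sq_le_sq ?_ zero_le_two
  rw [norm_chord_sq]
  linarith [Real.neg_one_le_cos θ]

theorem norm_chord_le_abs : ‖chord θ‖ ≤ |θ| := by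
  refine le_of_sq_le_sq ?_ (abs_nonneg θ)
  rw [norm_chord_sq, sq_abs]
  linarith [Real.one_sub_sq_div_two_le_cos (x := θ)]

variable {p : ℝ}

theorem norm_one_add_mul_chord_le (hp0 : 0 ≤ p) (hp : p ≤ 1 / 2) :
    ‖1 + p * chord θ‖ ≤ Real.exp (-(p * (1 - Real.cos θ) / 2)) := by
  have hu : 0 ≤ 1 - Real.cos θ := sub_nonneg.2 (Real.cos_le_one θ)
  refine le_of_sq_le_sq ?_ (Real.exp_pos _).le
  have h1 : ‖1 + p * chord θ‖ ^ 2 = 1 - 2 * p * (1 - p) * (1 - Real.cos θ) := by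
    have h2 := norm_chord_sq θ
    rw [← Complex.normSq_eq_norm_sq, Complex.normSq_apply] at h2 ⊢
    have h3 := chord_re θ
    simp only [Complex.add_re, Complex.one_re, Complex.re_ofReal_mul, Complex.add_im,
      Complex.one_im, Complex.im_ofReal_mul]
    rw [h3] at h2 ⊢
    linear_combination p ^ 2 * h2
  rw [h1, ← Real.exp_nat_mul]
  have h4 := Real.add_one_le_exp (((2 : ℕ) : ℝ) * -(p * (1 - Real.cos θ) / 2))
  refine le_trans ?_ h4
  push_cast
  nlinarith [mul_nonneg (mul_nonneg hp0 (sub_nonneg.2 hp)) hu]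

/-- The characteristic functions of the binomial distribution and of the Poisson distribution with
the same mean differ by a multiple of `p`, uniformly in the number of trials. -/
theorem norm_pow_sub_cexp_le (hp0 : 0 ≤ p) (hp : p ≤ 1 / 2) (m : ℕ) :
    ‖(1 + p * chord θ) ^ m - Complex.exp (m * p * chord θ)‖ ≤ 4 * p := by
  rcases m with _ | m
  · simp; linarith
  set u := 1 - Real.cos θ with hu'
  have hu : 0 ≤ u := sub_nonneg.2 (Real.cos_le_one θ)
  have hu2 : u ≤ 2 := by linarith [Real.neg_one_le_cos θ]
  have hB : ‖Complex.exp (p * chord θ)‖ ≤ Real.exp (-(p * u / 2)) := by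
    rw [Complex.norm_exp, Complex.re_ofReal_mul, chord_re]
    exact Real.exp_le_exp.2 (by nlinarith [mul_nonneg hp0 hu])
  have hn : ‖(p : ℂ) * chord θ‖ ≤ 1 := by
    rw [norm_mul, Complex.norm_real, Real.norm_eq_abs, abs_of_nonneg hp0]
    nlinarith [norm_chord_le_two θ, norm_nonneg (chord θ)]
  have hAB : ‖1 + p * chord θ - Complex.exp (p * chord θ)‖ ≤ 2 * p ^ 2 * u := by
    have := Complex.norm_exp_sub_one_sub_id_le hn
    rw [norm_sub_rev, ← sub_sub]
    refine this.trans (le_of_eq ?_)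
    rw [norm_mul, mul_pow, norm_chord_sq, Complex.norm_real, Real.norm_eq_abs, sq_abs]
    ring
  have e : Complex.exp ((m + 1 : ℕ) * p * chord θ) = Complex.exp (p * chord θ) ^ (m + 1) := by
    rw [← Complex.exp_nat_mul]; congr 1; ring
  rw [e]
  refine (norm_pow_sub_pow_le' (norm_one_add_mul_chord_le θ hp0 hp) hB m).trans ?_
  -- the factor `m` is absorbed by the exponential decay, as `y * exp (-y / 2) ≤ 1`
  set y := ((m : ℝ) + 1) * p * u with hy
  have hy0 : 0 ≤ y := by positivity
  have h1 : Real.exp (-(p * u / 2)) ^ m = Real.exp (-(y / 2)) * Real.exp (p * u / 2) := by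
    rw [← Real.exp_nat_mul, ← Real.exp_add]; congr 1; rw [hy]; ring
  have h2 : Real.exp (p * u / 2) ≤ 2 := by
    have : Real.exp (p * u / 2) ≤ Real.exp (1 / 2) := Real.exp_le_exp.2 (by nlinarith)
    have h3 : Real.exp (1 / 2) ^ 2 = Real.exp 1 := by rw [← Real.exp_nat_mul]; norm_num
    have h4 := Real.exp_one_lt_d9
    nlinarith [Real.exp_pos (1 / 2)]
  have h5 := mul_exp_neg_half_le y
  calc _ ≤ (m + 1) * (2 * p ^ 2 * u) * (Real.exp (-(y / 2)) * Real.exp (p * u / 2)) := by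
        rw [h1]; gcongr
    _ = 2 * p * (y * Real.exp (-(y / 2))) * Real.exp (p * u / 2) := by rw [hy]; ring
    _ ≤ 2 * p * 1 * 2 := by gcongr
    _ = 4 * p := by ring

theorem two_mul_sq_div_le_one_sub_cos (hθ : θ ∈ Icc (-Real.pi) Real.pi) :
    2 / Real.pi ^ 2 * θ ^ 2 ≤ 1 - Real.cos θ := by
  have := Real.cos_le_one_sub_mul_cos_sq (x := θ) (abs_le.2 hθ)
  linarith

/-- The effect on the characteristic function of a Poisson distribution of a change of its mean. -/
theorem norm_cexp_mul_chord_sub_le {x : ℝ} (m : ℕ) (hp : x ^ 2 / 2 ≤ p)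
    (hpx : p ≤ x ^ 2) (hpx' : x ^ 2 - p ≤ 2 * x ^ 4) (hθ : θ ∈ Icc (-Real.pi) Real.pi) :
    ‖Complex.exp (m * p * chord θ) - Complex.exp (m * (x ^ 2 : ℝ) * chord θ)‖ ≤
      2 * x ^ 2 * (m * x ^ 2 * (|θ| * Real.exp (-(m * x ^ 2 / Real.pi ^ 2 * θ ^ 2)))) := by
  have hu := two_mul_sq_div_le_one_sub_cos θ hθ
  have key : ∀ y : ℝ, x ^ 2 / 2 ≤ y →
      (m * (y : ℂ) * chord θ).re ≤ -(m * x ^ 2 / Real.pi ^ 2 * θ ^ 2) := by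
    intro y hy
    rw [show (m : ℂ) * (y : ℂ) * chord θ = ((m * y : ℝ) : ℂ) * chord θ by push_cast; ring,
      Complex.re_ofReal_mul, chord_re, mul_neg, neg_le_neg_iff]
    have h1 : 0 ≤ 2 / Real.pi ^ 2 * θ ^ 2 := by positivity
    have hy0 : 0 ≤ y := (by positivity : 0 ≤ x ^ 2 / 2).trans hy
    calc m * x ^ 2 / Real.pi ^ 2 * θ ^ 2 = m * (x ^ 2 / 2) * (2 / Real.pi ^ 2 * θ ^ 2) := by ring
      _ ≤ m * y * (1 - Real.cos θ) := by gcongr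
  refine (norm_cexp_sub_cexp_le (key p hp) (key (x ^ 2) (by nlinarith [sq_nonneg x]))).trans ?_
  have e : (m : ℂ) * p * chord θ - m * (x ^ 2 : ℝ) * chord θ =
      ((-(m * (x ^ 2 - p)) : ℝ) : ℂ) * chord θ := by push_cast; ring
  rw [e, norm_mul, Complex.norm_real, Real.norm_eq_abs, abs_neg,
    abs_of_nonneg (mul_nonneg (Nat.cast_nonneg _) (sub_nonneg.2 hpx))]
  calc _ ≤ m * (2 * x ^ 4) * |θ| * Real.exp (-(m * x ^ 2 / Real.pi ^ 2 * θ ^ 2)) := by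
        gcongr; exact norm_chord_le_abs θ
    _ = _ := by ring

/-- A change by at most one in the number of trials changes the mean by at most `x ^ 2`. -/
theorem norm_cexp_mul_chord_sub_le_of_abs_sub_le_one {x m c : ℝ} (hm : 0 ≤ m) (hc : 0 ≤ c)
    (hmc : |m - c| ≤ 1) :
    ‖Complex.exp (m * (x ^ 2 : ℝ) * chord θ) - Complex.exp (((c * x ^ 2 : ℝ) : ℂ) * chord θ)‖ ≤
      2 * x ^ 2 := by
  have hu : 0 ≤ 1 - Real.cos θ := sub_nonneg.2 (Real.cos_le_one θ)
  have key : ∀ y : ℝ, 0 ≤ y → (((y * x ^ 2 : ℝ) : ℂ) * chord θ).re ≤ 0 := fun y hy => by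
    rw [Complex.re_ofReal_mul, chord_re]
    nlinarith [mul_nonneg (mul_nonneg hy (sq_nonneg x)) hu]
  have e0 : (m : ℂ) * (x ^ 2 : ℝ) * chord θ = ((m * x ^ 2 : ℝ) : ℂ) * chord θ := by
    push_cast; ring
  rw [e0]
  refine (norm_cexp_sub_cexp_le (key m hm) (key c hc)).trans ?_
  have e : ((m * x ^ 2 : ℝ) : ℂ) * chord θ - ((c * x ^ 2 : ℝ) : ℂ) * chord θ =
      (((m - c) * x ^ 2 : ℝ) : ℂ) * chord θ := by push_cast; ring
  rw [e, Real.exp_zero, mul_one, norm_mul, Complex.norm_real, Real.norm_eq_abs, abs_mul,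
    abs_of_nonneg (sq_nonneg x)]
  calc _ ≤ 1 * x ^ 2 * 2 := by gcongr; exact norm_chord_le_two θ
    _ = _ := by ring

end

/-- The bound of `norm_cexp_mul_chord_sub_le` is not small for each `θ`, uniformly in the number of
trials, but its integral is. -/
theorem integral_abs_mul_exp_le (K : ℝ) :
    ∫ θ in (-Real.pi)..Real.pi, K * (|θ| * Real.exp (-(K / Real.pi ^ 2 * θ ^ 2))) ≤
      Real.pi ^ 2 := by
  have hπ := Real.pi_pos
  have hcont : Continuous fun θ : ℝ => K * (|θ| * Real.exp (-(K / Real.pi ^ 2 * θ ^ 2))) := by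
    fun_prop
  have hderiv : ∀ θ : ℝ, HasDerivAt (fun θ => -(Real.pi ^ 2 / 2) *
      Real.exp (-(K / Real.pi ^ 2 * θ ^ 2)))
      (K * (θ * Real.exp (-(K / Real.pi ^ 2 * θ ^ 2)))) θ := fun θ => by
    have h1 : HasDerivAt (fun θ : ℝ => -(K / Real.pi ^ 2 * θ ^ 2))
        (-(K / Real.pi ^ 2 * (2 * θ))) θ := by
      have := ((hasDerivAt_pow 2 θ).const_mul (K / Real.pi ^ 2)).fun_neg
      simpa using this
    exact (h1.exp.const_mul (-(Real.pi ^ 2 / 2))).congr_deriv (by field_simp)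
  have hc2 : Continuous fun θ : ℝ => K * (θ * Real.exp (-(K / Real.pi ^ 2 * θ ^ 2))) := by
    fun_prop
  have hright : ∫ θ in (0 : ℝ)..Real.pi, K * (|θ| * Real.exp (-(K / Real.pi ^ 2 * θ ^ 2))) ≤
      Real.pi ^ 2 / 2 := by
    have e : ∫ θ in (0 : ℝ)..Real.pi, K * (|θ| * Real.exp (-(K / Real.pi ^ 2 * θ ^ 2))) =
        ∫ θ in (0 : ℝ)..Real.pi, K * (θ * Real.exp (-(K / Real.pi ^ 2 * θ ^ 2))) :=
      intervalIntegral.integral_congr fun θ hθ => by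
        rw [uIcc_of_le hπ.le] at hθ
        simp only [abs_of_nonneg hθ.1]
    rw [e, intervalIntegral.integral_eq_sub_of_hasDerivAt (fun θ _ => hderiv θ)
      (hc2.intervalIntegrable _ _)]
    simp only [ne_eq, OfNat.ofNat_ne_zero, not_false_eq_true, zero_pow, mul_zero, neg_zero,
      Real.exp_zero, mul_one]
    have := Real.exp_pos (-(K / Real.pi ^ 2 * Real.pi ^ 2))
    nlinarith [sq_pos_of_pos hπ]
  have hleft : ∫ θ in (-Real.pi)..0, K * (|θ| * Real.exp (-(K / Real.pi ^ 2 * θ ^ 2))) ≤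
      Real.pi ^ 2 / 2 := by
    have := intervalIntegral.integral_comp_neg (a := 0) (b := Real.pi)
      (fun θ : ℝ => K * (|θ| * Real.exp (-(K / Real.pi ^ 2 * θ ^ 2))))
    simp only [abs_neg, even_two, Even.neg_pow, neg_zero] at this
    rw [← this]
    exact hright
  rw [← intervalIntegral.integral_add_adjacent_intervals (hcont.intervalIntegrable _ 0)
    (hcont.intervalIntegrable 0 _)]
  linarith

/-! ### The distribution of the number of caching devices in range -/

/-- The waypoints of each device other than `i` are turned by a rotation of their own. -/
noncomputable def turnOthers {M : ℕ} (i : Fin M) (R : Fin M → Rot) : Fin M × ℕ → Rot :=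
  fun j => if j.1 = i then 1 else R j.1

section
variable {M n : ℕ} {ρ smin smax r : ℝ} {i : Fin M}

theorem measurable_turnOthers (i : Fin M) (j : Fin M × ℕ) :
    Measurable fun R => turnOthers i R j := by
  unfold turnOthers
  split_ifs
  · exact measurable_const
  · exact measurable_pi_apply _

theorem itinerary_turnOthers_self (R : Fin M → Rot) (ω : Fin M × ℕ → UnitSphere × ℝ) :
    itinerary (turn (turnOthers i R) ω) i = itinerary ω i := by
  funext l
  simp [itinerary, turn, turnOthers, onSphere_one]

theorem itinerary_turnOthers_of_ne (R : Fin M → Rot) (ω : Fin M × ℕ → UnitSphere × ℝ) {k : Fin M}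
    (hk : k ≠ i) :
    itinerary (turn (turnOthers i R) ω) k = turnItinerary (R k) (itinerary ω k) := by
  funext l
  simp [itinerary, turn, turnOthers, turnItinerary, hk]

open Classical in
theorem pow_cachingCount (z : ℂ) (ω : Outcome M) (t : ℝ) :
    z ^ cachingCount ρ r ω i t =
      ∏ k, if k ∈ ω.2.erase i ∧ InRange ρ r ω i k t then z else 1 := by
  have : neighbours ρ r ω i t ∩ ω.2 =
      (Finset.univ.filter fun k => k ∈ ω.2.erase i ∧ InRange ρ r ω i k t : Finset (Fin M)) := by
    ext k
    simp only [neighbours, mem_inter_iff, mem_ofPred_eq, Finset.coe_filter, Finset.mem_univ,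
      true_and, Finset.mem_erase, SetLike.mem_coe]
    tauto
  rw [cachingCount, this, ncard_coe_finset, Finset.prod_ite, Finset.prod_const, Finset.prod_const_one,
    mul_one]

open Classical in
theorem measurable_pow_cachingCount (z : ℂ) (t : ℝ) :
    Measurable fun ω : Outcome M => z ^ cachingCount ρ r ω i t := by
  simp only [pow_cachingCount]
  refine Finset.measurable_prod _ fun k _ => Measurable.ite ?_ measurable_const measurable_const
  refine MeasurableSet.inter ?_ (measurableSet_inRange (ω := fun ω => ω) measurable_id measurable_const)
  exact measurable_snd (MeasurableSet.of_discrete (s := {S : Finset (Fin M) | k ∈ S.erase i}))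

theorem cachingCount_le (ω : Outcome M) (t : ℝ) : cachingCount ρ r ω i t ≤ M := by
  refine (ncard_le_card _).trans ?_
  simp

theorem norm_pow_cachingCount_le {z : ℂ} (hz : ‖z‖ = 1) (ω : Outcome M) (t : ℝ) :
    ‖z ^ cachingCount ρ r ω i t‖ ≤ 1 := by
  rw [norm_pow, hz, one_pow]

theorem integral_haar_geoDist {u v : Space} (hu : ‖u‖ = 1) (hv : ‖v‖ = 1) (hρ : 0 < ρ)
    (hr : 0 ≤ r) (z : ℂ) [∀ R : Rot, Decidable (geoDist ρ u (R.1 v) ≤ r)] :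
    ∫ R : Rot, (if geoDist ρ u (R.1 v) ≤ r then z else 1) ∂(Rot.haar) =
      1 + capProb (r / ρ) * (z - 1) := by
  have hm : MeasurableSet {R : Rot | geoDist ρ u (R.1 v) ≤ r} :=
    measurableSet_le (measurable_geoDist (by fun_prop) (by fun_prop)) measurable_const
  have e : ∀ R : Rot, (if geoDist ρ u (R.1 v) ≤ r then z else 1) =
      1 + {R : Rot | geoDist ρ u (R.1 v) ≤ r}.indicator (fun _ => z - 1) R := fun R => by
    classical
    rw [indicator_apply]
    simp only [mem_ofPred_eq]
    split_ifs <;> ring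
  simp only [e]
  rw [integral_add (integrable_const _) ((integrable_const _).indicator hm),
    integral_indicator_const _ hm, measureReal_def, haar_geoDist_le hu hv hρ hr,
    ENNReal.toReal_ofReal (capProb_nonneg _)]
  simp

/-- Given the set of caching devices, the number of those in range is binomially distributed. -/
theorem integral_pow_cachingCount (hρ : 0 < ρ) (hs0 : 0 < smin) (hs : smin ≤ smax) (hr : 0 ≤ r)
    {z : ℂ} (hz : ‖z‖ = 1) (S : Finset (Fin M)) (t : ℝ) :
    ∫ ω, z ^ cachingCount ρ r (ω, S) i t ∂movement M smin smax =
      (1 + capProb (r / ρ) * (z - 1)) ^ (S.erase i).card := by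
  classical
  rw [integral_turn (Measure.pi fun _ : Fin M => Rot.haar) (measurable_turnOthers i)
    (F := fun ω => z ^ cachingCount ρ r (ω, S) i t)
    ((measurable_pow_cachingCount z t).comp (measurable_id.prodMk measurable_const))
    (fun ω => norm_pow_cachingCount_le hz (ω, S) t)]
  have : ∀ᵐ ω ∂movement M smin smax,
      ∫ R, z ^ cachingCount ρ r (turn (turnOthers i R) ω, S) i t ∂Measure.pi (fun _ : Fin M => Rot.haar)
        = (1 + capProb (r / ρ) * (z - 1)) ^ (S.erase i).card := by
    filter_upwards [ae_regular hρ hs0 hs] with ω hω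
    have e : ∀ (R : Fin M → Rot) (k : Fin M),
        (if k ∈ S.erase i ∧ InRange ρ r (turn (turnOthers i R) ω, S) i k t then z else 1) =
        if k ∈ S.erase i then (if geoDist ρ (position ρ (itinerary ω i) t)
          ((R k).1 (position ρ (itinerary ω k) t)) ≤ r then z else 1) else 1 := by
      intro R k
      by_cases hk : k ∈ S.erase i
      · have h1 : InRange ρ r (turn (turnOthers i R) ω, S) i k t ↔
            geoDist ρ (position ρ (itinerary ω i) t)
              ((R k).1 (position ρ (itinerary ω k) t)) ≤ r := by
          rw [← position_turn, ← itinerary_turnOthers_of_ne R ω (Finset.ne_of_mem_erase hk),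
            ← itinerary_turnOthers_self (i := i) R ω]
          rfl
        simp only [hk, h1, true_and, if_true]
      · simp only [hk, false_and, if_false]
    simp only [pow_cachingCount, e]
    rw [integral_fintype_prod_eq_prod (fun (k : Fin M) (R : Rot) => if k ∈ S.erase i then
      (if geoDist ρ (position ρ (itinerary ω i) t) (R.1 (position ρ (itinerary ω k) t)) ≤ r
        then z else 1) else (1 : ℂ))]
    have h2 : ∀ k, (∫ R : Rot, if k ∈ S.erase i then
        (if geoDist ρ (position ρ (itinerary ω i) t) (R.1 (position ρ (itinerary ω k) t)) ≤ r
        then z else 1) else (1 : ℂ) ∂(Rot.haar)) =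
        if k ∈ S.erase i then 1 + capProb (r / ρ) * (z - 1) else 1 := fun k => by
      by_cases hk : k ∈ S.erase i
      · simp only [hk, if_true]
        exact integral_haar_geoDist ((hω i).norm_position t) ((hω k).norm_position t) hρ hr z
      · simp only [hk, if_false, integral_const, probReal_univ, one_smul]
    simp only [h2]
    rw [Finset.prod_ite_mem, Finset.univ_inter, Finset.prod_const]
  rw [integral_congr_ae this]
  simp

theorem isProbabilityMeasure_law (hn : n ≤ M) : IsProbabilityMeasure (law M n smin smax) := by
  have := isProbabilityMeasure_uniformOn_card hn
  exact inferInstanceAs (IsProbabilityMeasure ((movement M smin smax).prod _))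

/-- The generating function of the number of caching devices in range is a mixture of binomial
ones. -/
theorem norm_integral_pow_cachingCount_sub_le (hn : n ≤ M) (hρ : 0 < ρ) (hs0 : 0 < smin)
    (hs : smin ≤ smax) (hr : 0 ≤ r) {z : ℂ} (hz : ‖z‖ = 1) (t : ℝ) (y : ℂ) {B : ℝ}
    (hB : ∀ S : Finset (Fin M), S.card = n →
      ‖(1 + capProb (r / ρ) * (z - 1)) ^ (S.erase i).card - y‖ ≤ B) :
    ‖∫ ω, z ^ cachingCount ρ r ω i t ∂law M n smin smax - y‖ ≤ B := by
  have := isProbabilityMeasure_uniformOn_card hn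
  have hl := isProbabilityMeasure_law (smin := smin) (smax := smax) hn
  have hint : Integrable (fun ω : Outcome M => z ^ cachingCount ρ r ω i t) (law M n smin smax) :=
    Integrable.of_bound (measurable_pow_cachingCount z t).aestronglyMeasurable 1
      (Eventually.of_forall fun ω => norm_pow_cachingCount_le hz ω t)
  have e : ∫ ω, z ^ cachingCount ρ r ω i t ∂law M n smin smax =
      ∫ S, (1 + capProb (r / ρ) * (z - 1)) ^ (Finset.erase S i).card
        ∂ProbabilityTheory.uniformOn {S : Finset (Fin M) | S.card = n} := by
    refine (integral_prod_symm (μ := movement M smin smax) _ hint).trans ?_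
    exact integral_congr_ae (Eventually.of_forall fun S =>
      integral_pow_cachingCount hρ hs0 hs hr hz S t)
  have e2 : y = ∫ _, y ∂ProbabilityTheory.uniformOn {S : Finset (Fin M) | S.card = n} := by simp
  rw [e]
  nth_rewrite 1 [e2]
  rw [← integral_sub Integrable.of_finite (integrable_const y)]
  refine (norm_integral_le_of_norm_le_const (C := B) ?_).trans (by simp)
  filter_upwards [ProbabilityTheory.ae_cond_mem (μ := Measure.count)
    (MeasurableSet.of_discrete (s := {S : Finset (Fin M) | S.card = n}))] with S hS
  exact hB S hS

theorem measurableSet_cachingCount_eq (t : ℝ) (j : ℕ) :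
    MeasurableSet {ω : Outcome M | cachingCount ρ r ω i t = j} := by
  have hm := measurable_pow_cachingCount (ρ := ρ) (r := r) (i := i) 2 t
  have : {ω : Outcome M | cachingCount ρ r ω i t = j} =
      (fun ω : Outcome M => (2 : ℂ) ^ cachingCount ρ r ω i t) ⁻¹' {2 ^ j} := by
    ext ω
    simp only [mem_ofPred_eq, mem_preimage, mem_singleton_iff]
    constructor
    · intro h; rw [h]
    · intro h
      have h2 : (2 : ℕ) ^ cachingCount ρ r ω i t = 2 ^ j := by exact_mod_cast h
      exact Nat.pow_right_injective le_rfl h2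
  rw [this]
  exact hm (measurableSet_singleton _)

theorem sum_real_cachingCount (hn : n ≤ M) (z : ℂ) (t : ℝ) :
    ∑ j ∈ Finset.range (M + 1),
      ((law M n smin smax).real {ω | cachingCount ρ r ω i t = j} : ℂ) * z ^ j =
      ∫ ω, z ^ cachingCount ρ r ω i t ∂law M n smin smax := by
  have hl := isProbabilityMeasure_law (smin := smin) (smax := smax) hn
  have e : ∀ ω : Outcome M, z ^ cachingCount ρ r ω i t = ∑ j ∈ Finset.range (M + 1),
      {ω : Outcome M | cachingCount ρ r ω i t = j}.indicator (fun _ => z ^ j) ω := fun ω => by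
    classical
    simp only [indicator_apply, mem_ofPred_eq]
    rw [Finset.sum_ite_eq, if_pos (Finset.mem_range_succ_iff.2 (cachingCount_le ω t))]
  simp only [e]
  rw [integral_finsetSum _ fun j _ =>
    (integrable_const (z ^ j)).indicator (measurableSet_cachingCount_eq t j)]
  refine Finset.sum_congr rfl fun j _ => ?_
  rw [integral_indicator_const _ (measurableSet_cachingCount_eq t j), Complex.real_smul]

theorem hasSum_real_cachingCount (hn : n ≤ M) (z : ℂ) (t : ℝ) :
    HasSum (fun j => ((law M n smin smax).real {ω | cachingCount ρ r ω i t = j} : ℂ) * z ^ j)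
      (∫ ω, z ^ cachingCount ρ r ω i t ∂law M n smin smax) := by
  rw [← sum_real_cachingCount hn]
  refine hasSum_sum_of_ne_finset_zero fun j hj => ?_
  have : {ω : Outcome M | cachingCount ρ r ω i t = j} = ∅ := by
    ext ω
    simp only [mem_ofPred_eq, mem_empty_iff_false, iff_false]
    have := cachingCount_le (ρ := ρ) (r := r) (i := i) ω t
    rw [Finset.mem_range] at hj
    omega
  rw [this]
  simp

theorem hasSum_poisson (a : ℝ) (z : ℂ) :
    HasSum (fun j : ℕ => ((a ^ j / (j.factorial : ℝ) * Real.exp (-a) : ℝ) : ℂ) * z ^ j)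
      (Complex.exp (a * (z - 1))) := by
  have h := (NormedSpace.expSeries_div_hasSum_exp (a * z : ℂ)).mul_right (Complex.exp (-a))
  rw [← Complex.exp_eq_exp_ℂ, ← Complex.exp_add] at h
  rw [show (a : ℂ) * (z - 1) = a * z + -a by ring]
  have e : (fun j : ℕ => ((a ^ j / (j.factorial : ℝ) * Real.exp (-a) : ℝ) : ℂ) * z ^ j) =
      fun j : ℕ => (a * z : ℂ) ^ j / j.factorial * Complex.exp (-a) := by
    funext j
    push_cast
    ring
  rw [e]
  exact h

/-- The number of caching devices other than `i` is `n` or `n - 1`; the factor `M - 1` in the mean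
corresponds to its expectation. -/
theorem card_erase_sub_le (hn : n ≤ M) {S : Finset (Fin M)} (hS : S.card = n) :
    ((S.erase i).card = n ∨ (S.erase i).card = n - 1) ∧
      |((S.erase i).card : ℝ) - (M - 1) * (n / M)| ≤ 1 := by
  have hM : (0 : ℝ) < M := by exact_mod_cast Fin.pos i
  have hnM : (n : ℝ) / M ≤ 1 := (div_le_one hM).2 (by exact_mod_cast hn)
  have hnM0 : (0 : ℝ) ≤ n / M := by positivity
  have e : ((M : ℝ) - 1) * (n / M) = n - n / M := by field_simp
  rw [e]
  by_cases hi : i ∈ S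
  · have hpos := Finset.card_pos.2 ⟨i, hi⟩
    have h : (S.erase i).card = n - 1 := by rw [Finset.card_erase_of_mem hi, hS]
    refine ⟨Or.inr h, ?_⟩
    rw [h, Nat.cast_pred (hS ▸ hpos), abs_le]
    constructor <;> linarith
  · have h : (S.erase i).card = n := by rw [Finset.erase_eq_of_notMem hi, hS]
    refine ⟨Or.inl h, ?_⟩
    rw [h, abs_le]
    constructor <;> linarith

theorem capProb_bounds {x : ℝ} (hx : 0 < x) (hx2 : x ^ 2 ≤ 1 / 2) :
    x ^ 2 / 2 ≤ capProb (2 * x) ∧ capProb (2 * x) ≤ x ^ 2 ∧ x ^ 2 - capProb (2 * x) ≤ 2 * x ^ 4 := by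
  have hx1 : x ≤ 1 := by nlinarith
  have e : capProb (2 * x) = Real.sin x ^ 2 := by
    rw [capProb, min_eq_left (by linarith [Real.pi_gt_three]), Real.cos_two_mul, Real.sin_sq]; ring
  have h1 : x - x ^ 3 / 4 < Real.sin x := by
    linarith [Real.sin_gt_sub_cube hx, pow_pos hx 3]
  have h2 := Real.sin_le hx.le
  have h3 : 0 ≤ x - x ^ 3 / 4 := by nlinarith
  have h4 : (x - x ^ 3 / 4) ^ 2 ≤ Real.sin x ^ 2 := by gcongr
  have h5 : Real.sin x ^ 2 ≤ x ^ 2 := by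
    have : 0 ≤ Real.sin x := h3.trans h1.le
    gcongr
  have h6 : (x - x ^ 3 / 4) ^ 2 = x ^ 2 - x ^ 4 / 2 + x ^ 6 / 16 := by ring
  have h7 : 0 ≤ x ^ 6 := by positivity
  have h8 : x ^ 4 ≤ x ^ 2 / 2 := by nlinarith [sq_nonneg x]
  rw [e]
  refine ⟨?_, h5, ?_⟩ <;> nlinarith [sq_nonneg x]

theorem q_eq (hρ : 0 < ρ) (hr : 0 < r) (hs0 : 0 < smin) (hs : smin ≤ smax) (j : ℕ) :
    q M n ρ r smin smax j = ((M - 1) * (n / M) * (r / (2 * ρ)) ^ 2) ^ j / (j.factorial : ℝ) *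
      Real.exp (-((M - 1) * (n / M) * (r / (2 * ρ)) ^ 2)) := by
  have h : arrivalRate M ρ r smin smax / departureRate r smin smax * ((n : ℝ) / M) =
      (M - 1) * (n / M) * (r / (2 * ρ)) ^ 2 := by
    have h2 : smax + smin ≠ 0 := by linarith
    unfold arrivalRate departureRate relSpeed
    have := Real.pi_ne_zero
    field_simp
    ring
  unfold q
  rw [h]

theorem q_mem_Icc (hM : 1 ≤ M) (hρ : 0 < ρ) (hr : 0 < r) (hs0 : 0 < smin) (hs : smin ≤ smax)
    (j : ℕ) : q M n ρ r smin smax j ∈ Icc (0 : ℝ) 1 := by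
  have hM' : (0 : ℝ) ≤ M - 1 := sub_nonneg.2 (by exact_mod_cast hM)
  have ha : 0 ≤ (M - 1) * ((n : ℝ) / M) * (r / (2 * ρ)) ^ 2 := by positivity
  rw [q_eq hρ hr hs0 hs, Real.exp_neg, ← div_eq_mul_inv]
  refine ⟨by positivity, (div_le_one (Real.exp_pos _)).2 (Real.pow_div_factorial_le_exp _ ha j)⟩

theorem integral_const_add_mul_add_mul {f g : ℝ → ℝ} (hf : Continuous f) (hg : Continuous g)
    (K A B : ℝ) : ∫ θ in (-Real.pi)..Real.pi, (K + (A * f θ + B * g θ)) =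
      2 * Real.pi * K + (A * (∫ θ in (-Real.pi)..Real.pi, f θ) +
        B * ∫ θ in (-Real.pi)..Real.pi, g θ) := by
  rw [intervalIntegral.integral_add intervalIntegrable_const
    (Continuous.intervalIntegrable (by fun_prop) _ _),
    intervalIntegral.integral_add (Continuous.intervalIntegrable (by fun_prop) _ _)
    (Continuous.intervalIntegrable (by fun_prop) _ _), intervalIntegral.integral_const_mul,
    intervalIntegral.integral_const_mul, intervalIntegral.integral_const, smul_eq_mul]
  ring

/-- For `x = r / (2 * ρ)` the binomial characteristic function is compared with the Poisson one of
mean `m * p`, that with the one of mean `m * x ^ 2`, and that with the one of mean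
`(M - 1) * (n / M) * x ^ 2`, where `m` is `n` or `n - 1`. If `x ^ 2 > 1 / 2` the right-hand side
exceeds `1`. -/
theorem abs_real_cachingCount_sub_le (hn : n ≤ M) (hρ : 0 < ρ) (hr : 0 < r) (hs0 : 0 < smin)
    (hs : smin ≤ smax) (i : Fin M) (t : ℝ) (k : ℕ) :
    |(law M n smin smax).real {ω | cachingCount ρ r ω i t = k} - q M n ρ r smin smax k| ≤
      14 * (r / (2 * ρ)) ^ 2 := by
  have hl := isProbabilityMeasure_law (smin := smin) (smax := smax) hn
  have hM : 1 ≤ M := Fin.pos i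
  set x := r / (2 * ρ) with hx
  have hx0 : 0 < x := by positivity
  rcases lt_or_ge (1 / 2) (x ^ 2) with hx2 | hx2
  · obtain ⟨h1, h2⟩ := q_mem_Icc (n := n) hM hρ hr hs0 hs k
    have h3 : (law M n smin smax).real {ω | cachingCount ρ r ω i t = k} ≤ 1 := measureReal_le_one
    have h4 : 0 ≤ (law M n smin smax).real {ω | cachingCount ρ r ω i t = k} := measureReal_nonneg
    rw [abs_le]
    constructor <;> linarith
  · have hα : r / ρ = 2 * x := by rw [hx]; field_simp
    obtain ⟨hp1, hp2, hp3⟩ := capProb_bounds hx0 hx2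
    set p := capProb (2 * x)
    set c : ℝ := (M - 1) * (n / M) with hc
    have hc0 : 0 ≤ c := by
      have hM' : (0 : ℝ) ≤ M - 1 := sub_nonneg.2 (by exact_mod_cast hM)
      positivity
    set G : ℕ → ℝ → ℝ := fun m θ =>
      m * x ^ 2 * (|θ| * Real.exp (-(m * x ^ 2 / Real.pi ^ 2 * θ ^ 2))) with hG
    have hG0 : ∀ m θ, 0 ≤ G m θ := fun m θ => by positivity
    have hGc : ∀ m, Continuous (G m) := fun m => by fun_prop
    have hqs := fun z => hasSum_poisson (c * x ^ 2) z
    have hps := fun z => hasSum_real_cachingCount (ρ := ρ) (r := r) (smin := smin) (smax := smax)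
      (i := i) hn z t
    have hsub : ∀ z, HasSum (fun j => (((law M n smin smax).real
        {ω | cachingCount ρ r ω i t = j} - q M n ρ r smin smax j : ℝ) : ℂ) * z ^ j)
        (∫ ω, z ^ cachingCount ρ r ω i t ∂law M n smin smax -
          Complex.exp ((c * x ^ 2 : ℝ) * (z - 1))) := fun z => by
      have e : ∀ j, (((law M n smin smax).real {ω | cachingCount ρ r ω i t = j} -
          q M n ρ r smin smax j : ℝ) : ℂ) * z ^ j =
          ((law M n smin smax).real {ω | cachingCount ρ r ω i t = j} : ℂ) * z ^ j -
          (((c * x ^ 2) ^ j / (j.factorial : ℝ) * Real.exp (-(c * x ^ 2)) : ℝ) : ℂ) * z ^ j :=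
        fun j => by
          rw [q_eq hρ hr hs0 hs, Complex.ofReal_sub, sub_mul]
      simp only [e]
      exact (hps z).sub (hqs z)
    have hsum : Summable fun j => ‖(((law M n smin smax).real
        {ω | cachingCount ρ r ω i t = j} - q M n ρ r smin smax j : ℝ) : ℂ)‖ := by
      have := (hsub 1).summable.norm
      simpa only [one_pow, mul_one] using this
    have hmain := norm_coeff_le hsum (fun θ => hsub (Complex.exp (θ * Complex.I)))
      (g := fun θ => (4 * p + 2 * x ^ 2) + (2 * x ^ 2 * G n θ + 2 * x ^ 2 * G (n - 1) θ))
      (by fun_prop) (fun θ hθ => ?_) k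
    · have hI : ∫ θ in (-Real.pi)..Real.pi,
          ((4 * p + 2 * x ^ 2) + (2 * x ^ 2 * G n θ + 2 * x ^ 2 * G (n - 1) θ)) =
          2 * Real.pi * (4 * p + 2 * x ^ 2) + (2 * x ^ 2 * (∫ θ in (-Real.pi)..Real.pi, G n θ) +
            2 * x ^ 2 * ∫ θ in (-Real.pi)..Real.pi, G (n - 1) θ) :=
        integral_const_add_mul_add_mul (hGc n) (hGc (n - 1)) _ _ _
      rw [hI, Complex.norm_real, Real.norm_eq_abs] at hmain
      have h1 : ∫ θ in (-Real.pi)..Real.pi, G n θ ≤ Real.pi ^ 2 := integral_abs_mul_exp_le _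
      have h2 : ∫ θ in (-Real.pi)..Real.pi, G (n - 1) θ ≤ Real.pi ^ 2 := integral_abs_mul_exp_le _
      have hx2' : 0 ≤ 2 * x ^ 2 := by positivity
      have h3 := mul_le_mul_of_nonneg_left h1 hx2'
      have h4 := mul_le_mul_of_nonneg_left h2 hx2'
      have hπ := Real.pi_pos
      have hπ4 := Real.pi_le_four
      have h5 : 2 * Real.pi * |(law M n smin smax).real {ω | cachingCount ρ r ω i t = k} -
          q M n ρ r smin smax k| ≤ 2 * Real.pi * (14 * x ^ 2) := by
        have h6 : x ^ 2 * Real.pi ^ 2 ≤ x ^ 2 * Real.pi * 4 := by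
          rw [pow_two Real.pi, ← mul_assoc]
          exact mul_le_mul_of_nonneg_left hπ4 (by positivity)
        have h7 : Real.pi * p ≤ Real.pi * x ^ 2 := mul_le_mul_of_nonneg_left hp2 hπ.le
        refine hmain.trans ?_
        linarith
      exact le_of_mul_le_mul_left h5 (by positivity)
    · refine norm_integral_pow_cachingCount_sub_le hn hρ hs0 hs hr.le
        (Complex.norm_exp_ofReal_mul_I θ) t _ fun S hS => ?_
      obtain ⟨hm, hmc⟩ := card_erase_sub_le (i := i) hn hS
      set m := (S.erase i).card
      rw [hα]
      have h1 := norm_pow_sub_cexp_le θ (p := p) (le_trans (by positivity) hp1) (hp2.trans hx2) m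
      have h2 := norm_cexp_mul_chord_sub_le θ m hp1 hp2 hp3 hθ
      have h3 := norm_cexp_mul_chord_sub_le_of_abs_sub_le_one θ (x := x) (Nat.cast_nonneg m) hc0 hmc
      have h4 : 2 * x ^ 2 * G m θ ≤ 2 * x ^ 2 * G n θ + 2 * x ^ 2 * G (n - 1) θ := by
        have := hG0 n θ
        have := hG0 (n - 1) θ
        rcases hm with h | h
        · rw [h]; exact le_add_of_nonneg_right (by positivity)
        · rw [h]; exact le_add_of_nonneg_left (by positivity)
      have e : (1 + (p : ℂ) * (Complex.exp (θ * Complex.I) - 1)) ^ m -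
          Complex.exp ((c * x ^ 2 : ℝ) * (Complex.exp (θ * Complex.I) - 1)) =
          ((1 + p * chord θ) ^ m - Complex.exp (m * p * chord θ)) +
          (Complex.exp (m * p * chord θ) - Complex.exp (m * (x ^ 2 : ℝ) * chord θ)) +
          (Complex.exp ((m : ℝ) * (x ^ 2 : ℝ) * chord θ) -
            Complex.exp (((c * x ^ 2 : ℝ) : ℂ) * chord θ)) := by
        rw [Complex.ofReal_natCast, sub_add_sub_cancel, sub_add_sub_cancel]; rfl
      rw [e]
      refine (norm_add₃_le).trans ?_
      linarith
end

end RandomWaypoint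


theorem theorem1 :
    ∃ C : ℝ, 0 < C ∧
      ∀ (M n : ℕ) (ρ r smin smax : ℝ), n ≤ M → 0 < ρ → 0 < r → 0 < smin → smin ≤ smax →
        ∀ i : Fin M,
          (∀ t : ℝ, 0 ≤ t → ∀ j : ℕ,
            |(RandomWaypoint.law M n smin smax).real
                {ω | RandomWaypoint.cachingCount ρ r ω i t = j}
              - RandomWaypoint.q M n ρ r smin smax j| ≤ C * (r / (2 * ρ)) ^ 2) ∧
          (∀ a b : ℝ, 0 ≤ a → a < b →
            (∫⁻ ω, RandomWaypoint.arrivals ρ r ω i a b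
                ∂(RandomWaypoint.law M n smin smax)) ≠ ⊤ ∧
            |(∫⁻ ω, RandomWaypoint.arrivals ρ r ω i a b
                  ∂(RandomWaypoint.law M n smin smax)).toReal / (b - a)
                - RandomWaypoint.arrivalRate M ρ r smin smax|
              ≤ (C * (r / (2 * ρ)) ^ 2 + (smax - smin) / (smax + smin))
                * RandomWaypoint.arrivalRate M ρ r smin smax) ∧
          (∀ a b : ℝ, 0 ≤ a → a < b →
            (∫⁻ ω, RandomWaypoint.departures ρ r ω i a b
                ∂(RandomWaypoint.law M n smin smax)) ≠ ⊤ ∧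
            (∫⁻ ω, RandomWaypoint.contactTime ρ r ω i a b
                ∂(RandomWaypoint.law M n smin smax)) ≠ ⊤ ∧
            (2 ≤ M → (∫⁻ ω, RandomWaypoint.contactTime ρ r ω i a b
                ∂(RandomWaypoint.law M n smin smax)) ≠ 0 ∧
              |(∫⁻ ω, RandomWaypoint.departures ρ r ω i a b
                    ∂(RandomWaypoint.law M n smin smax)).toReal /
                  (∫⁻ ω, RandomWaypoint.contactTime ρ r ω i a b
                    ∂(RandomWaypoint.law M n smin smax)).toReal
                  - RandomWaypoint.departureRate r smin smax|
                ≤ (C * (r / (2 * ρ)) ^ 2 + (smax - smin) / (smax + smin))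
                  * RandomWaypoint.departureRate r smin smax)) := by
  refine ⟨14, by norm_num, fun M n ρ r smin smax hn hρ hr hs0 hs i => ⟨fun t _ j => ?_,
    fun a b _ hab => ?_, fun a b _ hab => ?_⟩⟩
  · exact RandomWaypoint.abs_real_cachingCount_sub_le hn hρ hr hs0 hs i t j
  · exact RandomWaypoint.arrivals_rate hn hρ hr hs0 hs (by norm_num) i hab
  · exact RandomWaypoint.departures_rate hn hρ hr hs0 hs (by norm_num) i hab
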